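/- **Theorem (supercloseness).** Let $k,\ell$ be integers with $1\le \ell\le k$, and let $\lambda,\theta\in\mathbb R$ with $\lambda\ge \tfrac12$, $\theta\ne\tfrac12$; put $\tilde\theta=1-\theta$. *Equation.* Let $T>0$ and let $u$ be a classical solution, $2\pi$-periodic in $x$ and continuous up to $t=0$, of $u_t+u_x-u_{xx}=0$ for $0<t\le T$. Assume that $u(\cdot,t)\in C^2(\mathbb R)$ and $u(\cdot,t)\in W^{k+\ell+3,\infty}(\Omega)$, $\Omega=(0,2\pi)$, with $\|u(\cdot,t)\|_{k+\ell+3,\infty}\le M$, for all $t\in[0,T]$. Put $q=u_x$. *Mesh and notation.* Let $0=x_{1/2}<x_{3/2}<\dots<x_{N+1/2}=2\pi$, $I_j=(x_{j-1/2},x_{j+1/2})$, $h_j=x_{j+1/2}-x_{j-1/2}$, $h=\max_j h_j$, and assume $\sigma h\le h_j$ for all $j$, with $\sigma>0$. Let $V_h^k$ be the space of functions whose restriction to each $I_j$ is a polynomial of degree at most $k$. For a function $v$ that is continuous on each closed cell (two-valued at nodes), $v^\mp_{j+1/2}$ are the traces at $x_{j+1/2}$ from the left and from the right (periodically, cell $N+1$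 being cell $1$), $[v]=v^+-v^-$, $v^{(\theta)}=\theta v^-+\tilde\theta v^+$, $(v,w)_j=\int_{I_j}vw\,dx$, and $\|\cdot\|$ is the norm of $L^2(0,2\pi)$. Let $D_x^{-1}v(x)=\frac{1}{\bar h_j}\int_{x_{j-1/2}}^x v\,d\tau$ on $I_j$, where $\bar h_j=h_j/2$. *Scheme.* Let $u_h,q_h:[0,T]\to V_h^k$, with $u_h$ continuous on $[0,T]$ and differentiable on $(0,T]$, satisfy for all $t\in(0,T]$, all $v,\psi\in V_h^k$ and all $j$ $$(u_{ht},v)_j-(u_h-q_h,v_x)_j+(u_h^{(\lambda)}-q_h^{(\tilde\theta)})v^-|_{j+1/2}-(u_h^{(\lambda)}-q_h^{(\tilde\theta)})v^+|_{j-1/2}=0,$$ $$(q_h,\psi)_j+(u_h,\psi_x)_j-u_h^{(\theta)}\psi^-|_{j+1/2}+u_h^{(\theta)}\psi^+|_{j-1/2}=0.$$ *Corrected interpolants.* The functions $P_\theta u,\ P^*_{\tilde\theta}q,\ w_{u,i},\ w_{q,i}\in V_h^k$ $(1\le i\le \ell)$ are determined, at each time, by the following relations for all $j$ and all polynomials $v$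 of degree at most $k-1$: $$(P_\theta u-u,v)_j=0,\qquad (P_\theta u)^{(\theta)}_{j+1/2}=u^{(\theta)}_{j+1/2};$$ $$(P^*_{\tilde\theta}q-q,v)_j=0,\qquad (P^*_{\tilde\theta}q)^{(\tilde\theta)}_{j+1/2}=q^{(\tilde\theta)}_{j+1/2}+(\lambda-\theta)[u-P_\theta u]_{j+1/2};$$ and, with $w_{u,0}=u-P_\theta u$ and $w_{q,0}=q-P^*_{\tilde\theta}q$, $$(w_{u,i}-\bar h_jD_x^{-1}w_{q,i-1},v)_j=0,\qquad (w_{u,i}^{(\theta)})_{j+1/2}=0;$$ $$(w_{q,i}-w_{u,i}-\bar h_jD_x^{-1}\partial_tw_{u,i-1},v)_j=0,\qquad (w_{q,i}^{(\tilde\theta)})_{j+1/2}=(w_{u,i}^{(\lambda)})_{j+1/2}$$ (time derivatives at the end points of $[0,T]$ are one-sided). For $\lambda=\theta$ this gives $P^*_{\tilde\theta}q=P_{\tilde\theta}q$ and $(w_{q,i}^{(\tilde\theta)})_{j+1/2}=0$. Put $$u_I^\ell=P_\theta u-\sum_{i=1}^\ell w_{u,i},\qquad q_I^\ell=P^*_{\tilde\theta}q-\sum_{i=1}^\ell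 w_{q,i}.$$ *Conclusion.* If $\|(u_I^\ell-u_h)(0)\|=0$, then for all $t\in[0,T]$ the function $\tau\mapsto\|(q_I^\ell-q_h)(\tau)\|^2$ is integrable on $[0,t]$ and $$\|(u_I^\ell-u_h)(t)\|+\Big(\int_0^t\|(q_I^\ell-q_h)(\tau)\|^2\,d\tau\Big)^{1/2}\le C(1+t)h^{k+\ell+1},$$ where $C$ depends only on $k,\ell,\lambda,\theta,\sigma,M$ (not on the mesh, $N$, $T$, $t$, or on $u,u_h,q_h$ otherwise). -/

import Mathlib

open Set MeasureTheory Polynomial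
open scoped ContDiff ENNReal

noncomputable section

namespace LDG

/-! ### Sobolev spaces of `L^∞` type, through weak derivatives -/

/-- `g` is the weak derivative of order `i` of `f` on the open set `D ⊆ ℝ`. -/
def IsWeakDeriv (D : Set ℝ) (i : ℕ) (f g : ℝ → ℝ) : Prop :=
  LocallyIntegrableOn f D volume ∧ LocallyIntegrableOn g D volume ∧
    ∀ φ : ℝ → ℝ, ContDiff ℝ ∞ φ → HasCompactSupport φ → tsupport φ ⊆ D →
      ∫ x, f x * iteratedDeriv i φ x = (-1) ^ i * ∫ x, g x * φ x

/-- The norm of `W^{m,∞}(D)`, the maximum over `i ≤ m` of the essential suprema of the weak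
derivatives of order `i`. (Weak derivatives are unique almost everywhere, so the infimum only
selects them.) It is `⊤` if a weak derivative is missing or unbounded; thus `f ∈ W^{m,∞}(D)`
means that it is finite. -/
def sobolevNorm (D : Set ℝ) (m : ℕ) (f : ℝ → ℝ) : ℝ≥0∞ :=
  ⨅ (g : ℕ → ℝ → ℝ) (_ : ∀ i ≤ m, IsWeakDeriv D i f (g i)),
    ⨆ (i : ℕ) (_ : i ≤ m), eLpNormEssSup (g i) (volume.restrict D)

/-! ### The differential equation -/

/-- `u t x` is a classical solution of `u_t + u_x - u_xx = 0` for `0 < t ≤ T`, continuous up to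
`t = 0`, that is `2π`-periodic in `x`. -/
structure IsPeriodicSolution (T : ℝ) (u : ℝ → ℝ → ℝ) : Prop where
  periodic : ∀ t ∈ Icc 0 T, Function.Periodic (u t) (2 * Real.pi)
  contDiff : ∀ t ∈ Icc 0 T, ContDiff ℝ 2 (u t)
  continuousOn : ContinuousOn (Function.uncurry u) (Icc 0 T ×ˢ univ)
  pde : ∀ t ∈ Ioc 0 T, ∀ x : ℝ,
    HasDerivWithinAt (fun s => u s x) (deriv (deriv (u t)) x - deriv (u t) x) (Icc 0 T) t

/-! ### Meshes and broken functions -/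

/-- A partition of `[0, 2π]` into `N` cells. -/
structure Mesh (N : ℕ) where
  node : Fin (N + 1) → ℝ
  strictMono : StrictMono node
  node_zero : node 0 = 0
  node_last : node (Fin.last N) = 2 * Real.pi

/-- A function defined cell by cell. Only the values of `v j` on the closed cell number `j` matter;
its values at the two end points of the cell are the one-sided traces from inside the cell. -/
abbrev Broken (N : ℕ) : Type := Fin N → ℝ → ℝ

/-- The finite element space: on each cell a polynomial of degree at most `k`. -/
abbrev Vh (N k : ℕ) : Type := Fin N → degreeLT ℝ (k + 1)

/-- A finite element function as a broken function. -/
def Vh.toBroken {N k : ℕ} (v : Vh N k) : Broken N := fun j x => (v j : ℝ[X]).eval x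

/-- The cellwise spatial derivative of a finite element function. -/
def Vh.dx {N k : ℕ} (v : Vh N k) : Broken N := fun j x => (derivative (v j : ℝ[X])).eval x

/-- The time derivative (one-sided at the end points of `[0, T]`). -/
def timeDeriv {N : ℕ} (T : ℝ) (w : ℝ → Broken N) (t : ℝ) : Broken N :=
  fun j x => derivWithin (fun s => w s j x) (Icc 0 T) t

namespace Mesh

variable {N : ℕ} (Th : Mesh N)

/-- Left end point of cell `j`. -/
def left (j : Fin N) : ℝ := Th.node j.castSucc

/-- Right end point of cell `j`. -/
def right (j : Fin N) : ℝ := Th.node j.succ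

/-- Length of cell `j`. -/
def cellLength (j : Fin N) : ℝ := Th.right j - Th.left j

/-- The mesh size, that is the largest cell length. -/
def size : ℝ := ⨆ j, Th.cellLength j

/-- Quasi-uniformity with constant `σ`. -/
def QuasiUniform (σ : ℝ) : Prop := ∀ j, σ * Th.size ≤ Th.cellLength j

/-- The integral of `f * g` over cell `j`. -/
def cellInner (j : Fin N) (f g : ℝ → ℝ) : ℝ := ∫ x in (Th.left j)..(Th.right j), f x * g x

/-- The `L²` norm over `[0, 2π]` of a broken function. -/
def l2norm (v : Broken N) : ℝ := √(∑ j, Th.cellInner j (v j) (v j))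

/-- Trace from the left, at the right end point of cell `j`. -/
def minus (v : Broken N) (j : Fin N) : ℝ := v j (Th.right j)

/-- Trace from the right, at the right end point of cell `j`: taken from the next cell, which is
the first one after the last one by periodicity. -/
def plus (v : Broken N) (j : Fin N) : ℝ := v (finRotate N j) (Th.left (finRotate N j))

/-- Jump at the right end point of cell `j`. -/
def jump (v : Broken N) (j : Fin N) : ℝ := Th.plus v j - Th.minus v j

/-- Weighted average `θ v⁻ + (1 - θ) v⁺` at the right end point of cell `j`. -/
def wavg (θ : ℝ) (v : Broken N) (j : Fin N) : ℝ := θ * Th.minus v j + (1 - θ) * Th.plus v j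

/-- The integral operator `D_x⁻¹ v (x) = (2 / h_j) ∫_{left end of cell j}^x v`. -/
def dxInv (v : Broken N) : Broken N :=
  fun j x => (Th.cellLength j / 2)⁻¹ * ∫ y in (Th.left j)..x, v j y

/-! ### The scheme -/

/-- `(uh, qh)` is a solution on `[0, T]` of the semidiscrete LDG scheme with the generalized
alternating fluxes `uh^(lam) - qh^(1-θ)` and `uh^(θ)`. The end points of cell `j` are the right
end points of the cells `j` and `(finRotate N).symm j`. -/
structure IsLDGSolution {k : ℕ} (lam θ T : ℝ) (uh qh : ℝ → Vh N k) : Prop where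
  continuousOn : ∀ j x, ContinuousOn (fun t => (uh t).toBroken j x) (Icc 0 T)
  differentiable : ∀ t ∈ Ioc 0 T, ∀ j x,
    DifferentiableWithinAt ℝ (fun s => (uh s).toBroken j x) (Icc 0 T) t
  eq_u : ∀ t ∈ Ioc 0 T, ∀ (v : Vh N k) (j : Fin N),
    Th.cellInner j (timeDeriv T (fun s => (uh s).toBroken) t j) (v.toBroken j)
      - Th.cellInner j (fun x => (uh t).toBroken j x - (qh t).toBroken j x) (v.dx j)
      + (Th.wavg lam (uh t).toBroken j - Th.wavg (1 - θ) (qh t).toBroken j)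
          * v.toBroken j (Th.right j)
      - (Th.wavg lam (uh t).toBroken ((finRotate N).symm j)
            - Th.wavg (1 - θ) (qh t).toBroken ((finRotate N).symm j))
          * v.toBroken j (Th.left j) = 0
  eq_q : ∀ t ∈ Ioc 0 T, ∀ (ψ : Vh N k) (j : Fin N),
    Th.cellInner j ((qh t).toBroken j) (ψ.toBroken j)
      + Th.cellInner j ((uh t).toBroken j) (ψ.dx j)
      - Th.wavg θ (uh t).toBroken j * ψ.toBroken j (Th.right j)
      + Th.wavg θ (uh t).toBroken ((finRotate N).symm j) * ψ.toBroken j (Th.left j) = 0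

/-! ### Projections and correction functions -/

/-- `p` has on each cell the same moments as `g` against polynomials of degree at most `k - 1`,
and its `θ`-weighted averages at the nodes are the prescribed numbers `b`. -/
def IsRadau {k : ℕ} (θ : ℝ) (g : Broken N) (b : Fin N → ℝ) (p : Vh N k) : Prop :=
  (∀ j, ∀ r ∈ degreeLT ℝ k, Th.cellInner j (fun x => p.toBroken j x - g j x) (fun x => r.eval x) = 0)
    ∧ ∀ j, Th.wavg θ p.toBroken j = b j

/-- The finite element function determined by `IsRadau`; for `θ ≠ 1/2` it exists and is unique. -/
def radau (k : ℕ) (θ : ℝ) (g : Broken N) (b : Fin N → ℝ) : Vh N k :=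
  Classical.epsilon (Th.IsRadau θ g b)

/-- The generalized Gauss--Radau projection `P_θ`. -/
def projU (k : ℕ) (θ : ℝ) (z : Broken N) : Vh N k := Th.radau k θ z (Th.wavg θ z)

/-- The modified projection `P*_{1-θ} q` of the pair `(z, q)`. For `lam = θ` the jump term vanishes
and this is the generalized Gauss--Radau projection `P_{1-θ} q`. -/
def projQ (k : ℕ) (lam θ : ℝ) (z q : Broken N) : Vh N k :=
  Th.radau k (1 - θ) q (fun j => Th.wavg (1 - θ) q j
    + (lam - θ) * Th.jump (fun j x => z j x - (Th.projU k θ z).toBroken j x) j)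

/-- One step of the construction of the correction functions, for `u`: the moments are those of
`(h_j / 2) D_x⁻¹ w_q`, the `θ`-averages are zero. -/
def stepU (k : ℕ) (θ : ℝ) (wq : Broken N) : Vh N k :=
  Th.radau k θ (fun j x => Th.cellLength j / 2 * Th.dxInv wq j x) 0

/-- One step of the construction of the correction functions, for `q`: the moments are those of
`w_u' + (h_j / 2) D_x⁻¹ ∂_t w_u`, where `w_u'` is the new and `w_u` the old correction for `u`; the
`(1 - θ)`-averages are the `lam`-averages of `w_u'` (which are zero for `lam = θ`). -/
def stepQ (k : ℕ) (lam θ : ℝ) (wu' dtwu : Broken N) : Vh N k :=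
  Th.radau k (1 - θ) (fun j x => wu' j x + Th.cellLength j / 2 * Th.dxInv dtwu j x)
    (Th.wavg lam wu')

/-- The pair `(w_{u,i}, w_{q,i})` as functions of time, for a function `u t x` and `q = u_x`. -/
def corr (k : ℕ) (lam θ T : ℝ) (u : ℝ → ℝ → ℝ) : ℕ → (ℝ → Broken N) × (ℝ → Broken N)
  | 0 =>
    (fun t j x => u t x - (Th.projU k θ (fun _ => u t)).toBroken j x,
     fun t j x => deriv (u t) x
      - (Th.projQ k lam θ (fun _ => u t) (fun _ => deriv (u t))).toBroken j x)
  | i + 1 =>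
    let w := corr k lam θ T u i
    let wu' : ℝ → Broken N := fun t => (Th.stepU k θ (w.2 t)).toBroken
    (wu', fun t => (Th.stepQ k lam θ (wu' t) (timeDeriv T w.1 t)).toBroken)

/-- The corrected interpolant `u_I^ℓ = P_θ u - ∑_{i=1}^ℓ w_{u,i}`. -/
def uI (k ℓ : ℕ) (lam θ T : ℝ) (u : ℝ → ℝ → ℝ) (t : ℝ) : Broken N := fun j x =>
  (Th.projU k θ (fun _ => u t)).toBroken j x
    - ∑ i ∈ Finset.Icc 1 ℓ, (Th.corr k lam θ T u i).1 t j x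

/-- The corrected interpolant `q_I^ℓ = P*_{1-θ} q - ∑_{i=1}^ℓ w_{q,i}`, where `q = u_x`. -/
def qI (k ℓ : ℕ) (lam θ T : ℝ) (u : ℝ → ℝ → ℝ) (t : ℝ) : Broken N := fun j x =>
  (Th.projQ k lam θ (fun _ => u t) (fun _ => deriv (u t))).toBroken j x
    - ∑ i ∈ Finset.Icc 1 ℓ, (Th.corr k lam θ T u i).2 t j x

end Mesh

end LDG

end

namespace LDG

/-! ### Polynomials on an interval -/

/-! Subtracting the scheme from the equations for `u` and `q = u_x` shows that the error of an
interpolant is driven by its residual in the two discrete equations. For the projections alone this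
residual is of order `h^(k+1)`. The corrections make it telescope: testing step `i + 1` with `v_x`
and integrating the primitive by parts gives minus the residual left by step `i`, and the node
conditions cancel every flux term. Only `(∂_t w_{u,ℓ}, v)` and `(w_{q,ℓ}, ψ)` survive
(`Mesh.corrOp_sum_inner`, `Mesh.error_equations`). Each step takes a primitive over one cell and
gains a factor `h`, so the survivors are of order `h^(k+ℓ+1)` (`Mesh.exists_corrOp_error`). The
integration by parts leaves no boundary term because the corrections of order `i < k` are orthogonal
to constants (`Mesh.corrOp_orth`); this is where `ℓ ≤ k` enters.

Testing the error equations with the errors themselves reduces all flux and volume terms to `λ -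
1/2` times the sum of squared jumps (`Mesh.energy_nonneg`). A Gronwall argument for the square root
of the energy then gives growth linear in `t` (`sqrt_add_sqrt_integral_le`).

The constants do not depend on the mesh. A Gauss-Radau projection is a local `L²` projection plus
one multiple of a Legendre polynomial per cell; the multiples solve a cyclic two-term system, which
is strictly dominated by one of its coefficients since `θ ≠ 1/2` means `|θ| ≠ |1 - θ|`
(`Mesh.circulant_bound`).

The time derivatives need separate care, as the regularity assumption concerns space derivatives at
fixed times. The corrections are linear in the sequence of space derivatives of `u`, on which `∂_t`
acts as `evo`. Weak derivatives are first replaced by classical Lipschitz ones (`exists_jet`).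
Landau's interpolation inequality makes them continuous in time, uniformly in `x`
(`JetFlow.eventually_close`), and the differential equation passes to them in integrated form
(`JetFlow.sub_eq_integral`). Boundedness of the correction operators transports the resulting time
derivative to the corrections (`JetFlow.corr_eq`). -/

lemma polyIntegrable (p : ℝ[X]) (a b : ℝ) :
    IntervalIntegrable (fun x => p.eval x) volume a b :=
  p.continuous.intervalIntegrable a b

lemma intervalIntegrable_mul_poly {a b : ℝ} (hab : a ≤ b) {g : ℝ → ℝ}
    (hg : ContinuousOn g (Icc a b)) (p : ℝ[X]) :
    IntervalIntegrable (fun x => g x * p.eval x) volume a b :=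
  (hg.mul p.continuous.continuousOn).intervalIntegrable_of_Icc hab

lemma derivative_mem_degreeLT {n : ℕ} {p : ℝ[X]} (hp : p ∈ degreeLT ℝ (n + 1)) :
    derivative p ∈ degreeLT ℝ n := by
  rw [mem_degreeLT, degree_lt_iff_coeff_zero] at *
  intro m hm
  rw [coeff_derivative, hp (m + 1) (by omega), zero_mul]

/-- Lets a test polynomial be written as a derivative, so that moments of a primitive become moments
of its integrand. -/
lemma exists_antiderivative {n : ℕ} {r : ℝ[X]} (hr : r ∈ degreeLT ℝ n) :
    ∃ R ∈ degreeLT ℝ (n + 1), derivative R = r := by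
  refine ⟨∑ i ∈ Finset.range n, monomial (i + 1) (r.coeff i / (i + 1)), ?_, ?_⟩
  · refine Submodule.sum_mem _ fun i hi => ?_
    rw [mem_degreeLT]
    refine lt_of_le_of_lt (degree_monomial_le _ _) ?_
    have := Finset.mem_range.mp hi
    exact_mod_cast (by omega : i + 1 < n + 1)
  · rw [derivative_sum]
    have h : ∀ i ∈ Finset.range n, derivative (monomial (i + 1) (r.coeff i / (i + 1)))
        = monomial i (r.coeff i) := by
      intro i _
      rw [derivative_monomial]
      have : ((i : ℝ) + 1) ≠ 0 := by positivity
      congr 1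
      push_cast
      field_simp
    rw [Finset.sum_congr rfl h]
    by_cases h0 : r = 0
    · simp [h0]
    · rw [mem_degreeLT] at hr
      exact (as_sum_range' r n ((natDegree_lt_iff_degree_lt h0).mpr hr)).symm

lemma integral_mul_derivative {a b : ℝ} {f f' : ℝ → ℝ} (hab : a ≤ b)
    (hf : ∀ x ∈ Icc a b, HasDerivWithinAt f (f' x) (Icc a b) x)
    (hf' : ContinuousOn f' (Icc a b)) (p : ℝ[X]) :
    ∫ x in a..b, f x * (derivative p).eval x
      = f b * p.eval b - f a * p.eval a - ∫ x in a..b, f' x * p.eval x := by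
  have := intervalIntegral.integral_mul_deriv_eq_deriv_mul_of_hasDerivWithinAt
    (a := a) (b := b) (u := f) (u' := f') (v := fun x => p.eval x)
    (v' := fun x => (derivative p).eval x)
    (by rwa [uIcc_of_le hab]) (fun x _ => (p.hasDerivAt x).hasDerivWithinAt)
    (hf'.intervalIntegrable_of_Icc hab) (polyIntegrable _ _ _)
  exact this

lemma hasDerivWithinAt_primitive {a b : ℝ} {v : ℝ → ℝ}
    (hv : ContinuousOn v (Icc a b)) :
    ∀ x ∈ Icc a b, HasDerivWithinAt (fun y => ∫ z in a..y, v z) (v x) (Icc a b) x := by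
  intro x hx
  have : Fact (x ∈ Icc a b) := ⟨hx⟩
  exact intervalIntegral.integral_hasDerivWithinAt_right
    ((hv.mono (Icc_subset_Icc_right hx.2)).intervalIntegrable_of_Icc hx.1)
    (hv.stronglyMeasurableAtFilter_nhdsWithin measurableSet_Icc x) (hv x hx)

/-! ### Legendre polynomials -/

/-- The shifted Legendre polynomial with real coefficients. -/
noncomputable def leg (n : ℕ) : ℝ[X] := (shiftedLegendre n).map (Int.castRingHom ℝ)

lemma degree_leg (n : ℕ) : (leg n).degree = n := by
  rw [leg, degree_map_eq_of_injective (RingHom.injective_int _), degree_shiftedLegendre]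

lemma leg_mem (n : ℕ) : leg n ∈ degreeLT ℝ (n + 1) := by
  rw [mem_degreeLT, degree_leg]; exact_mod_cast Nat.lt_succ_self n

lemma leg_ne_zero (n : ℕ) : leg n ≠ 0 := by
  intro h
  have := degree_leg n
  rw [h] at this
  simp at this

lemma leg_eval_zero (n : ℕ) : (leg n).eval 0 = 1 := by
  rw [← coeff_zero_eq_eval_zero, leg, coeff_map, coeff_shiftedLegendre]
  simp

lemma leg_eval_one (n : ℕ) : (leg n).eval 1 = (-1) ^ n := by
  have h := shiftedLegendre_eval_symm n (1 : ℝ)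
  have e : ∀ x : ℝ, aeval x (shiftedLegendre n) = (leg n).eval x := by
    intro x
    rw [leg, eval_map, aeval_def]; rfl
  rw [e, e, sub_self, leg_eval_zero] at h
  simpa using h

/-- Rodrigues' formula. -/
lemma factorial_smul_leg (n : ℕ) :
    (n.factorial : ℝ[X]) * leg n = derivative^[n] (X ^ n * (1 - X) ^ n) := by
  have := congrArg (map (Int.castRingHom ℝ)) (factorial_mul_shiftedLegendre_eq n)
  rw [Polynomial.map_mul, ← iterate_derivative_map] at this
  simpa [leg] using this

/-- By Rodrigues' formula, `n` integrations by parts move all derivatives onto `v`, whose degree is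
below `n`. -/
lemma leg_orthogonal (n : ℕ) {v : ℝ[X]} (hv : v ∈ degreeLT ℝ n) :
    ∫ x in (0 : ℝ)..1, (leg n).eval x * v.eval x = 0 := by
  set w : ℝ[X] := X ^ n * (1 - X) ^ n with hw
  have key : ∀ m ≤ n, ∀ v : ℝ[X], ∫ x in (0 : ℝ)..1, (derivative^[m] w).eval x * v.eval x
      = (-1) ^ m * ∫ x in (0 : ℝ)..1, w.eval x * (derivative^[m] v).eval x := by
    intro m
    induction m with
    | zero => intro _ v; simp
    | succ m ih =>
      intro hm v
      -- There are no boundary terms: after `m < n` differentiations the factors `X ^ (n - m)` and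
      -- `(1 - X) ^ (n - m)` still divide.
      have hroot : ∀ c : ℝ, (c = 0 ∨ c = 1) → (derivative^[m] w).eval c = 0 := by
        intro c hc
        rcases hc with rfl | rfl
        · have h1 : (X : ℝ[X]) ^ (n - m) ∣ derivative^[m] w :=
            pow_sub_dvd_iterate_derivative_of_pow_dvd m (Dvd.intro _ rfl)
          obtain ⟨q, hq⟩ := h1
          rw [hq]; simp; left; omega
        · have h1 : (1 - X : ℝ[X]) ^ (n - m) ∣ derivative^[m] w :=
            pow_sub_dvd_iterate_derivative_of_pow_dvd m (Dvd.intro_left _ rfl)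
          obtain ⟨q, hq⟩ := h1
          rw [hq]; simp; left; omega
      have h := integral_mul_derivative (a := 0) (b := 1) (f := fun x => v.eval x)
        (f' := fun x => (derivative v).eval x) zero_le_one
        (fun x _ => (v.hasDerivAt x).hasDerivWithinAt) (derivative v).continuous.continuousOn
        (derivative^[m] w)
      rw [hroot 0 (Or.inl rfl), hroot 1 (Or.inr rfl)] at h
      have h2 := ih (by omega) (derivative v)
      rw [Function.iterate_succ_apply', Function.iterate_succ_apply]
      rw [pow_succ]
      have e1 : ∀ p q : ℝ[X], ∫ x in (0 : ℝ)..1, p.eval x * q.eval x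
          = ∫ x in (0 : ℝ)..1, q.eval x * p.eval x := by
        intro p q; congr 1; ext x; ring
      rw [e1, h, e1, h2]; ring
  have h := key n le_rfl v
  rw [← factorial_smul_leg] at h
  have hz : derivative^[n] v = 0 := by
    by_cases h0 : v = 0
    · simp [h0]
    · exact iterate_derivative_eq_zero ((natDegree_lt_iff_degree_lt h0).mpr (mem_degreeLT.mp hv))
  rw [hz] at h
  have h3 : ∫ x in (0 : ℝ)..1, ((n.factorial : ℝ[X]) * leg n).eval x * v.eval x
      = n.factorial * ∫ x in (0 : ℝ)..1, (leg n).eval x * v.eval x := by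
    rw [← intervalIntegral.integral_const_mul]
    congr 1; ext x; simp [mul_assoc]
  rw [h3] at h
  have : (n.factorial : ℝ) ≠ 0 := by exact_mod_cast n.factorial_ne_zero
  simpa [this] using h

lemma leg_sq_pos (n : ℕ) : 0 < ∫ x in (0 : ℝ)..1, (leg n).eval x * (leg n).eval x := by
  refine intervalIntegral.integral_pos zero_lt_one
    ((leg n).continuous.mul (leg n).continuous).continuousOn
    (fun x _ => mul_self_nonneg _) ⟨0, by simp, ?_⟩
  rw [leg_eval_zero]; norm_num

lemma exists_sub_leg_mem {k : ℕ} {r : ℝ[X]} (hr : r ∈ degreeLT ℝ (k + 1)) :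
    ∃ c : ℝ, r - c • leg k ∈ degreeLT ℝ k := by
  have hl : (leg k).coeff k ≠ 0 := by
    have := leadingCoeff_ne_zero.mpr (leg_ne_zero k)
    rwa [leadingCoeff, natDegree_eq_of_degree_eq_some (degree_leg k)] at this
  refine ⟨r.coeff k / (leg k).coeff k, ?_⟩
  rw [mem_degreeLT]
  rw [degree_lt_iff_coeff_zero]
  intro m hm
  rcases Nat.eq_or_lt_of_le hm with rfl | h
  · simp only [coeff_sub, coeff_smul, smul_eq_mul]
    field_simp; ring
  · have h1 : r.coeff m = 0 := by
      rw [mem_degreeLT, degree_lt_iff_coeff_zero] at hr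
      exact hr m (by omega)
    have h2 : (leg k).coeff m = 0 := by
      apply coeff_eq_zero_of_degree_lt
      rw [degree_leg]; exact_mod_cast h
    simp [h1, h2]

lemma poly_eq_zero_of_integral_sq {p : ℝ[X]} {a b : ℝ} (hab : a < b)
    (h : ∫ x in a..b, p.eval x * p.eval x = 0) : p = 0 := by
  by_contra hp
  have hz : ∀ x ∈ Icc a b, p.eval x = 0 := by
    by_contra hne
    push Not at hne
    obtain ⟨c, hc, hc0⟩ := hne
    have := intervalIntegral.integral_pos hab
      ((p.continuous.mul p.continuous).continuousOn (s := Icc a b))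
      (fun x _ => mul_self_nonneg _) ⟨c, hc, mul_self_pos.mpr hc0⟩
    simp only [Pi.mul_apply] at this
    linarith
  exact hp (eq_zero_of_infinite_isRoot p ((Icc_infinite hab).mono fun x hx => hz x hx))

/-- The local `L²` projection onto polynomials, bounded in the maximum norm, on `[0, 1]`. -/
lemma exists_proj_unit (k : ℕ) : ∃ C : ℝ, 0 ≤ C ∧ ∀ g : ℝ → ℝ, ContinuousOn g (Icc 0 1) →
    ∃ r ∈ degreeLT ℝ k, (∀ v ∈ degreeLT ℝ k,
      ∫ x in (0 : ℝ)..1, (r.eval x - g x) * v.eval x = 0) ∧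
      ∀ A, (∀ x ∈ Icc (0 : ℝ) 1, |g x| ≤ A) → ∀ x ∈ Icc (0 : ℝ) 1, |r.eval x| ≤ C * A := by
  induction k with
  | zero =>
    refine ⟨0, le_rfl, fun g _ => ⟨0, Submodule.zero_mem _, ?_, ?_⟩⟩
    · intro v hv
      have : v = 0 := by
        rw [mem_degreeLT] at hv
        simpa using hv
      simp [this]
    · simp
  | succ k ih =>
    obtain ⟨C, hC, ih⟩ := ih
    obtain ⟨B, hB⟩ := (isCompact_Icc (a := (0 : ℝ)) (b := 1)).exists_bound_of_continuousOn
      (leg k).continuous.continuousOn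
    have hB0 : 0 ≤ B := le_trans (norm_nonneg _) (hB 0 (by simp))
    set D := ∫ x in (0 : ℝ)..1, (leg k).eval x * (leg k).eval x with hD
    have hDpos : 0 < D := leg_sq_pos k
    refine ⟨C + B * B / D, by positivity, fun g hg => ?_⟩
    obtain ⟨r, hr, horth, hbd⟩ := ih g hg
    -- The Fourier coefficient of `g` along the next Legendre polynomial, which is orthogonal to
    -- everything of lower degree.
    set c := (∫ x in (0 : ℝ)..1, g x * (leg k).eval x) / D with hc
    have hint := intervalIntegrable_mul_poly zero_le_one hg
    have hintp : ∀ p q : ℝ[X], IntervalIntegrable (fun x => p.eval x * q.eval x) volume 0 1 :=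
      fun p q => intervalIntegrable_mul_poly zero_le_one p.continuous.continuousOn q
    refine ⟨r + c • leg k, ?_, ?_, ?_⟩
    · exact Submodule.add_mem _ (degreeLT_mono (Nat.le_succ k) hr)
        (Submodule.smul_mem _ _ (leg_mem k))
    · intro v hv
      obtain ⟨d, hd⟩ := exists_sub_leg_mem hv
      have h1 := horth _ hd
      have h2 := leg_orthogonal k hd
      have h3 := leg_orthogonal k hr
      simp only [eval_sub, eval_smul, smul_eq_mul, eval_add] at *
      have e : ∀ x, (r.eval x + c * (leg k).eval x - g x) * v.eval x =
          (r.eval x - g x) * (v.eval x - d * (leg k).eval x)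
          + c * ((leg k).eval x * (v.eval x - d * (leg k).eval x))
          + d * ((leg k).eval x * r.eval x) + (d * c) * ((leg k).eval x * (leg k).eval x)
          - d * (g x * (leg k).eval x) := by intro x; ring
      have i1 : IntervalIntegrable
          (fun x => (r.eval x - g x) * (v.eval x - d * (leg k).eval x)) volume 0 1 := by
        have := intervalIntegrable_mul_poly zero_le_one
          (r.continuous.continuousOn.sub hg) (v - d • leg k)
        simpa using this
      have i2 : IntervalIntegrable
          (fun x => c * ((leg k).eval x * (v.eval x - d * (leg k).eval x))) volume 0 1 := by
        have := (hintp (leg k) (v - d • leg k)).const_mul c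
        simpa using this
      have i3 := (hintp (leg k) r).const_mul d
      have i4 := (hintp (leg k) (leg k)).const_mul (d * c)
      have i5 := (hint (leg k)).const_mul d
      rw [intervalIntegral.integral_congr (fun x _ => e x)]
      rw [intervalIntegral.integral_sub (((i1.add i2).add i3).add i4) i5,
        intervalIntegral.integral_add ((i1.add i2).add i3) i4,
        intervalIntegral.integral_add (i1.add i2) i3, intervalIntegral.integral_add i1 i2]
      simp only [intervalIntegral.integral_const_mul]
      rw [h1, h2, h3, ← hD, hc]
      field_simp; ring
    · intro A hA x hx
      have hA0 : 0 ≤ A := le_trans (abs_nonneg _) (hA 0 (by simp))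
      have hcb : |c| ≤ A * B / D := by
        rw [hc, abs_div, abs_of_pos hDpos]
        gcongr
        have := intervalIntegral.norm_integral_le_of_norm_le_const (a := (0 : ℝ)) (b := 1)
          (f := fun x => g x * (leg k).eval x) (C := A * B) (by
            intro x hx
            rw [uIoc_of_le zero_le_one] at hx
            have hx' : x ∈ Icc (0 : ℝ) 1 := Ioc_subset_Icc_self hx
            rw [norm_mul]
            exact mul_le_mul (hA x hx') (hB x hx') (norm_nonneg _) hA0)
        simpa using this
      simp only [eval_add, eval_smul, smul_eq_mul]
      calc |r.eval x + c * (leg k).eval x| ≤ |r.eval x| + |c| * |(leg k).eval x| := by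
            rw [← abs_mul]; exact abs_add_le _ _
        _ ≤ C * A + (A * B / D) * B := by
            gcongr
            · exact hbd A hA x hx
            · exact hB x hx
        _ = (C + B * B / D) * A := by ring

/-- Pull-back of a polynomial on `[a, b]` to `[0, 1]`. -/
noncomputable def pull (a b : ℝ) (p : ℝ[X]) : ℝ[X] := p.comp (C (b - a) * X + C a)

/-- Transport of a polynomial on `[0, 1]` to `[a, b]`. -/
noncomputable def push (a b : ℝ) (p : ℝ[X]) : ℝ[X] :=
  p.comp (C (b - a)⁻¹ * X + C (-((b - a)⁻¹ * a)))

lemma comp_mem_degreeLT {n : ℕ} {p : ℝ[X]} (hp : p ∈ degreeLT ℝ n) (c d : ℝ) :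
    p.comp (C c * X + C d) ∈ degreeLT ℝ n := by
  by_cases h0 : p = 0
  · subst h0; simp
  · by_cases h1 : p.comp (C c * X + C d) = 0
    · rw [h1]; exact Submodule.zero_mem _
    · rw [mem_degreeLT] at *
      rw [← natDegree_lt_iff_degree_lt h1]
      rw [← natDegree_lt_iff_degree_lt h0] at hp
      refine lt_of_le_of_lt (natDegree_comp_le.trans ?_) hp
      have := natDegree_linear_le (a := c) (b := d)
      nlinarith

lemma pull_eval (a b : ℝ) (p : ℝ[X]) (s : ℝ) : (pull a b p).eval s = p.eval ((b - a) * s + a) := by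
  simp [pull]

lemma push_eval (a b : ℝ) (p : ℝ[X]) (x : ℝ) :
    (push a b p).eval x = p.eval ((b - a)⁻¹ * (x - a)) := by
  simp only [push, eval_comp, eval_add, eval_mul, eval_C, eval_X]
  congr 1; ring

lemma integral_eq_unit {a b : ℝ} (hab : a < b) (f : ℝ → ℝ) :
    ∫ x in a..b, f x = (b - a) * ∫ s in (0 : ℝ)..1, f ((b - a) * s + a) := by
  have h : b - a ≠ 0 := by linarith
  rw [intervalIntegral.integral_comp_mul_add f h a]
  simp [h]

lemma affine_mem {a b s : ℝ} (hab : a ≤ b) (hs : s ∈ Icc (0 : ℝ) 1) :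
    (b - a) * s + a ∈ Icc a b := by
  constructor
  · nlinarith [hs.1]
  · nlinarith [hs.2]

lemma affine_inv_mem {a b x : ℝ} (hab : a < b) (hx : x ∈ Icc a b) :
    (b - a)⁻¹ * (x - a) ∈ Icc (0 : ℝ) 1 := by
  have h : 0 < b - a := by linarith
  constructor
  · have := hx.1; have : 0 ≤ x - a := by linarith
    positivity
  · rw [inv_mul_le_iff₀ h]; linarith [hx.2]

/-- The Legendre polynomial of degree `k` on the interval `[a, b]`. -/
noncomputable def legOn (a b : ℝ) (k : ℕ) : ℝ[X] := push a b (leg k)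

lemma legOn_mem (a b : ℝ) (k : ℕ) : legOn a b k ∈ degreeLT ℝ (k + 1) :=
  comp_mem_degreeLT (leg_mem k) _ _

lemma legOn_left (a b : ℝ) (k : ℕ) : (legOn a b k).eval a = 1 := by
  rw [legOn, push_eval]; simp [leg_eval_zero]

lemma legOn_right {a b : ℝ} (hab : a < b) (k : ℕ) : (legOn a b k).eval b = (-1) ^ k := by
  rw [legOn, push_eval, inv_mul_cancel₀ (by linarith), leg_eval_one]

lemma push_pull {a b : ℝ} (hab : a < b) (p : ℝ[X]) : push a b (pull a b p) = p := by
  apply Polynomial.funext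
  intro x
  rw [push_eval, pull_eval]
  congr 1
  have : b - a ≠ 0 := by linarith
  field_simp; ring

lemma pull_push_eval {a b : ℝ} (hab : a < b) (p : ℝ[X]) (s : ℝ) :
    (push a b p).eval ((b - a) * s + a) = p.eval s := by
  rw [push_eval]
  congr 1
  have : b - a ≠ 0 := by linarith
  field_simp; ring

lemma legOn_orthogonal {a b : ℝ} (hab : a < b) (k : ℕ) {v : ℝ[X]} (hv : v ∈ degreeLT ℝ k) :
    ∫ x in a..b, (legOn a b k).eval x * v.eval x = 0 := by
  rw [integral_eq_unit hab]
  have := leg_orthogonal k (comp_mem_degreeLT hv (b - a) a)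
  simp only [legOn, pull_push_eval hab]
  simp only [eval_comp, eval_add, eval_mul, eval_C, eval_X] at this
  rw [this, mul_zero]

lemma exists_legOn_bound (k : ℕ) : ∃ C : ℝ, 0 ≤ C ∧ ∀ a b : ℝ, a < b → ∀ x ∈ Icc a b,
    |(legOn a b k).eval x| ≤ C := by
  obtain ⟨B, hB⟩ := (isCompact_Icc (a := (0 : ℝ)) (b := 1)).exists_bound_of_continuousOn
    (leg k).continuous.continuousOn
  refine ⟨B, le_trans (norm_nonneg _) (hB 0 (by simp)), fun a b hab x hx => ?_⟩
  rw [legOn, push_eval]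
  exact hB _ (affine_inv_mem hab hx)

lemma exists_sub_legOn_mem {a b : ℝ} (hab : a < b) {k : ℕ} {r : ℝ[X]}
    (hr : r ∈ degreeLT ℝ (k + 1)) : ∃ c : ℝ, r - c • legOn a b k ∈ degreeLT ℝ k := by
  obtain ⟨c, hc⟩ := exists_sub_leg_mem (comp_mem_degreeLT hr (b - a) a)
  refine ⟨c, ?_⟩
  have := comp_mem_degreeLT hc (b - a)⁻¹ (-((b - a)⁻¹ * a))
  rw [sub_comp, smul_comp] at this
  have h2 := push_pull hab r
  rw [push, pull] at h2
  rwa [h2] at this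

/-- Once the top Legendre component is removed, the remainder is orthogonal to itself. Consequently
the moments below degree `k` leave exactly one free number per cell. -/
lemma eq_smul_legOn {a b : ℝ} (hab : a < b) {k : ℕ} {r : ℝ[X]} (hr : r ∈ degreeLT ℝ (k + 1))
    (horth : ∀ v ∈ degreeLT ℝ k, ∫ x in a..b, r.eval x * v.eval x = 0) :
    ∃ c : ℝ, r = c • legOn a b k := by
  obtain ⟨c, hc⟩ := exists_sub_legOn_mem hab hr
  refine ⟨c, sub_eq_zero.mp (poly_eq_zero_of_integral_sq hab ?_)⟩
  have h1 := horth _ hc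
  have h2 := legOn_orthogonal hab k hc
  have e : ∀ x, (r - c • legOn a b k).eval x * (r - c • legOn a b k).eval x
      = r.eval x * (r - c • legOn a b k).eval x
        - c * ((legOn a b k).eval x * (r - c • legOn a b k).eval x) := by
    intro x; simp; ring
  rw [intervalIntegral.integral_congr (fun x _ => e x), intervalIntegral.integral_sub,
    intervalIntegral.integral_const_mul, h1, h2]
  · simp
  · exact intervalIntegrable_mul_poly hab.le r.continuous.continuousOn _
  · exact (intervalIntegrable_mul_poly hab.le (legOn a b k).continuous.continuousOn _).const_mul c

/-- The local `L²` projection onto polynomials, bounded in the maximum norm. -/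
lemma exists_proj (k : ℕ) : ∃ C : ℝ, 0 ≤ C ∧ ∀ a b : ℝ, a < b → ∀ g : ℝ → ℝ,
    ContinuousOn g (Icc a b) →
    ∃ r ∈ degreeLT ℝ k, (∀ v ∈ degreeLT ℝ k,
      ∫ x in a..b, (r.eval x - g x) * v.eval x = 0) ∧
      ∀ A, (∀ x ∈ Icc a b, |g x| ≤ A) → ∀ x ∈ Icc a b, |r.eval x| ≤ C * A := by
  obtain ⟨C, hC, h⟩ := exists_proj_unit k
  refine ⟨C, hC, fun a b hab g hg => ?_⟩
  have hg' : ContinuousOn (fun s => g ((b - a) * s + a)) (Icc 0 1) :=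
    hg.comp (by fun_prop) fun s hs => affine_mem hab.le hs
  obtain ⟨r, hr, h1, h2⟩ := h _ hg'
  refine ⟨push a b r, comp_mem_degreeLT hr _ _, fun v hv => ?_, fun A hA x hx => ?_⟩
  · rw [integral_eq_unit hab]
    have := h1 _ (comp_mem_degreeLT hv (b - a) a)
    simp only [pull_push_eval hab]
    simp only [eval_comp, eval_add, eval_mul, eval_C, eval_X] at this
    rw [this, mul_zero]
  · rw [push_eval]
    exact h2 A (fun s hs => hA _ (affine_mem hab.le hs)) _ (affine_inv_mem hab hx)

/-! ### Elementary facts on meshes and broken functions -/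

namespace Vh

variable {N k : ℕ}

lemma toBroken_apply (v : Vh N k) (j : Fin N) (x : ℝ) :
    v.toBroken j x = (v j : ℝ[X]).eval x := rfl

lemma toBroken_continuous (v : Vh N k) (j : Fin N) : Continuous (v.toBroken j) :=
  (v j : ℝ[X]).continuous

lemma toBroken_add (v w : Vh N k) (j : Fin N) (x : ℝ) :
    Vh.toBroken (v + w) j x = v.toBroken j x + w.toBroken j x := by
  simp [toBroken_apply]

lemma toBroken_smul (c : ℝ) (v : Vh N k) (j : Fin N) (x : ℝ) :
    Vh.toBroken (c • v) j x = c * v.toBroken j x := by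
  simp [toBroken_apply]

lemma toBroken_sub (v w : Vh N k) (j : Fin N) (x : ℝ) :
    Vh.toBroken (v - w) j x = v.toBroken j x - w.toBroken j x := by
  simp [toBroken_apply]

end Vh

namespace Mesh

variable {N : ℕ} (Th : Mesh N)

lemma left_lt_right (j : Fin N) : Th.left j < Th.right j := Th.strictMono Fin.castSucc_lt_succ

lemma left_le_right (j : Fin N) : Th.left j ≤ Th.right j := (Th.left_lt_right j).le

lemma cellLength_pos (j : Fin N) : 0 < Th.cellLength j := sub_pos.mpr (Th.left_lt_right j)

lemma card_pos (Th : Mesh N) : 0 < N := by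
  rcases Nat.eq_zero_or_pos N with h | h
  · subst h
    have h0 := Th.node_zero
    have h1 := Th.node_last
    rw [show (Fin.last 0) = 0 from rfl, h0] at h1
    linarith [Real.pi_pos]
  · exact h

lemma zero_le_left (j : Fin N) : 0 ≤ Th.left j := by
  rw [← Th.node_zero]; exact Th.strictMono.monotone (Fin.zero_le _)

lemma right_le (j : Fin N) : Th.right j ≤ 2 * Real.pi := by
  rw [← Th.node_last]; exact Th.strictMono.monotone (Fin.le_last _)

lemma cell_subset (j : Fin N) : Icc (Th.left j) (Th.right j) ⊆ Icc 0 (2 * Real.pi) :=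
  Icc_subset_Icc (Th.zero_le_left j) (Th.right_le j)

lemma left_mem (j : Fin N) : Th.left j ∈ Icc (Th.left j) (Th.right j) :=
  left_mem_Icc.mpr (Th.left_le_right j)

lemma right_mem (j : Fin N) : Th.right j ∈ Icc (Th.left j) (Th.right j) :=
  right_mem_Icc.mpr (Th.left_le_right j)

lemma cellLength_le_size (j : Fin N) : Th.cellLength j ≤ Th.size :=
  le_ciSup (Set.finite_range _).bddAbove j

lemma size_pos : 0 < Th.size :=
  lt_of_lt_of_le (Th.cellLength_pos ⟨0, Th.card_pos⟩) (Th.cellLength_le_size _)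

lemma size_le : Th.size ≤ 2 * Real.pi := by
  have : Nonempty (Fin N) := ⟨⟨0, Th.card_pos⟩⟩
  refine ciSup_le fun j => ?_
  have h1 := Th.zero_le_left j
  have h2 := Th.right_le j
  unfold cellLength
  linarith

lemma periodic_left_rotate {f : ℝ → ℝ} (hf : f 0 = f (2 * Real.pi)) (j : Fin N) :
    f (Th.left (finRotate N j)) = f (Th.right j) := by
  obtain ⟨n, rfl⟩ : ∃ n, N = n + 1 := ⟨N - 1, by have := Th.card_pos; omega⟩
  by_cases h : j = Fin.last n
  · subst h
    rw [finRotate_last, left, right, Fin.castSucc_zero, Th.node_zero, Fin.succ_last,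
      Th.node_last, hf]
  · have hj : (j : ℕ) < n := by
      have h1 := j.2
      have h2 : (j : ℕ) ≠ n := fun h' => h (Fin.ext h')
      omega
    rw [finRotate_of_lt hj, left, right]
    congr 2

/-- Continuity on every closed cell. -/
def CellCont (v : Broken N) : Prop := ∀ j, ContinuousOn (v j) (Icc (Th.left j) (Th.right j))

lemma CellCont.toBroken {k : ℕ} (v : Vh N k) : Th.CellCont v.toBroken :=
  fun j => (v.toBroken_continuous j).continuousOn

variable {Th} in
lemma CellCont.combo {v w : Broken N} (hv : Th.CellCont v) (hw : Th.CellCont w) (a c : ℝ) :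
    Th.CellCont (fun j x => a * v j x + c * w j x) :=
  fun j => (continuousOn_const.mul (hv j)).add (continuousOn_const.mul (hw j))

lemma cellInner_congr (j : Fin N) {f f' g g' : ℝ → ℝ}
    (hf : ∀ x ∈ Icc (Th.left j) (Th.right j), f x = f' x)
    (hg : ∀ x ∈ Icc (Th.left j) (Th.right j), g x = g' x) :
    Th.cellInner j f g = Th.cellInner j f' g' := by
  unfold cellInner
  refine intervalIntegral.integral_congr fun x hx => ?_
  rw [uIcc_of_le (Th.left_le_right j)] at hx
  simp only [hf x hx, hg x hx]

lemma cellInner_combo (j : Fin N) {f₁ f₂ g : ℝ → ℝ} (a c : ℝ)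
    (h₁ : ContinuousOn f₁ (Icc (Th.left j) (Th.right j)))
    (h₂ : ContinuousOn f₂ (Icc (Th.left j) (Th.right j)))
    (hg : ContinuousOn g (Icc (Th.left j) (Th.right j))) :
    Th.cellInner j (fun x => a * f₁ x + c * f₂ x) g
      = a * Th.cellInner j f₁ g + c * Th.cellInner j f₂ g := by
  unfold cellInner
  rw [← intervalIntegral.integral_const_mul, ← intervalIntegral.integral_const_mul,
    ← intervalIntegral.integral_add]
  · congr 1; ext x; ring
  · exact ((h₁.mul hg).intervalIntegrable_of_Icc (Th.left_le_right j)).const_mul a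
  · exact ((h₂.mul hg).intervalIntegrable_of_Icc (Th.left_le_right j)).const_mul c

lemma cellInner_add (j : Fin N) {f₁ f₂ g : ℝ → ℝ}
    (h₁ : ContinuousOn f₁ (Icc (Th.left j) (Th.right j)))
    (h₂ : ContinuousOn f₂ (Icc (Th.left j) (Th.right j)))
    (hg : ContinuousOn g (Icc (Th.left j) (Th.right j))) :
    Th.cellInner j (fun x => f₁ x + f₂ x) g = Th.cellInner j f₁ g + Th.cellInner j f₂ g := by
  simpa using Th.cellInner_combo j 1 1 h₁ h₂ hg

lemma cellInner_sub (j : Fin N) {f₁ f₂ g : ℝ → ℝ}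
    (h₁ : ContinuousOn f₁ (Icc (Th.left j) (Th.right j)))
    (h₂ : ContinuousOn f₂ (Icc (Th.left j) (Th.right j)))
    (hg : ContinuousOn g (Icc (Th.left j) (Th.right j))) :
    Th.cellInner j (fun x => f₁ x - f₂ x) g = Th.cellInner j f₁ g - Th.cellInner j f₂ g := by
  simpa [sub_eq_add_neg] using Th.cellInner_combo j 1 (-1) h₁ h₂ hg

lemma cellInner_comm (j : Fin N) (f g : ℝ → ℝ) : Th.cellInner j f g = Th.cellInner j g f := by
  unfold cellInner; congr 1; ext x; ring

lemma wavg_congr (θ : ℝ) {v w : Broken N}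
    (h : ∀ j, ∀ x ∈ Icc (Th.left j) (Th.right j), v j x = w j x) (j : Fin N) :
    Th.wavg θ v j = Th.wavg θ w j := by
  unfold wavg minus plus
  rw [h j _ (Th.right_mem j), h _ _ (Th.left_mem _)]

lemma wavg_combo (θ : ℝ) (v w : Broken N) (a c : ℝ) (j : Fin N) :
    Th.wavg θ (fun j x => a * v j x + c * w j x) j = a * Th.wavg θ v j + c * Th.wavg θ w j := by
  unfold wavg minus plus; ring

lemma abs_wavg_le (θ : ℝ) {v : Broken N} {A : ℝ}
    (h : ∀ j, ∀ x ∈ Icc (Th.left j) (Th.right j), |v j x| ≤ A) (j : Fin N) :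
    |Th.wavg θ v j| ≤ (|θ| + |1 - θ|) * A := by
  unfold wavg minus plus
  refine (abs_add_le _ _).trans ?_
  rw [abs_mul, abs_mul, add_mul]
  gcongr
  · exact h _ _ (Th.right_mem _)
  · exact h _ _ (Th.left_mem _)

/-! ### Generalized Gauss--Radau projections -/

lemma abs_sub_abs_pos {θ : ℝ} (hθ : θ ≠ 1 / 2) : 0 < |(|θ| - |1 - θ|)| := by
  rw [abs_pos, sub_ne_zero]
  intro h
  rcases abs_eq_abs.mp h with h | h
  · exact hθ (by linarith)
  · linarith

/-- Take an index where `|c|` is largest and absorb its neighbour. If `|θ|` dominates, the relation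
used is the one in which the largest entry carries `θ`; otherwise it is the preceding one, where it
carries `1 - θ`. The bound does not involve `N`. -/
lemma circulant_bound (Th : Mesh N) {θ : ℝ} (hθ : θ ≠ 1 / 2) {s : ℝ} (hs : |s| = 1) {c : Fin N → ℝ} {B : ℝ}
    (h : ∀ j, |θ * (c j * s) + (1 - θ) * c (finRotate N j)| ≤ B) (j : Fin N) :
    |c j| ≤ B / |(|θ| - |1 - θ|)| := by
  have : Nonempty (Fin N) := ⟨⟨0, Th.card_pos⟩⟩
  obtain ⟨i, hi⟩ := Finite.exists_max fun j => |c j|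
  rw [le_div_iff₀ (abs_sub_abs_pos hθ)]
  have e : ∀ j, |θ * (c j * s)| = |θ| * |c j| := fun j => by rw [abs_mul, abs_mul, hs, mul_one]
  have e' : ∀ j, |(1 - θ) * c j| = |1 - θ| * |c j| := fun j => abs_mul _ _
  have hj := hi j
  have hij : |c j| * |(|θ| - |1 - θ|)| ≤ |c i| * |(|θ| - |1 - θ|)| := by gcongr
  refine hij.trans ?_
  rcases le_total |1 - θ| |θ| with hle | hle
  · rw [abs_of_nonneg (sub_nonneg.mpr hle)]
    have h1 := h i
    have h2 := abs_sub_abs_le_abs_sub (θ * (c i * s)) (-((1 - θ) * c (finRotate N i)))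
    rw [sub_neg_eq_add, abs_neg, e, e'] at h2
    have h3 := mul_le_mul_of_nonneg_left (hi (finRotate N i)) (abs_nonneg (1 - θ))
    nlinarith
  · rw [abs_of_nonpos (sub_nonpos.mpr hle)]
    have h1 := h ((finRotate N).symm i)
    rw [Equiv.apply_symm_apply] at h1
    have h2 := abs_sub_abs_le_abs_sub ((1 - θ) * c i) (-(θ * (c ((finRotate N).symm i) * s)))
    rw [sub_neg_eq_add, abs_neg, e, e', add_comm ((1 - θ) * c i)] at h2
    have h3 := mul_le_mul_of_nonneg_left (hi ((finRotate N).symm i)) (abs_nonneg θ)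
    nlinarith

/-- By `circulant_bound` zero data force the zero solution, and an injective endomorphism in finite
dimension is onto. -/
lemma circulant_surjective (Th : Mesh N) {θ : ℝ} (hθ : θ ≠ 1 / 2) {s : ℝ} (hs : |s| = 1) (b : Fin N → ℝ) :
    ∃ c : Fin N → ℝ, ∀ j, θ * (c j * s) + (1 - θ) * c (finRotate N j) = b j := by
  let Φ : (Fin N → ℝ) →ₗ[ℝ] (Fin N → ℝ) :=
    { toFun := fun c j => θ * (c j * s) + (1 - θ) * c (finRotate N j)
      map_add' := fun c d => by ext j; simp only [Pi.add_apply]; ring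
      map_smul' := fun a c => by
        ext j; simp only [Pi.smul_apply, smul_eq_mul, RingHom.id_apply]; ring }
  have hinj : Function.Injective Φ := by
    rw [← LinearMap.ker_eq_bot, LinearMap.ker_eq_bot']
    intro c hc
    ext j
    have := Th.circulant_bound hθ hs (c := c) (B := 0) (fun j => by
      have := congrFun hc j
      simp only [Pi.zero_apply] at this
      rw [show θ * (c j * s) + (1 - θ) * c (finRotate N j) = 0 from this, abs_zero]) j
    rw [zero_div] at this
    exact abs_eq_zero.mp (le_antisymm this (abs_nonneg _))
  obtain ⟨c, hc⟩ := (LinearMap.injective_iff_surjective.mp hinj) b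
  exact ⟨c, fun j => congrFun hc j⟩

/-- The local `L²` projection to degree below `k` settles the moments. The multiples of `legOn`,
invisible to these moments, are then chosen to meet the node conditions; its end values `1` and
`(-1) ^ k` turn these into the cyclic system. -/
lemma exists_isRadau (k : ℕ) {θ : ℝ} (hθ : θ ≠ 1 / 2) {g : Broken N} (hg : Th.CellCont g)
    (b : Fin N → ℝ) : ∃ p : Vh N k, Th.IsRadau θ g b p := by
  obtain ⟨C, -, hC⟩ := exists_proj k
  choose r hr hr1 hr2 using fun j => hC (Th.left j) (Th.right j) (Th.left_lt_right j) (g j) (hg j)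
  obtain ⟨c, hc⟩ := Th.circulant_surjective hθ (s := (-1) ^ k) (by simp) fun j =>
    b j - (θ * (r j).eval (Th.right j)
      + (1 - θ) * (r (finRotate N j)).eval (Th.left (finRotate N j)))
  refine ⟨fun j => ⟨r j + c j • legOn (Th.left j) (Th.right j) k,
    Submodule.add_mem _ (degreeLT_mono (Nat.le_succ k) (hr j))
      (Submodule.smul_mem _ _ (legOn_mem _ _ _))⟩, fun j v hv => ?_, fun j => ?_⟩
  · have h1 := hr1 j v hv
    have h2 := legOn_orthogonal (Th.left_lt_right j) k hv
    have := Th.cellInner_combo j (f₁ := fun x => (r j).eval x - g j x)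
      (f₂ := fun x => (legOn (Th.left j) (Th.right j) k).eval x) (g := fun x => v.eval x) 1 (c j)
      ((r j).continuous.continuousOn.sub (hg j)) (Polynomial.continuous _).continuousOn
      v.continuous.continuousOn
    rw [cellInner, cellInner, cellInner, h1, h2] at this
    rw [cellInner]
    simp only [Vh.toBroken_apply, eval_add, eval_smul, smul_eq_mul]
    rw [mul_zero, mul_zero, add_zero] at this
    rw [← this]
    congr 1; ext x; ring
  · have h := hc j
    simp only [wavg, minus, plus, Vh.toBroken_apply, eval_add, eval_smul, smul_eq_mul,
      legOn_left, legOn_right (Th.left_lt_right j)]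
    linarith

lemma radau_spec (k : ℕ) {θ : ℝ} (hθ : θ ≠ 1 / 2) {g : Broken N} (hg : Th.CellCont g)
    (b : Fin N → ℝ) : Th.IsRadau θ g b (Th.radau k θ g b) :=
  Classical.epsilon_spec (Th.exists_isRadau k hθ hg b)

/-- The splitting of `exists_isRadau` holds for every solution by `eq_smul_legOn`. Its two parts are
bounded by constants of the reference interval and by `circulant_bound`, so the constant serves all
meshes. -/
lemma exists_radau_bound (k : ℕ) {θ : ℝ} (hθ : θ ≠ 1 / 2) : ∃ C : ℝ, 0 ≤ C ∧
    ∀ (N : ℕ) (Th : Mesh N) (g : Broken N), Th.CellCont g → ∀ (b : Fin N → ℝ) (p : Vh N k),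
      Th.IsRadau θ g b p → ∀ A : ℝ, (∀ j, ∀ x ∈ Icc (Th.left j) (Th.right j), |g j x| ≤ A) →
      (∀ j, |b j| ≤ A) → ∀ j, ∀ x ∈ Icc (Th.left j) (Th.right j), |p.toBroken j x| ≤ C * A := by
  obtain ⟨C, hC0, hC⟩ := exists_proj k
  obtain ⟨B, hB0, hB⟩ := exists_legOn_bound k
  refine ⟨C + (1 + (|θ| + |1 - θ|) * C) / |(|θ| - |1 - θ|)| * B, by positivity,
    fun N Th g hg b p hp A hgA hbA => ?_⟩
  choose r hr hr1 hr2 using fun j => hC (Th.left j) (Th.right j) (Th.left_lt_right j) (g j) (hg j)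
  have hex : ∀ j, ∃ c : ℝ, (p j : ℝ[X]) - r j = c • legOn (Th.left j) (Th.right j) k := by
    intro j
    refine eq_smul_legOn (Th.left_lt_right j)
      (Submodule.sub_mem _ (p j).2 (degreeLT_mono (Nat.le_succ k) (hr j))) fun v hv => ?_
    have h1 := hp.1 j v hv
    have h2 := hr1 j v hv
    have := Th.cellInner_sub j (f₁ := fun x => p.toBroken j x - g j x)
      (f₂ := fun x => (r j).eval x - g j x) (g := fun x => v.eval x)
      ((p.toBroken_continuous j).continuousOn.sub (hg j))
      ((r j).continuous.continuousOn.sub (hg j)) v.continuous.continuousOn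
    rw [h1] at this
    unfold cellInner at this
    rw [h2, sub_zero] at this
    rw [← this]
    congr 1; ext x; simp only [eval_sub, Vh.toBroken_apply]; ring
  choose c hc using hex
  have hpe : ∀ j x, p.toBroken j x
      = (r j).eval x + c j * (legOn (Th.left j) (Th.right j) k).eval x := by
    intro j x
    have := congrArg (eval x) (hc j)
    simp only [eval_sub, eval_smul, smul_eq_mul] at this
    rw [Vh.toBroken_apply]; linarith
  have hrA : ∀ j, ∀ x ∈ Icc (Th.left j) (Th.right j), |(r j).eval x| ≤ C * A :=
    fun j x hx => hr2 j A (hgA j) x hx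
  have hcb : ∀ j, |c j| ≤ ((1 + (|θ| + |1 - θ|) * C) * A) / |(|θ| - |1 - θ|)| := by
    refine Th.circulant_bound hθ (s := (-1) ^ k) (by simp) fun j => ?_
    have h1 := hp.2 j
    simp only [wavg, minus, plus, hpe, legOn_left, legOn_right (Th.left_lt_right j)] at h1
    have h2 := Th.abs_wavg_le θ hrA j
    simp only [wavg, minus, plus] at h2
    have h3 := hbA j
    have e : θ * (c j * (-1) ^ k) + (1 - θ) * c (finRotate N j) = b j
        - (θ * (r j).eval (Th.right j)
          + (1 - θ) * (r (finRotate N j)).eval (Th.left (finRotate N j))) := by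
      rw [← h1]; ring
    rw [e]
    refine (abs_sub _ _).trans ?_
    nlinarith
  intro j x hx
  rw [hpe]
  refine (abs_add_le _ _).trans ?_
  rw [abs_mul]
  have h1 := hrA j x hx
  have h2 := mul_le_mul (hcb j) (hB _ _ (Th.left_lt_right j) x hx) (abs_nonneg _)
    ((abs_nonneg _).trans (hcb j))
  calc _ ≤ _ := add_le_add h1 h2
    _ = _ := by ring

lemma IsRadau.congr {k : ℕ} {θ : ℝ} {g g' : Broken N} {b b' : Fin N → ℝ} {p : Vh N k}
    (h : Th.IsRadau θ g b p) (hg : ∀ j, ∀ x ∈ Icc (Th.left j) (Th.right j), g j x = g' j x)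
    (hb : ∀ j, b j = b' j) : Th.IsRadau θ g' b' p := by
  refine ⟨fun j r hr => ?_, fun j => (h.2 j).trans (hb j)⟩
  rw [← h.1 j r hr]
  exact Th.cellInner_congr j (fun x hx => by rw [hg j x hx]) fun _ _ => rfl

lemma IsRadau.combo {k : ℕ} {θ : ℝ} {g₁ g₂ : Broken N} (hg₁ : Th.CellCont g₁)
    (hg₂ : Th.CellCont g₂) {b₁ b₂ : Fin N → ℝ} {p₁ p₂ : Vh N k}
    (h₁ : Th.IsRadau θ g₁ b₁ p₁) (h₂ : Th.IsRadau θ g₂ b₂ p₂) (a c : ℝ) :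
    Th.IsRadau θ (fun j x => a * g₁ j x + c * g₂ j x) (fun j => a * b₁ j + c * b₂ j)
      (a • p₁ + c • p₂) := by
  refine ⟨fun j r hr => ?_, fun j => ?_⟩
  · have := Th.cellInner_combo j a c (f₁ := fun x => p₁.toBroken j x - g₁ j x)
      (f₂ := fun x => p₂.toBroken j x - g₂ j x) (g := fun x => r.eval x)
      ((p₁.toBroken_continuous j).continuousOn.sub (hg₁ j))
      ((p₂.toBroken_continuous j).continuousOn.sub (hg₂ j)) r.continuous.continuousOn
    rw [h₁.1 j r hr, h₂.1 j r hr, mul_zero, mul_zero, add_zero] at this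
    rw [← this]
    congr 1; ext x
    rw [Vh.toBroken_add, Vh.toBroken_smul, Vh.toBroken_smul]; ring
  · beta_reduce
    rw [← h₁.2 j, ← h₂.2 j, ← Th.wavg_combo]
    refine Th.wavg_congr _ (fun j x _ => ?_) j
    rw [Vh.toBroken_add, Vh.toBroken_smul, Vh.toBroken_smul]

/-- The difference of two solutions solves the problem with zero data, and the stability bound with
`A = 0` annihilates it. -/
lemma IsRadau.unique {k : ℕ} {θ : ℝ} (hθ : θ ≠ 1 / 2) {g : Broken N} (hg : Th.CellCont g)
    {b : Fin N → ℝ} {p p' : Vh N k} (h : Th.IsRadau θ g b p) (h' : Th.IsRadau θ g b p') :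
    p = p' := by
  obtain ⟨C, -, hC⟩ := exists_radau_bound k hθ
  have h0 := IsRadau.combo Th hg hg h h' 1 (-1)
  have hz := hC N Th _ (hg.combo hg 1 (-1)) _ _ h0 0 (fun j x _ => by simp) (fun j => by simp)
  have hp : ∀ j, ((p j : ℝ[X]) - (p' j : ℝ[X])) = 0 := by
    intro j
    refine eq_zero_of_infinite_isRoot _ ((Icc_infinite (Th.left_lt_right j)).mono fun x hx => ?_)
    have := hz j x hx
    rw [mul_zero] at this
    have h2 := abs_eq_zero.mp (le_antisymm this (abs_nonneg _))
    rw [Vh.toBroken_add, Vh.toBroken_smul, Vh.toBroken_smul, Vh.toBroken_apply,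
      Vh.toBroken_apply] at h2
    change eval x (_ - _) = 0
    rw [eval_sub]
    linarith
  funext j
  exact Subtype.ext (sub_eq_zero.mp (hp j))

lemma radau_eq {k : ℕ} {θ : ℝ} (hθ : θ ≠ 1 / 2) {g : Broken N} (hg : Th.CellCont g)
    {b : Fin N → ℝ} {p : Vh N k} (h : Th.IsRadau θ g b p) : Th.radau k θ g b = p :=
  IsRadau.unique Th hθ hg (Th.radau_spec k hθ hg b) h

lemma radau_congr {k : ℕ} {θ : ℝ} (hθ : θ ≠ 1 / 2) {g g' : Broken N} (hg : Th.CellCont g)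
    (hg' : Th.CellCont g') {b b' : Fin N → ℝ}
    (h : ∀ j, ∀ x ∈ Icc (Th.left j) (Th.right j), g j x = g' j x) (hb : ∀ j, b j = b' j) :
    Th.radau k θ g b = Th.radau k θ g' b' :=
  Th.radau_eq hθ hg (IsRadau.congr Th (Th.radau_spec k hθ hg' b')
    (fun j x hx => (h j x hx).symm) fun j => (hb j).symm)

lemma radau_combo {k : ℕ} {θ : ℝ} (hθ : θ ≠ 1 / 2) {g₁ g₂ g : Broken N} (hg₁ : Th.CellCont g₁)
    (hg₂ : Th.CellCont g₂) (hg : Th.CellCont g) {b₁ b₂ b : Fin N → ℝ} {a c : ℝ}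
    (h : ∀ j, ∀ x ∈ Icc (Th.left j) (Th.right j), g j x = a * g₁ j x + c * g₂ j x)
    (hb : ∀ j, b j = a * b₁ j + c * b₂ j) :
    Th.radau k θ g b = a • Th.radau k θ g₁ b₁ + c • Th.radau k θ g₂ b₂ :=
  Th.radau_eq hθ hg (IsRadau.congr Th (IsRadau.combo Th hg₁ hg₂ (Th.radau_spec k hθ hg₁ b₁)
    (Th.radau_spec k hθ hg₂ b₂) a c) (fun j x hx => (h j x hx).symm) fun j => (hb j).symm)

end Mesh

/-! ### Jets -/

/-- The evolution operator `f ↦ f'' - f'` on sequences of derivatives. -/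
def evo (F : ℕ → ℝ → ℝ) : ℕ → ℝ → ℝ := fun m x => F (m + 2) x - F (m + 1) x

/-- All members of the sequence are continuous on `[0, 2π]`. -/
def JetCont (F : ℕ → ℝ → ℝ) : Prop := ∀ m, ContinuousOn (F m) (Icc 0 (2 * Real.pi))

/-- `F (m + 1)` is the derivative of `F m` for `m < n`, and `F m` is `K`-Lipschitz for `m ≤ n`. -/
structure JetReg (n : ℕ) (K : ℝ) (F : ℕ → ℝ → ℝ) : Prop where
  hasDeriv : ∀ m < n, ∀ x ∈ Icc 0 (2 * Real.pi),
    HasDerivWithinAt (F m) (F (m + 1) x) (Icc 0 (2 * Real.pi)) x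
  lip : ∀ m ≤ n, ∀ x ∈ Icc 0 (2 * Real.pi), ∀ y ∈ Icc 0 (2 * Real.pi),
    |F m x - F m y| ≤ K * |x - y|

lemma JetCont.evo {F : ℕ → ℝ → ℝ} (h : JetCont F) : JetCont (evo F) :=
  fun m => (h (m + 2)).sub (h (m + 1))

lemma JetCont.combo {F G : ℕ → ℝ → ℝ} (hF : JetCont F) (hG : JetCont G) (a c : ℝ) :
    JetCont (fun m x => a * F m x + c * G m x) :=
  fun m => (continuousOn_const.mul (hF m)).add (continuousOn_const.mul (hG m))

lemma JetReg.mono {n n' : ℕ} {K : ℝ} {F : ℕ → ℝ → ℝ} (h : JetReg n K F) (hn : n' ≤ n) :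
    JetReg n' K F :=
  ⟨fun m hm => h.hasDeriv m (lt_of_lt_of_le hm hn), fun m hm => h.lip m (hm.trans hn)⟩

lemma JetReg.evo {n : ℕ} {K : ℝ} {F : ℕ → ℝ → ℝ} (h : JetReg (n + 2) K F) :
    JetReg n (2 * K) (evo F) := by
  refine ⟨fun m hm x hx => ?_, fun m hm x hx y hy => ?_⟩
  · exact (h.hasDeriv (m + 2) (by omega) x hx).sub (h.hasDeriv (m + 1) (by omega) x hx)
  · have h1 := h.lip (m + 2) (by omega) x hx y hy
    have h2 := h.lip (m + 1) (by omega) x hx y hy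
    have e : LDG.evo F m x - LDG.evo F m y
        = (F (m + 2) x - F (m + 2) y) - (F (m + 1) x - F (m + 1) y) := by
      simp only [LDG.evo]; ring
    rw [e]
    refine (abs_sub _ _).trans ?_
    linarith

lemma JetReg.shift {n : ℕ} {K : ℝ} {F : ℕ → ℝ → ℝ} (h : JetReg (n + 1) K F) :
    JetReg n K (fun m => F (m + 1)) :=
  ⟨fun m hm => h.hasDeriv (m + 1) (by omega), fun m hm => h.lip (m + 1) (by omega)⟩

/-- Approximation by a polynomial of degree at most `k` on a subinterval. -/
lemma JetReg.exists_poly {k : ℕ} {K : ℝ} (hK : 0 ≤ K) {a b h : ℝ}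
    (hab : a ≤ b) (hbh : b - a ≤ h) (hsub : Icc a b ⊆ Icc 0 (2 * Real.pi)) :
    ∀ {F : ℕ → ℝ → ℝ}, JetReg k K F →
      ∃ r ∈ degreeLT ℝ (k + 1), ∀ x ∈ Icc a b, |F 0 x - r.eval x| ≤ K * h ^ (k + 1) := by
  have hh : 0 ≤ h := by linarith
  have ha : a ∈ Icc a b := left_mem_Icc.mpr hab
  induction k with
  | zero =>
    intro F hF
    refine ⟨C (F 0 a), ?_, fun x hx => ?_⟩
    · rw [mem_degreeLT]
      exact lt_of_le_of_lt degree_C_le (by norm_num)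
    · rw [eval_C]
      refine (hF.lip 0 le_rfl x (hsub hx) a (hsub ha)).trans ?_
      rw [abs_of_nonneg (by linarith [hx.1])]
      rw [zero_add, pow_one]
      have := hx.2
      gcongr
      linarith
  | succ k ih =>
    intro F hF
    obtain ⟨r, hr, hb⟩ := ih hF.shift
    obtain ⟨R, hR, hRr⟩ := exists_antiderivative hr
    -- An antiderivative of the approximation of `F 1`, shifted to agree with `F 0` at `a`; the mean
    -- value inequality then supplies the additional factor `h`.
    refine ⟨R + C (F 0 a - R.eval a), Submodule.add_mem _ hR ?_, fun x hx => ?_⟩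
    · rw [mem_degreeLT]
      exact lt_of_le_of_lt degree_C_le (by exact_mod_cast Nat.succ_pos _)
    · have hder : ∀ y ∈ Icc a b, HasDerivWithinAt (fun y => F 0 y - R.eval y)
          (F 1 y - r.eval y) (Icc a b) y := by
        intro y hy
        have h1 := (hF.hasDeriv 0 (by omega) y (hsub hy)).mono hsub
        have h2 := (R.hasDerivAt y).hasDerivWithinAt (s := Icc a b)
        rw [hRr] at h2
        exact h1.sub h2
      have := Convex.norm_image_sub_le_of_norm_hasDerivWithin_le hder
        (C := K * h ^ (k + 1)) (fun y hy => hb y hy) (convex_Icc a b) ha hx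
      rw [Real.norm_eq_abs, Real.norm_eq_abs, abs_of_nonneg (by linarith [hx.1] : 0 ≤ x - a)] at this
      rw [eval_add, eval_C]
      calc |F 0 x - (R.eval x + (F 0 a - R.eval a))|
          = |F 0 x - R.eval x - (F 0 a - R.eval a)| := by congr 1; ring
        _ ≤ K * h ^ (k + 1) * (x - a) := this
        _ ≤ K * h ^ (k + 1) * h := by gcongr; linarith [hx.2]
        _ = K * h ^ (k + 1 + 1) := by ring

lemma one_sub_ne_half {θ : ℝ} (hθ : θ ≠ 1 / 2) : 1 - θ ≠ 1 / 2 :=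
  fun h => hθ (by linarith)

/-! ### Cellwise primitives -/

namespace Mesh

variable {N : ℕ} (Th : Mesh N)

/-- `v` is bounded by `A` on the closed cells. -/
def Bdd (v : Broken N) (A : ℝ) : Prop := ∀ j, ∀ x ∈ Icc (Th.left j) (Th.right j), |v j x| ≤ A

/-- Cellwise primitive, vanishing at the left end points. -/
noncomputable def prim (v : Broken N) : Broken N := fun j x => ∫ y in (Th.left j)..x, v j y

lemma half_mul_dxInv (v : Broken N) (j : Fin N) (x : ℝ) :
    Th.cellLength j / 2 * Th.dxInv v j x = Th.prim v j x := by
  have := (Th.cellLength_pos j).ne'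
  rw [dxInv, prim]
  field_simp

variable {Th} in
lemma CellCont.prim {v : Broken N} (hv : Th.CellCont v) : Th.CellCont (Th.prim v) :=
  fun j x hx => (hasDerivWithinAt_primitive (hv j) x hx).continuousWithinAt

variable {Th} in
-- The source of the extra power of the mesh size in every correction step.
lemma Bdd.prim {v : Broken N} {A : ℝ} (hA : 0 ≤ A) (hv : Th.Bdd v A) :
    Th.Bdd (Th.prim v) (A * Th.size) := by
  intro j x hx
  have h := intervalIntegral.norm_integral_le_of_norm_le_const (a := Th.left j) (b := x)
    (f := v j) (C := A) (fun y hy => by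
      rw [uIoc_of_le hx.1] at hy
      exact hv j y ⟨hy.1.le, hy.2.trans hx.2⟩)
  rw [Real.norm_eq_abs, abs_of_nonneg (by linarith [hx.1] : 0 ≤ x - Th.left j)] at h
  refine h.trans ?_
  have h1 := Th.cellLength_le_size j
  unfold cellLength at h1
  have := hx.2
  gcongr
  linarith

/-- Integration by parts. The primitive vanishes at the left end, and the remaining boundary term
disappears as soon as `v` is orthogonal to constants. -/
lemma cellInner_prim {v : Broken N} (hv : Th.CellCont v) (j : Fin N) (p : ℝ[X]) :
    Th.cellInner j (Th.prim v j) (fun x => (derivative p).eval x)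
      = Th.cellInner j (v j) (fun _ => 1) * p.eval (Th.right j)
        - Th.cellInner j (v j) (fun x => p.eval x) := by
  have h := integral_mul_derivative (Th.left_le_right j) (hasDerivWithinAt_primitive (hv j)) (hv j) p
  unfold cellInner
  rw [show (∫ x in Th.left j..Th.right j, v j x * 1) = ∫ x in Th.left j..Th.right j, v j x by simp]
  have e : Th.prim v j = fun y => ∫ z in Th.left j..y, v j z := rfl
  rw [e, h, intervalIntegral.integral_same]
  ring

lemma prim_congr {v w : Broken N}
    (h : ∀ j, ∀ x ∈ Icc (Th.left j) (Th.right j), v j x = w j x) :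
    ∀ j, ∀ x ∈ Icc (Th.left j) (Th.right j), Th.prim v j x = Th.prim w j x := by
  intro j x hx
  refine intervalIntegral.integral_congr fun y hy => ?_
  rw [uIcc_of_le hx.1] at hy
  exact h j y ⟨hy.1, hy.2.trans hx.2⟩

lemma prim_combo {v w : Broken N} (hv : Th.CellCont v) (hw : Th.CellCont w) (a c : ℝ) :
    ∀ j, ∀ x ∈ Icc (Th.left j) (Th.right j),
      Th.prim (fun j x => a * v j x + c * w j x) j x = a * Th.prim v j x + c * Th.prim w j x := by
  intro j x hx
  unfold prim
  have i1 : IntervalIntegrable (v j) volume (Th.left j) x :=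
    ((hv j).mono (Icc_subset_Icc_right hx.2)).intervalIntegrable_of_Icc hx.1
  have i2 : IntervalIntegrable (w j) volume (Th.left j) x :=
    ((hw j).mono (Icc_subset_Icc_right hx.2)).intervalIntegrable_of_Icc hx.1
  rw [intervalIntegral.integral_add (i1.const_mul a) (i2.const_mul c),
    intervalIntegral.integral_const_mul, intervalIntegral.integral_const_mul]

variable {Th} in
lemma CellCont.of_continuousOn {f : ℝ → ℝ} (hf : ContinuousOn f (Icc 0 (2 * Real.pi))) :
    Th.CellCont (fun _ => f) := fun j => hf.mono (Th.cell_subset j)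

lemma jump_eq (v : Broken N) (j : Fin N) : Th.jump v j = Th.wavg 0 v j - Th.wavg 1 v j := by
  unfold jump wavg; ring

/-! ### The correction operators -/

/-- The correction functions as linear operators applied to the sequence of derivatives of a
function, time derivatives being replaced by `evo`. -/
noncomputable def corrOp (k : ℕ) (lam θ : ℝ) : ℕ → (ℕ → ℝ → ℝ) → Broken N × Broken N
  | 0, F =>
    (fun j x => F 0 x - (Th.projU k θ (fun _ => F 0)).toBroken j x,
     fun j x => F 1 x - (Th.projQ k lam θ (fun _ => F 0) (fun _ => F 1)).toBroken j x)
  | i + 1, F =>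
    ((Th.stepU k θ (corrOp k lam θ i F).2).toBroken,
     (Th.stepQ k lam θ (Th.stepU k θ (corrOp k lam θ i F).2).toBroken
      (corrOp k lam θ i (evo F)).1).toBroken)

variable {k : ℕ} {lam θ : ℝ} (hθ : θ ≠ 1 / 2)

lemma corrOp_cellCont (i : ℕ) {F : ℕ → ℝ → ℝ} (hF : JetCont F) :
    Th.CellCont (Th.corrOp k lam θ i F).1 ∧ Th.CellCont (Th.corrOp k lam θ i F).2 := by
  cases i with
  | zero =>
    exact ⟨fun j => (CellCont.of_continuousOn (hF 0) j).sub (CellCont.toBroken Th _ j),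
      fun j => (CellCont.of_continuousOn (hF 1) j).sub (CellCont.toBroken Th _ j)⟩
  | succ i => exact ⟨CellCont.toBroken Th _, CellCont.toBroken Th _⟩

include hθ

lemma projU_spec {z : Broken N} (hz : Th.CellCont z) :
    Th.IsRadau θ z (Th.wavg θ z) (Th.projU k θ z) := Th.radau_spec k hθ hz _

lemma projQ_spec {z q : Broken N} (hq : Th.CellCont q) :
    Th.IsRadau (1 - θ) q (fun j => Th.wavg (1 - θ) q j
      + (lam - θ) * Th.jump (fun j x => z j x - (Th.projU k θ z).toBroken j x) j)
      (Th.projQ k lam θ z q) := Th.radau_spec k (one_sub_ne_half hθ) hq _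

lemma stepU_spec {w : Broken N} (hw : Th.CellCont w) :
    Th.IsRadau θ (Th.prim w) 0 (Th.stepU k θ w) := by
  have e : (fun j x => Th.cellLength j / 2 * Th.dxInv w j x) = Th.prim w := by
    ext j x; exact Th.half_mul_dxInv w j x
  unfold stepU
  rw [e]
  exact Th.radau_spec k hθ hw.prim _

lemma stepQ_spec {w d : Broken N} (hw : Th.CellCont w) (hd : Th.CellCont d) :
    Th.IsRadau (1 - θ) (fun j x => w j x + Th.prim d j x) (Th.wavg lam w)
      (Th.stepQ k lam θ w d) := by
  have e : (fun j x => w j x + Th.cellLength j / 2 * Th.dxInv d j x)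
      = fun j x => w j x + Th.prim d j x := by
    ext j x; rw [Th.half_mul_dxInv d j x]
  unfold stepQ
  rw [e]
  exact Th.radau_spec k (one_sub_ne_half hθ) (fun j => (hw j).add (hd.prim j)) _

lemma projU_combo {z₁ z₂ z : Broken N} (h₁ : Th.CellCont z₁) (h₂ : Th.CellCont z₂)
    (hz : Th.CellCont z) {a c : ℝ}
    (h : ∀ j, ∀ x ∈ Icc (Th.left j) (Th.right j), z j x = a * z₁ j x + c * z₂ j x) :
    Th.projU k θ z = a • Th.projU k θ z₁ + c • Th.projU k θ z₂ :=
  Th.radau_combo hθ h₁ h₂ hz h fun j => by rw [Th.wavg_congr θ h, Th.wavg_combo]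

lemma projQ_combo {z₁ z₂ z q₁ q₂ q : Broken N} (h₁ : Th.CellCont z₁) (h₂ : Th.CellCont z₂)
    (hz : Th.CellCont z) (hq₁ : Th.CellCont q₁) (hq₂ : Th.CellCont q₂) (hq : Th.CellCont q)
    {a c : ℝ}
    (h : ∀ j, ∀ x ∈ Icc (Th.left j) (Th.right j), z j x = a * z₁ j x + c * z₂ j x)
    (h' : ∀ j, ∀ x ∈ Icc (Th.left j) (Th.right j), q j x = a * q₁ j x + c * q₂ j x) :
    Th.projQ k lam θ z q = a • Th.projQ k lam θ z₁ q₁ + c • Th.projQ k lam θ z₂ q₂ := by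
  refine Th.radau_combo (one_sub_ne_half hθ) hq₁ hq₂ hq h' fun j => ?_
  have e : ∀ j, ∀ x ∈ Icc (Th.left j) (Th.right j), z j x - (Th.projU k θ z).toBroken j x
      = a * (z₁ j x - (Th.projU k θ z₁).toBroken j x)
        + c * (z₂ j x - (Th.projU k θ z₂).toBroken j x) := by
    intro j x hx
    rw [Th.projU_combo hθ h₁ h₂ hz h, h j x hx, Vh.toBroken_add, Vh.toBroken_smul,
      Vh.toBroken_smul]
    ring
  rw [Th.wavg_congr _ h', Th.wavg_combo, jump_eq, jump_eq, jump_eq, Th.wavg_congr 0 e,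
    Th.wavg_congr 1 e, Th.wavg_combo 0, Th.wavg_combo 1]
  ring

lemma stepU_combo {w₁ w₂ w : Broken N} (h₁ : Th.CellCont w₁) (h₂ : Th.CellCont w₂)
    (hw : Th.CellCont w) {a c : ℝ}
    (h : ∀ j, ∀ x ∈ Icc (Th.left j) (Th.right j), w j x = a * w₁ j x + c * w₂ j x) :
    Th.stepU k θ w = a • Th.stepU k θ w₁ + c • Th.stepU k θ w₂ := by
  have s := IsRadau.combo Th h₁.prim h₂.prim (Th.stepU_spec (k := k) hθ h₁)
    (Th.stepU_spec (k := k) hθ h₂) a c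
  refine IsRadau.unique Th hθ hw.prim (Th.stepU_spec hθ hw) (IsRadau.congr Th s ?_ ?_)
  · intro j x hx
    rw [Th.prim_congr h j x hx, Th.prim_combo h₁ h₂ a c j x hx]
  · intro j; simp

lemma stepQ_combo {w₁ w₂ w d₁ d₂ d : Broken N} (h₁ : Th.CellCont w₁) (h₂ : Th.CellCont w₂)
    (hw : Th.CellCont w) (hd₁ : Th.CellCont d₁) (hd₂ : Th.CellCont d₂) (hd : Th.CellCont d)
    {a c : ℝ}
    (h : ∀ j, ∀ x ∈ Icc (Th.left j) (Th.right j), w j x = a * w₁ j x + c * w₂ j x)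
    (h' : ∀ j, ∀ x ∈ Icc (Th.left j) (Th.right j), d j x = a * d₁ j x + c * d₂ j x) :
    Th.stepQ k lam θ w d = a • Th.stepQ k lam θ w₁ d₁ + c • Th.stepQ k lam θ w₂ d₂ := by
  have s := IsRadau.combo Th (fun j => (h₁ j).add (hd₁.prim j)) (fun j => (h₂ j).add (hd₂.prim j))
    (Th.stepQ_spec (k := k) (lam := lam) hθ h₁ hd₁)
    (Th.stepQ_spec (k := k) (lam := lam) hθ h₂ hd₂) a c
  refine IsRadau.unique Th (one_sub_ne_half hθ) (fun j => (hw j).add (hd.prim j))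
    (Th.stepQ_spec hθ hw hd) (IsRadau.congr Th s ?_ ?_)
  · intro j x hx
    change _ = w j x + Th.prim d j x
    rw [Th.prim_congr h' j x hx, Th.prim_combo hd₁ hd₂ a c j x hx, h j x hx]
    simp only [Pi.add_apply]
    ring
  · intro j; rw [Th.wavg_congr _ h, Th.wavg_combo]

/-- The correction operators are linear. -/
lemma corrOp_combo (i : ℕ) {a c : ℝ} : ∀ {F G H : ℕ → ℝ → ℝ}, JetCont F → JetCont G → JetCont H →
    (∀ m, ∀ x ∈ Icc 0 (2 * Real.pi), H m x = a * F m x + c * G m x) →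
    (∀ j, ∀ x ∈ Icc (Th.left j) (Th.right j), (Th.corrOp k lam θ i H).1 j x
      = a * (Th.corrOp k lam θ i F).1 j x + c * (Th.corrOp k lam θ i G).1 j x) ∧
    ∀ j, ∀ x ∈ Icc (Th.left j) (Th.right j), (Th.corrOp k lam θ i H).2 j x
      = a * (Th.corrOp k lam θ i F).2 j x + c * (Th.corrOp k lam θ i G).2 j x := by
  induction i with
  | zero =>
    intro F G H hF hG hH h
    have hm : ∀ m, ∀ j : Fin N, ∀ x ∈ Icc (Th.left j) (Th.right j),
        H m x = a * F m x + c * G m x := fun m j x hx => h m x (Th.cell_subset j hx)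
    constructor
    · intro j x hx
      simp only [corrOp]
      rw [Th.projU_combo hθ (CellCont.of_continuousOn (hF 0)) (CellCont.of_continuousOn (hG 0))
        (CellCont.of_continuousOn (hH 0)) (hm 0), hm 0 j x hx, Vh.toBroken_add,
        Vh.toBroken_smul, Vh.toBroken_smul]
      ring
    · intro j x hx
      simp only [corrOp]
      rw [Th.projQ_combo hθ (CellCont.of_continuousOn (hF 0)) (CellCont.of_continuousOn (hG 0))
        (CellCont.of_continuousOn (hH 0)) (CellCont.of_continuousOn (hF 1))
        (CellCont.of_continuousOn (hG 1)) (CellCont.of_continuousOn (hH 1)) (hm 0) (hm 1),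
        hm 1 j x hx, Vh.toBroken_add, Vh.toBroken_smul, Vh.toBroken_smul]
      ring
  | succ i ih =>
    intro F G H hF hG hH h
    have h1 := (ih hF hG hH h).2
    have h2 := (ih hF.evo hG.evo hH.evo (fun m x hx => by
      simp only [evo, h _ x hx]; ring)).1
    have e1 : ∀ j x, (Th.corrOp k lam θ (i + 1) H).1 j x
        = a * (Th.corrOp k lam θ (i + 1) F).1 j x + c * (Th.corrOp k lam θ (i + 1) G).1 j x := by
      intro j x
      simp only [corrOp]
      rw [Th.stepU_combo hθ (Th.corrOp_cellCont i hF).2 (Th.corrOp_cellCont i hG).2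
        (Th.corrOp_cellCont i hH).2 h1, Vh.toBroken_add, Vh.toBroken_smul, Vh.toBroken_smul]
    refine ⟨fun j x _ => e1 j x, fun j x hx => ?_⟩
    have e2 := Th.stepQ_combo (k := k) (lam := lam) hθ (Th.corrOp_cellCont (i + 1) hF).1
      (Th.corrOp_cellCont (i + 1) hG).1 (Th.corrOp_cellCont (i + 1) hH).1
      (Th.corrOp_cellCont i hF.evo).1 (Th.corrOp_cellCont i hG.evo).1
      (Th.corrOp_cellCont i hH.evo).1 (fun j x _ => e1 j x) h2
    have e3 := congrArg (fun v => Vh.toBroken v j x) e2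
    simp only [Vh.toBroken_add, Vh.toBroken_smul] at e3
    exact e3

omit hθ in
lemma Bdd.mono {v : Broken N} {A B : ℝ} (h : Th.Bdd v A) (hAB : A ≤ B) : Th.Bdd v B :=
  fun j x hx => (h j x hx).trans hAB

omit hθ in
lemma Bdd.abs_jump_le {v : Broken N} {A : ℝ} (h : Th.Bdd v A) (j : Fin N) :
    |Th.jump v j| ≤ 2 * A := by
  unfold jump minus plus
  refine (abs_sub _ _).trans ?_
  have h1 := h _ _ (Th.left_mem (finRotate N j))
  have h2 := h _ _ (Th.right_mem j)
  linarith

end Mesh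

namespace Mesh

/-! ### Bounds for the projections and the corrections -/

/-- The projection reproduces `r`, so `p - r` is the projection of `g - r` and the stability bound
applies to it. The slack `B` in the node data accommodates the jump term of the modified projection.
-/
lemma exists_radau_error (k : ℕ) {θ : ℝ} (hθ : θ ≠ 1 / 2) : ∃ C : ℝ, 0 ≤ C ∧
    ∀ (N : ℕ) (Th : Mesh N) (g : Broken N), Th.CellCont g → ∀ (b : Fin N → ℝ) (p r : Vh N k),
      Th.IsRadau θ g b p → ∀ A B : ℝ, 0 ≤ A → 0 ≤ B →
      Th.Bdd (fun j x => g j x - r.toBroken j x) A →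
      (∀ j, |b j - Th.wavg θ g j| ≤ B) →
      Th.Bdd (fun j x => g j x - p.toBroken j x) (C * (A + B)) := by
  obtain ⟨C, hC0, hC⟩ := exists_radau_bound k hθ
  refine ⟨1 + C * (1 + |θ| + |1 - θ|), by positivity,
    fun N Th g hg b p r hp A B hA hB hr hb j x hx => ?_⟩
  have hrr : Th.IsRadau θ r.toBroken (Th.wavg θ r.toBroken) r :=
    ⟨fun j v _ => by simp [cellInner], fun j => rfl⟩
  have h := IsRadau.combo Th hg (CellCont.toBroken Th r) hp hrr 1 (-1)
  have hbd := hC N Th _ (hg.combo (CellCont.toBroken Th r) 1 (-1)) _ _ h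
    ((1 + |θ| + |1 - θ|) * (A + B)) ?_ ?_ j x hx
  · rw [Vh.toBroken_add, Vh.toBroken_smul, Vh.toBroken_smul] at hbd
    have h1 := hr j x hx
    have e : g j x - p.toBroken j x = (g j x - r.toBroken j x)
        - (1 * p.toBroken j x + -1 * r.toBroken j x) := by ring
    beta_reduce
    rw [e]
    refine (abs_sub _ _).trans ((add_le_add h1 hbd).trans ?_)
    nlinarith
  · intro j x hx
    have h1 := hr j x hx
    rw [show (1 : ℝ) * g j x + -1 * r.toBroken j x = g j x - r.toBroken j x by ring]
    refine h1.trans ?_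
    nlinarith [abs_nonneg θ, abs_nonneg (1 - θ)]
  · intro j
    have h1 := Th.abs_wavg_le θ hr j
    have e : Th.wavg θ (fun j x => g j x - r.toBroken j x) j
        = Th.wavg θ g j - Th.wavg θ r.toBroken j := by
      simp only [wavg, minus, plus]; ring
    rw [e] at h1
    rw [show (1 : ℝ) * b j + -1 * Th.wavg θ r.toBroken j
      = (b j - Th.wavg θ g j) + (Th.wavg θ g j - Th.wavg θ r.toBroken j) by ring]
    refine (abs_add_le _ _).trans ((add_le_add (hb j) h1).trans ?_)
    nlinarith [abs_nonneg θ, abs_nonneg (1 - θ)]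

lemma exists_projU_error (k : ℕ) {θ : ℝ} (hθ : θ ≠ 1 / 2) : ∃ C : ℝ, 0 ≤ C ∧
    ∀ (N : ℕ) (Th : Mesh N) (z : Broken N), Th.CellCont z → ∀ (r : Vh N k) (A : ℝ), 0 ≤ A →
      Th.Bdd (fun j x => z j x - r.toBroken j x) A →
      Th.Bdd (fun j x => z j x - (Th.projU k θ z).toBroken j x) (C * A) := by
  obtain ⟨C, hC0, hC⟩ := exists_radau_error k hθ
  refine ⟨C, hC0, fun N Th z hz r A hA hr => ?_⟩
  have := hC N Th z hz _ _ r (Th.projU_spec hθ hz) A 0 hA le_rfl hr (by simp)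
  rwa [add_zero] at this

/-- The node data are perturbed by a jump of `z - P_θ z`, which is itself controlled by the
projection error of `z`. -/
lemma exists_projQ_error (k : ℕ) (lam : ℝ) {θ : ℝ} (hθ : θ ≠ 1 / 2) : ∃ C : ℝ, 0 ≤ C ∧
    ∀ (N : ℕ) (Th : Mesh N) (z q : Broken N), Th.CellCont z → Th.CellCont q →
      ∀ (r s : Vh N k) (A : ℝ), 0 ≤ A →
      Th.Bdd (fun j x => z j x - r.toBroken j x) A →
      Th.Bdd (fun j x => q j x - s.toBroken j x) A →
      Th.Bdd (fun j x => q j x - (Th.projQ k lam θ z q).toBroken j x) (C * A) := by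
  obtain ⟨C₁, hC₁0, hC₁⟩ := exists_projU_error k hθ
  obtain ⟨C₂, hC₂0, hC₂⟩ := exists_radau_error k (one_sub_ne_half hθ)
  refine ⟨C₂ * (1 + |lam - θ| * (2 * C₁)), by positivity,
    fun N Th z q hz hq r s A hA hr hs => ?_⟩
  have h1 := hC₁ N Th z hz r A hA hr
  have h2 := hC₂ N Th q hq _ _ s (Th.projQ_spec (lam := lam) (z := z) hθ hq) A
    (|lam - θ| * (2 * (C₁ * A))) hA (by positivity) hs (fun j => by
      rw [add_sub_cancel_left, abs_mul]
      exact mul_le_mul_of_nonneg_left (Bdd.abs_jump_le Th h1 j) (abs_nonneg _))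
  refine Bdd.mono Th h2 (le_of_eq ?_)
  ring

lemma exists_stepU_bound (k : ℕ) {θ : ℝ} (hθ : θ ≠ 1 / 2) : ∃ C : ℝ, 0 ≤ C ∧
    ∀ (N : ℕ) (Th : Mesh N) (w : Broken N), Th.CellCont w → ∀ A : ℝ, 0 ≤ A → Th.Bdd w A →
      Th.Bdd (Th.stepU k θ w).toBroken (C * (A * Th.size)) := by
  obtain ⟨C, hC0, hC⟩ := exists_radau_bound k hθ
  refine ⟨C, hC0, fun N Th w hw A hA hb => ?_⟩
  have := Th.size_pos
  exact hC N Th _ hw.prim _ _ (Th.stepU_spec hθ hw) _ (hb.prim hA)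
    (fun j => by simp only [Pi.zero_apply, abs_zero]; positivity)

lemma exists_stepQ_bound (k : ℕ) (lam : ℝ) {θ : ℝ} (hθ : θ ≠ 1 / 2) : ∃ C : ℝ, 0 ≤ C ∧
    ∀ (N : ℕ) (Th : Mesh N) (w d : Broken N), Th.CellCont w → Th.CellCont d →
      ∀ A B : ℝ, 0 ≤ A → 0 ≤ B → Th.Bdd w A → Th.Bdd d B →
      Th.Bdd (Th.stepQ k lam θ w d).toBroken (C * (A + B * Th.size)) := by
  obtain ⟨C, hC0, hC⟩ := exists_radau_bound k (one_sub_ne_half hθ)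
  refine ⟨C * (1 + |lam| + |1 - lam|), by positivity, fun N Th w d hw hd A B hA hB hwA hdB => ?_⟩
  have hs := Th.size_pos
  have hBs : 0 ≤ B * Th.size := by positivity
  have := hC N Th _ (fun j => (hw j).add (hd.prim j)) _ _
    (Th.stepQ_spec (k := k) (lam := lam) hθ hw hd)
    ((1 + |lam| + |1 - lam|) * (A + B * Th.size)) (fun j x hx => by
      refine (abs_add_le _ _).trans ((add_le_add (hwA j x hx) (hdB.prim hB j x hx)).trans ?_)
      nlinarith [abs_nonneg lam, abs_nonneg (1 - lam)])
    (fun j => by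
      refine (Th.abs_wavg_le lam hwA j).trans ?_
      nlinarith [abs_nonneg lam, abs_nonneg (1 - lam)])
  exact Bdd.mono Th this (le_of_eq (by ring))

/-- Boundedness of the correction operators with respect to finitely many derivatives. -/
lemma exists_corrOp_bound (k : ℕ) (lam : ℝ) {θ : ℝ} (hθ : θ ≠ 1 / 2) (i : ℕ) : ∃ C : ℝ, 0 ≤ C ∧
    ∀ (N : ℕ) (Th : Mesh N) (F : ℕ → ℝ → ℝ), JetCont F → ∀ A : ℝ, 0 ≤ A →
      ((∀ m ≤ i, ∀ x ∈ Icc 0 (2 * Real.pi), |F m x| ≤ A) →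
        Th.Bdd (Th.corrOp k lam θ i F).1 (C * A)) ∧
      ((∀ m ≤ i + 1, ∀ x ∈ Icc 0 (2 * Real.pi), |F m x| ≤ A) →
        Th.Bdd (Th.corrOp k lam θ i F).2 (C * A)) := by
  induction i with
  | zero =>
    obtain ⟨C₁, hC₁0, hC₁⟩ := exists_projU_error k hθ
    obtain ⟨C₂, hC₂0, hC₂⟩ := exists_projQ_error k lam hθ
    -- Comparison with the zero polynomial turns the error estimates into plain stability.
    have hz : ∀ (N : ℕ) (Th : Mesh N) (f : ℝ → ℝ) (A : ℝ),
        (∀ x ∈ Icc 0 (2 * Real.pi), |f x| ≤ A) →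
        Th.Bdd (fun j x => f x - (0 : Vh N k).toBroken j x) A := by
      intro N Th f A hf j x hx
      simpa [Vh.toBroken] using hf x (Th.cell_subset j hx)
    refine ⟨C₁ + C₂, by positivity, fun N Th F hF A hA => ⟨fun h => ?_, fun h => ?_⟩⟩
    · refine Bdd.mono Th (hC₁ N Th (fun _ => F 0) (CellCont.of_continuousOn (hF 0)) 0 A hA
        (hz N Th _ A (h 0 le_rfl))) (by nlinarith)
    · refine Bdd.mono Th (hC₂ N Th (fun _ => F 0) (fun _ => F 1) (CellCont.of_continuousOn (hF 0))
        (CellCont.of_continuousOn (hF 1)) 0 0 A hA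
        (hz N Th _ A (h 0 (by omega))) (hz N Th _ A (h 1 le_rfl))) (by nlinarith)
  | succ i ih =>
    obtain ⟨C, hC0, ih⟩ := ih
    obtain ⟨C₁, hC₁0, hC₁⟩ := exists_stepU_bound k hθ
    obtain ⟨C₂, hC₂0, hC₂⟩ := exists_stepQ_bound k lam hθ
    have hpi := Real.pi_pos
    set D := C₁ * (C * (2 * Real.pi)) with hD
    have hD0 : 0 ≤ D := by positivity
    refine ⟨D + C₂ * (D + C * 2 * (2 * Real.pi)), by positivity, fun N Th F hF A hA => ?_⟩
    have hs := Th.size_le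
    have hs0 := Th.size_pos.le
    have hU : (∀ m ≤ i + 1, ∀ x ∈ Icc 0 (2 * Real.pi), |F m x| ≤ A) →
        Th.Bdd (Th.corrOp k lam θ (i + 1) F).1 (D * A) := by
      intro h
      have h1 := (ih N Th F hF A hA).2 h
      refine Bdd.mono Th (hC₁ N Th _ (Th.corrOp_cellCont i hF).2 _ (by positivity) h1) ?_
      calc C₁ * (C * A * Th.size) ≤ C₁ * (C * A * (2 * Real.pi)) := by gcongr
        _ = D * A := by rw [hD]; ring
    refine ⟨fun h => Bdd.mono Th (hU h) ?_, fun h => ?_⟩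
    · have : 0 ≤ C₂ * (D + C * 2 * (2 * Real.pi)) * A := by positivity
      linarith
    · have h1 := hU fun m hm => h m (by omega)
      -- `evo` reads two derivatives further, so the range `m ≤ i` becomes `m ≤ i + 2`, as available
      -- for the second component of step `i + 1`.
      have h2 := (ih N Th (evo F) hF.evo (2 * A) (by positivity)).1 fun m hm x hx => by
        unfold evo
        refine (abs_sub _ _).trans ?_
        have := h (m + 2) (by omega) x hx
        have := h (m + 1) (by omega) x hx
        linarith
      refine Bdd.mono Th (hC₂ N Th _ _ (Th.corrOp_cellCont (i + 1) hF).1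
        (Th.corrOp_cellCont i hF.evo).1 _ _ (by positivity) (by positivity) h1 h2) ?_
      calc C₂ * (D * A + C * (2 * A) * Th.size) ≤ C₂ * (D * A + C * (2 * A) * (2 * Real.pi)) := by
            gcongr
        _ = C₂ * (D + C * 2 * (2 * Real.pi)) * A := by ring
        _ ≤ _ := by
          have : 0 ≤ D * A := by positivity
          linarith

lemma JetReg.exists_vh {N : ℕ} (Th : Mesh N) {k : ℕ} {K : ℝ} (hK : 0 ≤ K) {F : ℕ → ℝ → ℝ}
    (hF : JetReg k K F) :
    ∃ r : Vh N k, Th.Bdd (fun j x => F 0 x - r.toBroken j x) (K * Th.size ^ (k + 1)) := by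
  choose r hr hb using fun j => JetReg.exists_poly hK (Th.left_le_right j)
    (Th.cellLength_le_size j) (Th.cell_subset j) hF
  exact ⟨fun j => ⟨r j, hr j⟩, fun j x hx => hb j x hx⟩

/-- The corrections of order `i` have size `h ^ (k + 1 + i)`. -/
lemma exists_corrOp_error (k : ℕ) (lam : ℝ) {θ : ℝ} (hθ : θ ≠ 1 / 2) (i : ℕ) : ∃ C : ℝ, 0 ≤ C ∧
    ∀ (N : ℕ) (Th : Mesh N) (F : ℕ → ℝ → ℝ), JetCont F → ∀ K : ℝ, 0 ≤ K →
      (JetReg (k + i) K F → Th.Bdd (Th.corrOp k lam θ i F).1 (C * K * Th.size ^ (k + 1 + i))) ∧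
      (JetReg (k + i + 1) K F →
        Th.Bdd (Th.corrOp k lam θ i F).2 (C * K * Th.size ^ (k + 1 + i))) := by
  induction i with
  | zero =>
    obtain ⟨C₁, hC₁0, hC₁⟩ := exists_projU_error k hθ
    obtain ⟨C₂, hC₂0, hC₂⟩ := exists_projQ_error k lam hθ
    refine ⟨C₁ + C₂, by positivity, fun N Th F hF K hK => ?_⟩
    have hs0 := Th.size_pos.le
    have hA : 0 ≤ K * Th.size ^ (k + 1) := by positivity
    refine ⟨fun h => ?_, fun h => ?_⟩
    · obtain ⟨r, hr⟩ := JetReg.exists_vh Th hK h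
      refine Bdd.mono Th (hC₁ N Th (fun _ => F 0) (CellCont.of_continuousOn (hF 0)) r _ hA hr) ?_
      rw [add_zero]; nlinarith
    · obtain ⟨r, hr⟩ := JetReg.exists_vh Th hK (h.mono (Nat.le_succ _))
      -- The approximation of `F 1` accounts for the additional order of regularity asked of the
      -- second component.
      obtain ⟨s, hs⟩ := JetReg.exists_vh Th hK h.shift
      refine Bdd.mono Th (hC₂ N Th (fun _ => F 0) (fun _ => F 1) (CellCont.of_continuousOn (hF 0))
        (CellCont.of_continuousOn (hF 1)) r s _ hA hr hs) ?_
      rw [add_zero]; nlinarith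
  | succ i ih =>
    obtain ⟨C, hC0, ih⟩ := ih
    obtain ⟨C₁, hC₁0, hC₁⟩ := exists_stepU_bound k hθ
    obtain ⟨C₂, hC₂0, hC₂⟩ := exists_stepQ_bound k lam hθ
    refine ⟨C₁ * C + C₂ * (C₁ * C + C * 2), by positivity, fun N Th F hF K hK => ?_⟩
    have hs0 := Th.size_pos.le
    have hA : 0 ≤ K * Th.size ^ (k + 1 + (i + 1)) := by positivity
    have hU : JetReg (k + (i + 1)) K F → Th.Bdd (Th.corrOp k lam θ (i + 1) F).1
        (C₁ * C * K * Th.size ^ (k + 1 + (i + 1))) := by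
      intro h
      have h1 := (ih N Th F hF K hK).2 h
      refine Bdd.mono Th (hC₁ N Th _ (Th.corrOp_cellCont i hF).2 _ (by positivity) h1)
        (le_of_eq (by ring))
    refine ⟨fun h => Bdd.mono Th (hU h) ?_, fun h => ?_⟩
    · have : 0 ≤ C₂ * (C₁ * C + C * 2) * (K * Th.size ^ (k + 1 + (i + 1))) := by positivity
      linarith
    · have h1 := hU (h.mono (Nat.le_succ _))
      have h2 := (ih N Th (evo F) hF.evo (2 * K) (by positivity)).1
        (JetReg.evo (h.mono (by omega)))
      refine Bdd.mono Th (hC₂ N Th _ _ (Th.corrOp_cellCont (i + 1) hF).1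
        (Th.corrOp_cellCont i hF.evo).1 _ _ (by positivity) (by positivity) h1 h2) ?_
      have e : C₂ * (C₁ * C * K * Th.size ^ (k + 1 + (i + 1))
          + C * (2 * K) * Th.size ^ (k + 1 + i) * Th.size)
          = C₂ * (C₁ * C + C * 2) * (K * Th.size ^ (k + 1 + (i + 1))) := by ring
      rw [e]
      have : 0 ≤ C₁ * C * (K * Th.size ^ (k + 1 + (i + 1))) := by positivity
      linarith

/-! ### Moments and traces of the corrections -/

variable {N : ℕ} (Th : Mesh N) {k : ℕ} {lam θ : ℝ} (hθ : θ ≠ 1 / 2)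

include hθ

lemma corrOp_zero_orth {F : ℕ → ℝ → ℝ} (hF : JetCont F) (j : Fin N) {r : ℝ[X]}
    (hr : r ∈ degreeLT ℝ k) :
    Th.cellInner j ((Th.corrOp k lam θ 0 F).1 j) (fun x => r.eval x) = 0 ∧
    Th.cellInner j ((Th.corrOp k lam θ 0 F).2 j) (fun x => r.eval x) = 0 := by
  have hn : ∀ f g : ℝ → ℝ, Th.cellInner j (fun x => f x - g x) (fun x => r.eval x) = 0 →
      Th.cellInner j (fun x => g x - f x) (fun x => r.eval x) = 0 := by
    intro f g h
    have : Th.cellInner j (fun x => g x - f x) (fun x => r.eval x)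
        = - Th.cellInner j (fun x => f x - g x) (fun x => r.eval x) := by
      unfold cellInner
      rw [← intervalIntegral.integral_neg]
      congr 1; ext x; ring
    rw [this, h, neg_zero]
  exact ⟨hn _ _ ((Th.projU_spec hθ (CellCont.of_continuousOn (hF 0))).1 j r hr),
    hn _ _ ((Th.projQ_spec (lam := lam) (z := fun _ => F 0) hθ
      (CellCont.of_continuousOn (hF 1))).1 j r hr)⟩

lemma corrOp_succ_inner (i : ℕ) {F : ℕ → ℝ → ℝ} (hF : JetCont F) (j : Fin N) {r : ℝ[X]}
    (hr : r ∈ degreeLT ℝ k) :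
    Th.cellInner j ((Th.corrOp k lam θ (i + 1) F).1 j) (fun x => r.eval x)
      = Th.cellInner j (Th.prim (Th.corrOp k lam θ i F).2 j) (fun x => r.eval x) ∧
    Th.cellInner j ((Th.corrOp k lam θ (i + 1) F).2 j) (fun x => r.eval x)
      = Th.cellInner j ((Th.corrOp k lam θ (i + 1) F).1 j) (fun x => r.eval x)
        + Th.cellInner j (Th.prim (Th.corrOp k lam θ i (evo F)).1 j) (fun x => r.eval x) := by
  have c1 := Th.corrOp_cellCont (k := k) (lam := lam) (θ := θ) i hF
  have c2 := Th.corrOp_cellCont (k := k) (lam := lam) (θ := θ) (i + 1) hF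
  have c3 := Th.corrOp_cellCont (k := k) (lam := lam) (θ := θ) i hF.evo
  have hrc : ContinuousOn (fun x => r.eval x) (Icc (Th.left j) (Th.right j)) :=
    r.continuous.continuousOn
  constructor
  · have h := (Th.stepU_spec (k := k) hθ c1.2).1 j r hr
    rw [Th.cellInner_sub j (CellCont.toBroken Th _ j) (c1.2.prim j) hrc] at h
    exact sub_eq_zero.mp h
  · have h := (Th.stepQ_spec (k := k) (lam := lam) hθ c2.1 c3.1).1 j r hr
    have hadd := Th.cellInner_add j (c2.1 j) (c3.1.prim j) hrc
    have hsub := Th.cellInner_sub j (CellCont.toBroken Th (Th.stepQ k lam θ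
      (Th.corrOp k lam θ (i + 1) F).1 (Th.corrOp k lam θ i (evo F)).1) j)
      ((c2.1 j).add (c3.1.prim j)) hrc
    rw [← hadd]
    exact sub_eq_zero.mp (hsub.symm.trans h)

/-- Each step loses one degree of orthogonality: a test polynomial is a derivative `R'`, and by
`cellInner_prim` the moment of the primitive against `R'` is a combination of moments of the
previous correction against `1` and `R`. -/
lemma corrOp_orth (i : ℕ) (j : Fin N) : ∀ {F : ℕ → ℝ → ℝ}, JetCont F → ∀ {r : ℝ[X]},
    r ∈ degreeLT ℝ (k - i) →
    Th.cellInner j ((Th.corrOp k lam θ i F).1 j) (fun x => r.eval x) = 0 ∧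
    Th.cellInner j ((Th.corrOp k lam θ i F).2 j) (fun x => r.eval x) = 0 := by
  induction i with
  | zero => intro F hF r hr; exact Th.corrOp_zero_orth hθ hF j hr
  | succ i ih =>
    intro F hF r hr
    -- The subtraction is truncated: for `k ≤ i` the test space is zero, while for `i < k` the
    -- constants are still available at level `i`.
    rcases Nat.eq_zero_or_pos (k - i) with h0 | hpos
    · have : r = 0 := by
        rw [show k - (i + 1) = 0 by omega, mem_degreeLT] at hr
        simpa using hr
      subst this
      simp [cellInner]
    · obtain ⟨R, hR, rfl⟩ := exists_antiderivative hr
      rw [show k - (i + 1) + 1 = k - i by omega] at hR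
      have h1 : (1 : ℝ[X]) ∈ degreeLT ℝ (k - i) := by
        rw [mem_degreeLT]
        exact lt_of_le_of_lt degree_one_le (by exact_mod_cast hpos)
      have hp : ∀ v : Broken N, Th.CellCont v →
          Th.cellInner j (v j) (fun x => (1 : ℝ[X]).eval x) = 0 →
          Th.cellInner j (v j) (fun x => R.eval x) = 0 →
          Th.cellInner j (Th.prim v j) (fun x => (derivative R).eval x) = 0 := by
        intro v hv e1 e2
        simp only [eval_one] at e1
        rw [Th.cellInner_prim hv, e1, e2]; ring
      have hs := Th.corrOp_succ_inner (lam := lam) hθ i hF j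
        (degreeLT_mono (by omega : k - (i + 1) ≤ k) hr)
      have hu := hp _ (Th.corrOp_cellCont i hF).2 (ih hF h1).2 (ih hF hR).2
      have hq := hp _ (Th.corrOp_cellCont i hF.evo).1 (ih hF.evo h1).1 (ih hF.evo hR).1
      rw [hs.2, hs.1, hu, hq]
      simp

/-- Testing the corrections with derivatives moves the index down. -/
lemma corrOp_succ_inner_derivative {i : ℕ} (hi : i < k) {F : ℕ → ℝ → ℝ} (hF : JetCont F)
    (j : Fin N) {v : ℝ[X]} (hv : v ∈ degreeLT ℝ (k + 1)) :
    Th.cellInner j ((Th.corrOp k lam θ (i + 1) F).1 j) (fun x => (derivative v).eval x)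
      = - Th.cellInner j ((Th.corrOp k lam θ i F).2 j) (fun x => v.eval x) ∧
    Th.cellInner j ((Th.corrOp k lam θ (i + 1) F).2 j) (fun x => (derivative v).eval x)
      = Th.cellInner j ((Th.corrOp k lam θ (i + 1) F).1 j) (fun x => (derivative v).eval x)
        - Th.cellInner j ((Th.corrOp k lam θ i (evo F)).1 j) (fun x => v.eval x) := by
  have h1 : (1 : ℝ[X]) ∈ degreeLT ℝ (k - i) := by
    rw [mem_degreeLT]
    exact lt_of_le_of_lt degree_one_le (by exact_mod_cast Nat.sub_pos_of_lt hi)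
  have hs := Th.corrOp_succ_inner (lam := lam) hθ i hF j (derivative_mem_degreeLT hv)
  have e1 := (Th.corrOp_orth (lam := lam) hθ i j hF h1).2
  have e2 := (Th.corrOp_orth (lam := lam) hθ i j hF.evo h1).1
  simp only [eval_one] at e1 e2
  constructor
  · rw [hs.1, Th.cellInner_prim (Th.corrOp_cellCont i hF).2, e1]; ring
  · rw [hs.2, Th.cellInner_prim (Th.corrOp_cellCont i hF.evo).1, e2]; ring

/-- For `i = 0`, vanishing of the `θ`-average makes the `lam`-average of `u - P_θ u` equal to `-(lam
- θ)` times its jump. The jump term of `projQ` is chosen to match this, so interpolation errors and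
corrections obey the same node conditions. -/
lemma corrOp_wavg (i : ℕ) {F : ℕ → ℝ → ℝ} (hF : JetCont F) (j : Fin N) :
    Th.wavg θ (Th.corrOp k lam θ i F).1 j = 0 ∧
    Th.wavg (1 - θ) (Th.corrOp k lam θ i F).2 j = Th.wavg lam (Th.corrOp k lam θ i F).1 j := by
  cases i with
  | zero =>
    have h1 := (Th.projU_spec (k := k) hθ (CellCont.of_continuousOn (hF 0))).2 j
    have h2 := (Th.projQ_spec (k := k) (lam := lam) (z := fun _ => F 0) hθ
      (CellCont.of_continuousOn (hF 1))).2 j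
    simp only [wavg, minus, plus, jump] at h1 h2
    simp only [corrOp, wavg, minus, plus]
    constructor
    · linarith
    · linear_combination h1 - h2
  | succ i =>
    exact ⟨(Th.stepU_spec hθ (Th.corrOp_cellCont i hF).2).2 j,
      (Th.stepQ_spec hθ (Th.corrOp_cellCont (i + 1) hF).1 (Th.corrOp_cellCont i hF.evo).1).2 j⟩

end Mesh

/-! ### Functions with bounded weak derivatives -/

lemma exists_test_integral_one {a b : ℝ} (hab : a < b) :
    ∃ ψ : ℝ → ℝ, ContDiff ℝ ∞ ψ ∧ HasCompactSupport ψ ∧ tsupport ψ ⊆ Ioo a b ∧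
      ∫ x in a..b, ψ x = 1 := by
  have hmid : (a + b) / 2 ∈ Ioo a b := ⟨by linarith, by linarith⟩
  obtain ⟨ψ, h1, h2, h3, h4, h5⟩ := exists_contDiff_tsupport_subset (n := ⊤)
    (isOpen_Ioo.mem_nhds hmid)
  have hpos : 0 < ∫ x in a..b, ψ x := by
    refine intervalIntegral.integral_pos hab h3.continuous.continuousOn
      (fun x _ => (h4 ⟨x, rfl⟩).1) ⟨_, Ioo_subset_Icc_self hmid, ?_⟩
    rw [h5]; norm_num
  refine ⟨fun x => (∫ x in a..b, ψ x)⁻¹ * ψ x, contDiff_const.mul h3, h2.mul_left,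
    (tsupport_mul_subset_right).trans h1, ?_⟩
  rw [intervalIntegral.integral_const_mul]
  exact inv_mul_cancel₀ hpos.ne'

/-- The primitive from `a` vanishes to the left of the support of `χ`, and to its right because `χ`
has mean zero. The extreme points of the support lie strictly inside `(a, b)`, hence so does the
support of the primitive. -/
lemma exists_test_primitive {a b : ℝ} {χ : ℝ → ℝ} (hχ : ContDiff ℝ ∞ χ)
    (hc : HasCompactSupport χ) (hs : tsupport χ ⊆ Ioo a b) (h0 : ∫ x in a..b, χ x = 0) :
    ∃ φ : ℝ → ℝ, ContDiff ℝ ∞ φ ∧ HasCompactSupport φ ∧ tsupport φ ⊆ Ioo a b ∧ deriv φ = χ := by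
  rcases (tsupport χ).eq_empty_or_nonempty with he | hne
  · have : χ = 0 := tsupport_eq_empty_iff.mp he
    subst this
    exact ⟨0, contDiff_const, HasCompactSupport.zero, by simp, by ext x; simp⟩
  · obtain ⟨α, hα, hαl⟩ := IsCompact.exists_isLeast hc hne
    obtain ⟨β, hβ, hβl⟩ := IsCompact.exists_isGreatest hc hne
    have hz : ∀ x, x ∉ Icc α β → χ x = 0 := by
      intro x hx
      by_contra h
      have hx' := subset_tsupport χ h
      exact hx ⟨hαl hx', hβl hx'⟩
    have hder : ∀ x, HasDerivAt (fun x => ∫ y in a..x, χ y) (χ x) x := fun x =>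
      intervalIntegral.integral_hasDerivAt_right (hχ.continuous.intervalIntegrable _ _)
        hχ.continuous.stronglyMeasurable.stronglyMeasurableAtFilter hχ.continuous.continuousAt
    have hd : deriv (fun x => ∫ y in a..x, χ y) = χ := funext fun x => (hder x).deriv
    have hsub : Function.support (fun x => ∫ y in a..x, χ y) ⊆ Icc α β := by
      intro x hx
      by_contra hxn
      apply hx
      have hcase : x < α ∨ β < x := by
        by_contra h
        push Not at h
        exact hxn ⟨h.1, h.2⟩
      rcases hcase with h | h
      · refine (intervalIntegral.integral_congr (g := fun _ => (0 : ℝ)) fun y hy => hz y ?_).trans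
          (by simp)
        intro hy'
        have := (hs hα).1
        have h1 := hy.2
        have h2 := hy'.1
        have : max a x < α := max_lt this h
        exact absurd (h2.trans h1) (not_le.mpr this)
      · change ∫ y in a..x, χ y = 0
        rw [← intervalIntegral.integral_add_adjacent_intervals
          (hχ.continuous.intervalIntegrable a b) (hχ.continuous.intervalIntegrable b x), h0, zero_add]
        refine (intervalIntegral.integral_congr (g := fun _ => (0 : ℝ)) fun y hy => hz y ?_).trans
          (by simp)
        intro hy'
        have := (hs hβ).2
        have h1 := hy.1
        have h2 := hy'.2
        have : β < min b x := lt_min this h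
        exact absurd (h1.trans h2) (not_le.mpr this)
    refine ⟨fun x => ∫ y in a..x, χ y, ?_, ?_, ?_, hd⟩
    · rw [contDiff_infty_iff_deriv]
      exact ⟨fun x => (hder x).differentiableAt, by rw [hd]; exact hχ⟩
    · exact HasCompactSupport.of_support_subset_isCompact isCompact_Icc hsub
    · refine (closure_minimal hsub isClosed_Icc).trans ?_
      exact fun x hx => ⟨(hs hα).1.trans_le hx.1, hx.2.trans_lt (hs hβ).2⟩

/-- A function with an integrable weak derivative is almost everywhere equal to a primitive. -/
lemma ae_eq_primitive_of_weakDeriv {a b : ℝ} (hab : a < b) {f g : ℝ → ℝ}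
    (hf : IntervalIntegrable f volume a b) (hg : IntervalIntegrable g volume a b)
    (h : ∀ φ : ℝ → ℝ, ContDiff ℝ ∞ φ → HasCompactSupport φ → tsupport φ ⊆ Ioo a b →
      ∫ x in a..b, f x * deriv φ x = - ∫ x in a..b, g x * φ x) :
    ∃ c : ℝ, ∀ᵐ x, x ∈ Ioo a b → f x = c + ∫ y in a..x, g y := by
  obtain ⟨ψ₀, hψ₀, hψ₀c, hψ₀s, hψ₀1⟩ := exists_test_integral_one hab
  set G : ℝ → ℝ := fun x => ∫ y in a..x, g y with hG
  have hGac : AbsolutelyContinuousOnInterval G a b :=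
    hg.absolutelyContinuousOnInterval_intervalIntegral (by simp)
  have hGint : IntervalIntegrable G volume a b := hGac.continuousOn.intervalIntegrable
  -- The weak derivative of `f - G` is zero; integration by parts for `G` needs only its absolute
  -- continuity.
  have key : ∀ φ : ℝ → ℝ, ContDiff ℝ ∞ φ → HasCompactSupport φ → tsupport φ ⊆ Ioo a b →
      ∫ x in a..b, (f x - G x) * deriv φ x = 0 := by
    intro φ hφ hφc hφs
    have hzero : ∀ x, x ∉ Ioo a b → φ x = 0 := fun x hx =>
      image_eq_zero_of_notMem_tsupport fun h' => hx (hφs h')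
    have hdc : Continuous (deriv φ) := hφ.continuous_deriv (by norm_cast)
    have hφac : AbsolutelyContinuousOnInterval φ a b :=
      ContDiffOn.absolutelyContinuousOnInterval
        ((hφ.of_le (by norm_cast)).contDiffOn)
    have h1 := hGac.integral_mul_deriv_eq_deriv_mul hφac
    rw [hzero a (by simp), hzero b (by simp)] at h1
    have h2 : ∫ x in a..b, deriv G x * φ x = ∫ x in a..b, g x * φ x := by
      apply intervalIntegral.integral_congr_ae
      filter_upwards [hg.ae_hasDerivAt_integral] with x hx hxm
      rw [(hx (uIoc_subset_uIcc hxm) a (by simp)).deriv]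
    have h3 := h φ hφ hφc hφs
    have e : ∀ x, (f x - G x) * deriv φ x = f x * deriv φ x - G x * deriv φ x := fun x => by ring
    simp only [e]
    rw [intervalIntegral.integral_sub (hf.mul_continuousOn hdc.continuousOn)
      (hGint.mul_continuousOn hdc.continuousOn), h3, h1, h2]
    ring
  set c := ∫ x in a..b, (f x - G x) * ψ₀ x with hc
  have hHint : IntervalIntegrable (fun x => f x - G x - c) volume a b :=
    (hf.sub hGint).sub intervalIntegrable_const
  refine ⟨c, ?_⟩
  have hae := isOpen_Ioo.ae_eq_zero_of_integral_contDiff_smul_eq_zero (μ := volume)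
    (f := fun x => f x - G x - c) (U := Ioo a b) (IntegrableOn.locallyIntegrableOn
      (by
        rw [intervalIntegrable_iff_integrableOn_Ioo_of_le hab.le] at hHint
        exact hHint)) (by
      intro ψ hψ hψc hψs
      -- The du Bois-Reymond argument: removing from `ψ` the multiple of `ψ₀` with the same integral
      -- leaves the derivative of a test function. Hence `f - G` pairs with `ψ` as the constant `c`
      -- does.
      obtain ⟨φ, hφ, hφc, hφs, hφd⟩ := exists_test_primitive (a := a) (b := b)
        (χ := fun x => ψ x - (∫ y in a..b, ψ y) * ψ₀ x) (hψ.sub (contDiff_const.mul hψ₀))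
        (hψc.sub (hψ₀c.mul_left))
        ((tsupport_sub _ _).trans (union_subset hψs ((tsupport_mul_subset_right).trans hψ₀s)))
        (by
          rw [intervalIntegral.integral_sub (hψ.continuous.intervalIntegrable _ _)
            ((hψ₀.continuous.intervalIntegrable _ _).const_mul _),
            intervalIntegral.integral_const_mul, hψ₀1]
          ring)
      have h1 := key φ hφ hφc hφs
      rw [hφd] at h1
      have hsupp : Function.support (fun x => ψ x • (f x - G x - c)) ⊆ Ioc a b := by
        intro x hx
        refine Ioo_subset_Ioc_self (hψs (subset_tsupport _ fun h0 => hx ?_))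
        change ψ x • _ = 0
        rw [h0, zero_smul]
      rw [← intervalIntegral.integral_eq_integral_of_support_subset hsupp]
      have hi := hf.sub hGint
      have iψ := hi.mul_continuousOn (hψ.continuous.continuousOn (s := uIcc a b))
      have iψ₀ := hi.mul_continuousOn (hψ₀.continuous.continuousOn (s := uIcc a b))
      have e : ∀ x, ψ x • (f x - G x - c)
          = (f x - G x) * (ψ x - (∫ y in a..b, ψ y) * ψ₀ x)
            + ((∫ y in a..b, ψ y) * ((f x - G x) * ψ₀ x) - c * ψ x) := by
        intro x; rw [smul_eq_mul]; ring
      simp only [e]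
      have e2 : IntervalIntegrable (fun x => (f x - G x) * (ψ x - (∫ y in a..b, ψ y) * ψ₀ x))
          volume a b := hi.mul_continuousOn
            (hψ.continuous.sub (continuous_const.mul hψ₀.continuous)).continuousOn
      have e3 : IntervalIntegrable (fun x => (∫ y in a..b, ψ y) * ((f x - G x) * ψ₀ x))
          volume a b := iψ₀.const_mul _
      have e4 : IntervalIntegrable (fun x => c * ψ x) volume a b :=
        (hψ.continuous.intervalIntegrable _ _).const_mul _
      rw [intervalIntegral.integral_add e2 (e3.sub e4), h1, intervalIntegral.integral_sub e3 e4,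
        intervalIntegral.integral_const_mul, intervalIntegral.integral_const_mul, ← hc]
      ring)
  filter_upwards [hae] with x hx hxm
  have := hx hxm
  linarith

/-- Testing order `i` with `φ'` and order `i + 1` with `φ` involves the same integral of `f`;
consecutive weak derivatives are therefore weak derivatives of each other. -/
lemma IsWeakDeriv.intervalIntegral_eq {a b : ℝ} {i : ℕ} {f g h : ℝ → ℝ}
    (hg : IsWeakDeriv (Ioo a b) i f g) (hh : IsWeakDeriv (Ioo a b) (i + 1) f h)
    {φ : ℝ → ℝ} (hφ : ContDiff ℝ ∞ φ) (hφc : HasCompactSupport φ) (hφs : tsupport φ ⊆ Ioo a b) :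
    ∫ x in a..b, g x * deriv φ x = - ∫ x in a..b, h x * φ x := by
  have hsupp : ∀ w ψ : ℝ → ℝ, tsupport ψ ⊆ Ioo a b →
      ∫ x in a..b, w x * ψ x = ∫ x, w x * ψ x := by
    intro w ψ hψ
    apply intervalIntegral.integral_eq_integral_of_support_subset
    intro x hx
    refine Ioo_subset_Ioc_self (hψ (subset_tsupport _ fun h0 => hx ?_))
    change w x * ψ x = 0
    rw [h0, mul_zero]
  have hds : tsupport (deriv φ) ⊆ Ioo a b := (tsupport_deriv_subset).trans hφs
  rw [hsupp _ _ hφs, hsupp _ _ hds]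
  have h1 := hg.2.2 (deriv φ) (contDiff_infty_iff_deriv.mp hφ).2 hφc.deriv hds
  have h2 := hh.2.2 φ hφ hφc hφs
  rw [← iteratedDeriv_succ', h2, pow_succ] at h1
  have hp : ((-1 : ℝ) ^ i) ≠ 0 := by simp
  have h3 : (-1 : ℝ) ^ i * (-1 * ∫ x, h x * φ x) = (-1) ^ i * ∫ x, g x * deriv φ x := by
    rw [← h1]; ring
  have := mul_left_cancel₀ hp h3
  linarith

/-- A continuous function with weak derivatives up to order `n + 1` bounded by `K` has classical
derivatives up to order `n`, which are `K`-Lipschitz. -/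
lemma exists_jet {n : ℕ} {K : ℝ} {f : ℝ → ℝ} (hf : Continuous f) {g : ℕ → ℝ → ℝ}
    (hg : ∀ i ≤ n + 1, IsWeakDeriv (Ioo 0 (2 * Real.pi)) i f (g i))
    (hK : ∀ i ≤ n + 1, ∀ᵐ x, x ∈ Ioo 0 (2 * Real.pi) → |g i x| ≤ K) :
    ∃ F : ℕ → ℝ → ℝ, JetCont F ∧ JetReg n K F ∧ ∀ x ∈ Icc 0 (2 * Real.pi), F 0 x = f x := by
  have hpi : (0 : ℝ) < 2 * Real.pi := by positivity
  have hint : ∀ i ≤ n + 1, IntervalIntegrable (g i) volume 0 (2 * Real.pi) := by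
    intro i hi
    rw [intervalIntegrable_iff_integrableOn_Ioo_of_le hpi.le]
    refine Integrable.of_bound (hg i hi).2.1.aestronglyMeasurable K ?_
    rw [ae_restrict_iff' measurableSet_Ioo]
    exact hK i hi
  have hex : ∀ i, ∃ c : ℝ, i ≤ n → ∀ᵐ x, x ∈ Ioo 0 (2 * Real.pi) →
      g i x = c + ∫ y in (0 : ℝ)..x, g (i + 1) y := by
    intro i
    by_cases hi : i ≤ n
    · obtain ⟨c, hc⟩ := ae_eq_primitive_of_weakDeriv hpi (hint i (by omega))
        (hint (i + 1) (by omega)) fun φ h1 h2 h3 =>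
          (hg i (by omega)).intervalIntegral_eq (hg (i + 1) (by omega)) h1 h2 h3
      exact ⟨c, fun _ => hc⟩
    · exact ⟨0, fun h => absurd h hi⟩
  choose c hc using hex
  have hsub : ∀ i ≤ n + 1, ∀ x ∈ Icc 0 (2 * Real.pi), ∀ y ∈ Icc 0 (2 * Real.pi),
      IntervalIntegrable (g i) volume x y := fun i hi x hx y hy =>
    (hint i hi).mono_set (by
      rw [uIcc_of_le hpi.le]
      exact (uIcc_subset_Icc hx hy))
  have h0mem : (0 : ℝ) ∈ Icc 0 (2 * Real.pi) := ⟨le_rfl, hpi.le⟩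
  -- The continuous representatives of the weak derivatives. Entries beyond `n` are set to zero
  -- because `JetCont` asks for continuity at every index.
  set F : ℕ → ℝ → ℝ := fun i x => if i ≤ n then c i + ∫ y in (0 : ℝ)..x, g (i + 1) y else 0 with hF
  have hFe : ∀ i ≤ n, ∀ x, F i x = c i + ∫ y in (0 : ℝ)..x, g (i + 1) y := fun i hi x => by
    simp only [hF, hi, if_true]
  have hFlip : ∀ i ≤ n, ∀ x ∈ Icc 0 (2 * Real.pi), ∀ y ∈ Icc 0 (2 * Real.pi),
      |F i x - F i y| ≤ K * |x - y| := by
    intro i hi x hx y hy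
    rw [hFe i hi, hFe i hi, add_sub_add_left_eq_sub,
      intervalIntegral.integral_interval_sub_left (hsub _ (by omega) _ h0mem _ hx)
        (hsub _ (by omega) _ h0mem _ hy)]
    change ‖∫ z in y..x, g (i + 1) z‖ ≤ K * |x - y|
    refine intervalIntegral.norm_integral_le_of_norm_le_const_ae ?_
    have hne : ∀ᵐ z : ℝ, z ≠ 2 * Real.pi := by
      simp [ae_iff, measure_singleton]
    filter_upwards [hK (i + 1) (by omega), hne] with z hz hz2 hzm
    have hz' : z ∈ Ioc 0 (2 * Real.pi) := by
      have h1 : min y x < z := hzm.1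
      have h2 : z ≤ max y x := hzm.2
      exact ⟨lt_of_le_of_lt (le_min hy.1 hx.1) h1, h2.trans (max_le hy.2 hx.2)⟩
    exact hz ⟨hz'.1, lt_of_le_of_ne hz'.2 hz2⟩
  have hFcont : JetCont F := by
    intro i
    by_cases hi : i ≤ n
    · have hL : LipschitzOnWith (Real.toNNReal (max K 0)) (F i) (Icc 0 (2 * Real.pi)) := by
        refine LipschitzOnWith.of_dist_le_mul fun x hx y hy => ?_
        rw [Real.dist_eq, Real.dist_eq, Real.coe_toNNReal _ (le_max_right _ _)]
        refine (hFlip i hi x hx y hy).trans ?_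
        gcongr
        exact le_max_left _ _
      exact hL.continuousOn
    · have : F i = fun _ => 0 := by
        ext x; simp only [hF, hi, if_false]
      rw [this]
      exact continuousOn_const
  have hFg : ∀ i ≤ n, ∀ᵐ x, x ∈ Ioo 0 (2 * Real.pi) → g i x = F i x := by
    intro i hi
    filter_upwards [hc i hi] with x hx hxm
    rw [hFe i hi, hx hxm]
  refine ⟨F, hFcont, ⟨fun i hi x hx => ?_, hFlip⟩, ?_⟩
  -- Inside the integral, `g (i + 1)` may be replaced by its continuous representative, which gives
  -- differentiability at every point, end points included.
  · have hprim := (hasDerivWithinAt_primitive (hFcont (i + 1)) x hx).const_add (c i)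
    refine hprim.congr_of_mem (fun y hy => ?_) hx
    rw [hFe i hi.le]
    congr 1
    apply intervalIntegral.integral_congr_ae
    have hne : ∀ᵐ z : ℝ, z ≠ 2 * Real.pi := by
      simp [ae_iff, measure_singleton]
    filter_upwards [hFg (i + 1) hi, hne] with z hz hz2 hzm
    rw [uIoc_of_le hy.1] at hzm
    exact hz ⟨hzm.1, lt_of_le_of_ne (hzm.2.trans hy.2) hz2⟩
  · have h0 := hg 0 (by omega)
    have hae := isOpen_Ioo.ae_eq_zero_of_integral_contDiff_smul_eq_zero (μ := volume)
      (f := fun x => f x - g 0 x) (U := Ioo 0 (2 * Real.pi)) (h0.1.sub h0.2.1) (by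
        intro ψ hψ hψc hψs
        have h1 := h0.2.2 ψ hψ hψc hψs
        simp only [iteratedDeriv_zero, pow_zero, one_mul] at h1
        have hsupp : ∀ w : ℝ → ℝ, ∫ x in (0 : ℝ)..(2 * Real.pi), w x * ψ x = ∫ x, w x * ψ x := by
          intro w
          apply intervalIntegral.integral_eq_integral_of_support_subset
          intro x hx
          refine Ioo_subset_Ioc_self (hψs (subset_tsupport _ fun h0 => hx ?_))
          change w x * ψ x = 0
          rw [h0, mul_zero]
        have e : ∀ x, ψ x • (f x - g 0 x) = (f x - g 0 x) * ψ x := fun x => by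
          rw [smul_eq_mul, mul_comm]
        simp only [e]
        rw [← hsupp]
        simp only [sub_mul]
        rw [intervalIntegral.integral_sub
          (show IntervalIntegrable (fun x => f x * ψ x) volume 0 (2 * Real.pi) from
            (hf.mul hψ.continuous).intervalIntegrable _ _)
          ((hint 0 (by omega)).mul_continuousOn hψ.continuous.continuousOn), hsupp, hsupp, h1,
          sub_self])
    have h2 : F 0 =ᵐ[volume.restrict (Icc 0 (2 * Real.pi))] f := by
      rw [Filter.EventuallyEq, ae_restrict_iff' measurableSet_Icc]
      have hne : ∀ᵐ z : ℝ, z ≠ 2 * Real.pi := by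
        simp [ae_iff, measure_singleton]
      have hne' : ∀ᵐ z : ℝ, z ≠ 0 := by
        simp [ae_iff, measure_singleton]
      filter_upwards [hae, hFg 0 (by omega), hne, hne'] with x hx hx2 h3 h4 hxm
      have hxo : x ∈ Ioo 0 (2 * Real.pi) :=
        ⟨lt_of_le_of_ne hxm.1 h4.symm, lt_of_le_of_ne hxm.2 h3⟩
      have := hx hxo
      rw [← hx2 hxo]
      linarith
    exact Measure.eqOn_Icc_of_ae_eq volume hpi.ne h2 (hFcont 0) hf.continuousOn

lemma exists_jet_of_sobolevNorm {n : ℕ} {M : ℝ} {f : ℝ → ℝ} (hf : Continuous f)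
    (h : sobolevNorm (Ioo 0 (2 * Real.pi)) (n + 1) f ≤ ENNReal.ofReal M) :
    ∃ F : ℕ → ℝ → ℝ, JetCont F ∧ JetReg n (max M 0 + 1) F ∧
      ∀ x ∈ Icc 0 (2 * Real.pi), F 0 x = f x := by
  -- A strict bound is needed to extract an admissible family from the infimum.
  have hlt : sobolevNorm (Ioo 0 (2 * Real.pi)) (n + 1) f < ENNReal.ofReal (max M 0 + 1) := by
    refine h.trans_lt ?_
    rw [ENNReal.ofReal_lt_ofReal_iff (by positivity)]
    have := le_max_left M 0
    linarith
  unfold sobolevNorm at hlt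
  simp only [iInf_lt_iff] at hlt
  obtain ⟨g, hg, hlt⟩ := hlt
  refine exists_jet hf hg fun i hi => ?_
  have h1 : eLpNormEssSup (g i) (volume.restrict (Ioo 0 (2 * Real.pi)))
      ≤ ENNReal.ofReal (max M 0 + 1) :=
    (le_iSup₂ (f := fun (i : ℕ) (_ : i ≤ n + 1) =>
      eLpNormEssSup (g i) (volume.restrict (Ioo 0 (2 * Real.pi)))) i hi).trans hlt.le
  have h2 := ae_le_eLpNormEssSup (f := g i) (μ := volume.restrict (Ioo 0 (2 * Real.pi)))
  rw [ae_restrict_iff' measurableSet_Ioo] at h2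
  filter_upwards [h2] with x hx hxm
  have h3 := (hx hxm).trans h1
  rwa [Real.enorm_eq_ofReal_abs, ENNReal.ofReal_le_ofReal_iff (by positivity)] at h3

open Filter Topology

/-! ### Regularity in time -/

/-- The mean value inequality for `g` minus its linear part at `x`, whose derivative is at most `L *
|y - x|` on the segment. -/
lemma taylor_bound {D : Set ℝ} (hD : Convex ℝ D) {g g₁ : ℝ → ℝ} {L : ℝ} (hL : 0 ≤ L)
    (hg : ∀ x ∈ D, HasDerivWithinAt g (g₁ x) D x)
    (hlip : ∀ x ∈ D, ∀ y ∈ D, |g₁ x - g₁ y| ≤ L * |x - y|) {x y : ℝ} (hx : x ∈ D) (hy : y ∈ D) :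
    |g y - g x - (y - x) * g₁ x| ≤ L * |y - x| ^ 2 := by
  have hsub : uIcc x y ⊆ D := by
    rw [← segment_eq_uIcc]; exact hD.segment_subset hx hy
  have hder : ∀ z ∈ uIcc x y, HasDerivWithinAt (fun z => g z - z * g₁ x) (g₁ z - 1 * g₁ x)
      (uIcc x y) z := fun z hz =>
    ((hg z (hsub hz)).mono hsub).sub ((hasDerivWithinAt_id z _).mul_const _)
  have h := Convex.norm_image_sub_le_of_norm_hasDerivWithin_le hder (C := L * |y - x|)
    (fun z hz => by
      rw [one_mul]
      refine (hlip z (hsub hz) x hx).trans ?_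
      have : |z - x| ≤ |y - x| := abs_sub_left_of_mem_uIcc hz
      gcongr) (convex_uIcc x y) left_mem_uIcc right_mem_uIcc
  rw [Real.norm_eq_abs, Real.norm_eq_abs] at h
  calc |g y - g x - (y - x) * g₁ x| = |g y - y * g₁ x - (g x - x * g₁ x)| := by congr 1; ring
    _ ≤ L * |y - x| * |y - x| := h
    _ = L * |y - x| ^ 2 := by ring

lemma hasDerivWithinAt_of_sq_bound {D : Set ℝ} {g : ℝ → ℝ} {g' L x : ℝ}
    (h : ∀ y ∈ D, |g y - g x - (y - x) * g'| ≤ L * |y - x| ^ 2) : HasDerivWithinAt g g' D x := by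
  rw [hasDerivWithinAt_iff_isLittleO]
  have h1 : (fun y => g y - g x - (y - x) • g') =O[𝓝[D] x] fun y => (y - x) ^ 2 := by
    refine Asymptotics.IsBigO.of_bound L ?_
    filter_upwards [self_mem_nhdsWithin] with y hy
    simpa using h y hy
  refine h1.trans_isLittleO ?_
  have h2 : (fun y : ℝ => (y - x) ^ 2) =o[𝓝 x] fun y => y - x := by
    have h3 : (fun y : ℝ => (y - x) ^ 2) = fun y => (y - x) * (y - x) := by ext y; ring
    have h4 : (fun y : ℝ => y - x) =o[𝓝 x] fun _ => (1 : ℝ) := by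
      rw [Asymptotics.isLittleO_one_iff]
      have : Tendsto (fun y : ℝ => y - x) (𝓝 x) (𝓝 (x - x)) := by
        exact tendsto_id.sub tendsto_const_nhds
      simpa using this
    rw [h3]
    simpa using h4.mul_isBigO (Asymptotics.isBigO_refl (fun y : ℝ => y - x) (𝓝 x))
  exact h2.mono nhdsWithin_le_nhds

/-- Landau's inequality: a derivative is small when the function is small and the derivative is
Lipschitz. Since `d ≤ π`, one of the points `x ± d` stays in the interval, and the Taylor bound
there is solved for the derivative. -/
lemma landau_bound {g g₁ : ℝ → ℝ} {L η d : ℝ} (hL : 0 ≤ L)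
    (hg : ∀ x ∈ Icc 0 (2 * Real.pi), HasDerivWithinAt g (g₁ x) (Icc 0 (2 * Real.pi)) x)
    (hlip : ∀ x ∈ Icc 0 (2 * Real.pi), ∀ y ∈ Icc 0 (2 * Real.pi), |g₁ x - g₁ y| ≤ L * |x - y|)
    (hη : ∀ x ∈ Icc 0 (2 * Real.pi), |g x| ≤ η) (hd : 0 < d) (hd1 : d ≤ Real.pi)
    {x : ℝ} (hx : x ∈ Icc 0 (2 * Real.pi)) : |g₁ x| ≤ 2 * η / d + L * d := by
  obtain ⟨y, hy, hyd⟩ : ∃ y ∈ Icc 0 (2 * Real.pi), |y - x| = d := by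
    rcases le_total x Real.pi with h | h
    · exact ⟨x + d, ⟨by linarith [hx.1], by linarith⟩, by simp [abs_of_pos hd]⟩
    · exact ⟨x - d, ⟨by linarith, by linarith [hx.2]⟩, by simp [abs_of_pos hd]⟩
  have h := taylor_bound (convex_Icc _ _) hL hg hlip hx hy
  rw [hyd] at h
  have h1 : d * |g₁ x| ≤ 2 * η + L * d ^ 2 := by
    rw [← hyd, ← abs_mul, hyd]
    have e : (y - x) * g₁ x = (g y - g x) - (g y - g x - (y - x) * g₁ x) := by ring
    rw [e]
    refine (abs_sub _ _).trans (add_le_add ((abs_sub _ _).trans ?_) h)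
    linarith [hη x hx, hη y hy]
  have e2 : 2 * η / d + L * d = (2 * η + L * d ^ 2) / d := by field_simp
  rw [e2, le_div_iff₀ hd]
  linarith

/-- Sequences of derivatives of a periodic solution, with uniform Lipschitz bounds. -/
structure JetFlow (n : ℕ) (K T : ℝ) (u : ℝ → ℝ → ℝ) (U : ℝ → ℕ → ℝ → ℝ) : Prop where
  cont : ∀ t ∈ Icc 0 T, JetCont (U t)
  reg : ∀ t ∈ Icc 0 T, JetReg n K (U t)
  eq : ∀ t ∈ Icc 0 T, ∀ x ∈ Icc 0 (2 * Real.pi), U t 0 x = u t x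

lemma exists_jetFlow {n : ℕ} {M T : ℝ} {u : ℝ → ℝ → ℝ} (hu : IsPeriodicSolution T u)
    (hM : ∀ t ∈ Icc 0 T,
      sobolevNorm (Ioo 0 (2 * Real.pi)) (n + 1) (u t) ≤ ENNReal.ofReal M) :
    ∃ U, JetFlow n (max M 0 + 1) T u U := by
  have : ∀ t, ∃ F : ℕ → ℝ → ℝ, t ∈ Icc 0 T → JetCont F ∧ JetReg n (max M 0 + 1) F ∧
      ∀ x ∈ Icc 0 (2 * Real.pi), F 0 x = u t x := by
    intro t
    by_cases ht : t ∈ Icc 0 T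
    · obtain ⟨F, hF⟩ := exists_jet_of_sobolevNorm (hu.contDiff t ht).continuous (hM t ht)
      exact ⟨F, fun _ => hF⟩
    · exact ⟨fun _ _ => 0, fun h => absurd h ht⟩
  choose U hU using this
  exact ⟨U, fun t ht => (hU t ht).1, fun t ht => (hU t ht).2.1, fun t ht => (hU t ht).2.2⟩

namespace JetFlow

variable {n : ℕ} {K T : ℝ} {u : ℝ → ℝ → ℝ} {U : ℝ → ℕ → ℝ → ℝ}

lemma eq_deriv (hU : JetFlow n K T u U) (hu : IsPeriodicSolution T u) (hn : 2 ≤ n) {t : ℝ}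
    (ht : t ∈ Icc 0 T) {x : ℝ} (hx : x ∈ Icc 0 (2 * Real.pi)) :
    U t 1 x = deriv (u t) x ∧ U t 2 x = deriv (deriv (u t)) x := by
  have hpi : (0 : ℝ) < 2 * Real.pi := by positivity
  have hud : UniqueDiffOn ℝ (Icc 0 (2 * Real.pi)) := uniqueDiffOn_Icc hpi
  have hc := hu.contDiff t ht
  have h1 : ∀ x ∈ Icc 0 (2 * Real.pi), U t 1 x = deriv (u t) x := by
    intro x hx
    have a := ((hU.reg t ht).hasDeriv 0 (by omega) x hx).congr_of_mem
      (fun y hy => (hU.eq t ht y hy).symm) hx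
    have b := ((hc.differentiable (by norm_num)) x).hasDerivAt.hasDerivWithinAt
      (s := Icc 0 (2 * Real.pi))
    exact (hud x hx).eq_deriv _ a b
  refine ⟨h1 x hx, ?_⟩
  have a := ((hU.reg t ht).hasDeriv 1 (by omega) x hx).congr_of_mem
    (fun y hy => (h1 y hy).symm) hx
  have hd : Differentiable ℝ (deriv (u t)) := by
    have : ContDiff ℝ (1 + 1) (u t) := hc
    exact ((contDiff_succ_iff_deriv.mp this).2.2).differentiable (by norm_num)
  exact (hud x hx).eq_deriv _ a (hd x).hasDerivAt.hasDerivWithinAt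

/-- Order zero is uniform continuity of `u` on a compact rectangle. Each further order follows from
Landau's inequality, because the derivatives at all times share one Lipschitz constant. -/
lemma eventually_close (hU : JetFlow n K T u U) (hu : IsPeriodicSolution T u) (hK : 0 ≤ K)
    {t : ℝ} (ht : t ∈ Icc 0 T) : ∀ m ≤ n, ∀ ε > 0, ∀ᶠ s in 𝓝[Icc 0 T] t,
      ∀ x ∈ Icc 0 (2 * Real.pi), |U s m x - U t m x| ≤ ε := by
  intro m
  induction m with
  | zero =>
    intro _ ε hε
    have hcomp : IsCompact (Icc 0 T ×ˢ Icc 0 (2 * Real.pi)) := isCompact_Icc.prod isCompact_Icc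
    have huc := hcomp.uniformContinuousOn_of_continuous
      (hu.continuousOn.mono (prod_mono le_rfl (subset_univ _)))
    rw [Metric.uniformContinuousOn_iff] at huc
    obtain ⟨δ, hδ, h⟩ := huc ε hε
    filter_upwards [self_mem_nhdsWithin, nhdsWithin_le_nhds (Metric.ball_mem_nhds t hδ)]
      with s hs hst x hx
    rw [hU.eq s hs x hx, hU.eq t ht x hx]
    have := h (s, x) ⟨hs, hx⟩ (t, x) ⟨ht, hx⟩ (by
      rw [Prod.dist_eq, dist_self, max_lt_iff]
      exact ⟨hst, hδ⟩)
    exact this.le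
  | succ m ih =>
    intro hm ε hε
    -- The step `d` is fixed first, to make the Lipschitz part at most `ε / 2`; closeness `ε * d /
    -- 4` at the previous order then makes the other part `ε / 2`.
    obtain ⟨d, hd, hd1, hdL⟩ : ∃ d > 0, d ≤ Real.pi ∧ 2 * K * d ≤ ε / 2 := by
      refine ⟨min Real.pi (ε / 2 / (2 * K + 1)), by positivity, min_le_left _ _, ?_⟩
      have h1 := min_le_right Real.pi (ε / 2 / (2 * K + 1))
      calc 2 * K * min Real.pi (ε / 2 / (2 * K + 1))
          ≤ (2 * K + 1) * (ε / 2 / (2 * K + 1)) := by gcongr; linarith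
        _ = ε / 2 := by field_simp
    filter_upwards [self_mem_nhdsWithin, ih (by omega) (ε * d / 4) (by positivity)] with s hs h x hx
    have := landau_bound (g := fun x => U s m x - U t m x)
      (g₁ := fun x => U s (m + 1) x - U t (m + 1) x) (L := 2 * K) (by positivity)
      (fun x hx => ((hU.reg s hs).hasDeriv m (by omega) x hx).sub
        ((hU.reg t ht).hasDeriv m (by omega) x hx))
      (fun x hx y hy => by
        have h1 := (hU.reg s hs).lip (m + 1) hm x hx y hy
        have h2 := (hU.reg t ht).lip (m + 1) hm x hx y hy
        have e : U s (m + 1) x - U t (m + 1) x - (U s (m + 1) y - U t (m + 1) y)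
            = (U s (m + 1) x - U s (m + 1) y) - (U t (m + 1) x - U t (m + 1) y) := by ring
        rw [e]
        refine (abs_sub _ _).trans ?_
        linarith) h hd hd1 hx
    refine this.trans ?_
    have e : 2 * (ε * d / 4) / d = ε / 2 := by field_simp; norm_num
    rw [e]; linarith

lemma continuousOn_time (hU : JetFlow n K T u U) (hu : IsPeriodicSolution T u) (hK : 0 ≤ K)
    {m : ℕ} (hm : m ≤ n) {x : ℝ} (hx : x ∈ Icc 0 (2 * Real.pi)) :
    ContinuousOn (fun t => U t m x) (Icc 0 T) := by
  intro t ht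
  rw [ContinuousWithinAt, Metric.tendsto_nhds]
  intro ε hε
  filter_upwards [hU.eventually_close hu hK ht m hm (ε / 2) (by positivity)] with s hs
  rw [Real.dist_eq]
  linarith [hs x hx]

lemma evo_continuousOn_time (hU : JetFlow n K T u U) (hu : IsPeriodicSolution T u) (hK : 0 ≤ K)
    {m : ℕ} (hm : m + 2 ≤ n) {x : ℝ} (hx : x ∈ Icc 0 (2 * Real.pi)) :
    ContinuousOn (fun t => evo (U t) m x) (Icc 0 T) :=
  (hU.continuousOn_time hu hK hm hx).sub (hU.continuousOn_time hu hK (by omega) hx)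

lemma evo_intervalIntegrable (hU : JetFlow n K T u U) (hu : IsPeriodicSolution T u) (hK : 0 ≤ K)
    {m : ℕ} (hm : m + 2 ≤ n) {x : ℝ} (hx : x ∈ Icc 0 (2 * Real.pi)) {s t : ℝ}
    (hs : s ∈ Icc 0 T) (ht : t ∈ Icc 0 T) :
    IntervalIntegrable (fun τ => evo (U τ) m x) volume s t :=
  ((hU.evo_continuousOn_time hu hK hm hx).mono (uIcc_subset_Icc hs ht)).intervalIntegrable

/-- The evolution equation for all derivatives, in integrated form. -/
lemma sub_eq_integral (hU : JetFlow n K T u U) (hu : IsPeriodicSolution T u) (hK : 0 ≤ K) :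
    ∀ m, m + 2 ≤ n → ∀ s ∈ Icc 0 T, ∀ t ∈ Icc 0 T, ∀ x ∈ Icc 0 (2 * Real.pi),
      U t m x - U s m x = ∫ τ in s..t, evo (U τ) m x := by
  intro m
  induction m with
  | zero =>
    intro hm s hs t ht x hx
    wlog hst : s ≤ t generalizing s t
    · rw [intervalIntegral.integral_symm, ← this t ht s hs (le_of_not_ge hst)]; ring
    rw [hU.eq t ht x hx, hU.eq s hs x hx]
    symm
    have hcx : ContinuousOn (fun τ => u τ x) (Icc 0 T) :=
      (hU.continuousOn_time hu hK (Nat.zero_le _) hx).congr fun τ hτ => (hU.eq τ hτ x hx).symm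
    -- Continuity up to the end points suffices, so the differential equation is used only at
    -- interior times.
    refine intervalIntegral.integral_eq_sub_of_hasDerivAt_of_le hst
      (hcx.mono (Icc_subset_Icc hs.1 ht.2)) (fun τ hτ => ?_)
      (hU.evo_intervalIntegrable hu hK hm hx hs ht)
    have hτ0 : τ ∈ Ioo 0 T := ⟨hs.1.trans_lt hτ.1, hτ.2.trans_le ht.2⟩
    have hp := (hu.pde τ (Ioo_subset_Ioc_self hτ0) x).hasDerivAt (Icc_mem_nhds hτ0.1 hτ0.2)
    have he := hU.eq_deriv hu hm (Ioo_subset_Icc_self hτ0) hx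
    simp only [evo]
    rw [zero_add, zero_add, he.1, he.2]
    exact hp
  | succ m ih =>
    intro hm s hs t ht x hx
    have hpi : (0 : ℝ) < 2 * Real.pi := by positivity
    have h1 : HasDerivWithinAt (fun x => U t m x - U s m x) (U t (m + 1) x - U s (m + 1) x)
        (Icc 0 (2 * Real.pi)) x :=
      ((hU.reg t ht).hasDeriv m (by omega) x hx).sub ((hU.reg s hs).hasDeriv m (by omega) x hx)
    -- Differentiation in `x` under the time integral: the Taylor remainder of the integrand is
    -- quadratic with a constant independent of `τ`. Uniqueness of the derivative then yields the
    -- identity of the next order.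
    have h2 : HasDerivWithinAt (fun x => U t m x - U s m x) (∫ τ in s..t, evo (U τ) (m + 1) x)
        (Icc 0 (2 * Real.pi)) x := by
      refine hasDerivWithinAt_of_sq_bound (L := 2 * K * |t - s|) fun y hy => ?_
      rw [ih (by omega) s hs t ht y hy, ih (by omega) s hs t ht x hx,
        ← intervalIntegral.integral_const_mul, ← intervalIntegral.integral_sub
          (hU.evo_intervalIntegrable hu hK (by omega) hy hs ht)
          (hU.evo_intervalIntegrable hu hK (by omega) hx hs ht),
        ← intervalIntegral.integral_sub
          ((hU.evo_intervalIntegrable hu hK (by omega) hy hs ht).sub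
            (hU.evo_intervalIntegrable hu hK (by omega) hx hs ht))
          ((hU.evo_intervalIntegrable hu hK (by omega) hx hs ht).const_mul _)]
      have := intervalIntegral.norm_integral_le_of_norm_le_const (a := s) (b := t)
        (f := fun τ => evo (U τ) m y - evo (U τ) m x - (y - x) * evo (U τ) (m + 1) x)
        (C := 2 * K * |y - x| ^ 2) (fun τ hτ => by
          have hτ' : τ ∈ Icc 0 T := uIcc_subset_Icc hs ht (uIoc_subset_uIcc hτ)
          have hr : JetReg (n - 2) (2 * K) (evo (U τ)) :=
            JetReg.evo (by rw [show n - 2 + 2 = n by omega]; exact hU.reg τ hτ')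
          exact taylor_bound (convex_Icc _ _) (by positivity)
            (fun z hz => hr.hasDeriv m (by omega) z hz)
            (fun z hz w hw => hr.lip (m + 1) (by omega) z hz w hw) hx hy)
      refine this.trans (le_of_eq (by ring))
    exact (uniqueDiffOn_Icc hpi x hx).eq_deriv _ h1 h2

/-- The integrated equation reduces this to continuity in time of the integrand. Uniformity in `x`
is essential, since the correction operators are bounded only with respect to maximum norms. -/
lemma eventually_diff (hU : JetFlow n K T u U) (hu : IsPeriodicSolution T u) (hK : 0 ≤ K)
    {t : ℝ} (ht : t ∈ Icc 0 T) {m : ℕ} (hm : m + 2 ≤ n) {ε : ℝ} (hε : 0 < ε) :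
    ∀ᶠ s in 𝓝[Icc 0 T] t, ∀ x ∈ Icc 0 (2 * Real.pi),
      |U s m x - U t m x - (s - t) * evo (U t) m x| ≤ ε * |s - t| := by
  have h1 := hU.eventually_close hu hK ht (m + 1) (by omega) (ε / 2) (by positivity)
  have h2 := hU.eventually_close hu hK ht (m + 2) hm (ε / 2) (by positivity)
  have h3 := h1.and h2
  rw [eventually_nhdsWithin_iff, Metric.eventually_nhds_iff] at h3
  obtain ⟨δ, hδ, h3⟩ := h3
  filter_upwards [self_mem_nhdsWithin, nhdsWithin_le_nhds (Metric.ball_mem_nhds t hδ)]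
    with s hs hst x hx
  rw [hU.sub_eq_integral hu hK m hm t ht s hs x hx]
  have e : (s - t) * evo (U t) m x = ∫ τ in t..s, evo (U t) m x := by
    rw [intervalIntegral.integral_const, smul_eq_mul]
  rw [e, ← intervalIntegral.integral_sub (hU.evo_intervalIntegrable hu hK hm hx ht hs)
    intervalIntegrable_const]
  refine intervalIntegral.norm_integral_le_of_norm_le_const
    (f := fun τ => evo (U τ) m x - evo (U t) m x) fun τ hτ => ?_
  rw [Real.norm_eq_abs]
  have hτ' : τ ∈ uIcc t s := uIoc_subset_uIcc hτ
  have hd : dist τ t < δ := by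
    refine lt_of_le_of_lt ?_ hst
    exact abs_sub_left_of_mem_uIcc hτ'
  have h4 := h3 hd (uIcc_subset_Icc ht hs hτ')
  have e2 : evo (U τ) m x - evo (U t) m x
      = (U τ (m + 2) x - U t (m + 2) x) - (U τ (m + 1) x - U t (m + 1) x) := by
    simp only [evo]; ring
  rw [e2]
  refine (abs_sub _ _).trans ?_
  linarith [h4.1 x hx, h4.2 x hx]

end JetFlow

open Filter Topology

namespace JetFlow

variable {n : ℕ} {K T : ℝ} {u : ℝ → ℝ → ℝ} {U : ℝ → ℕ → ℝ → ℝ}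
variable {N : ℕ} (Th : Mesh N) {k : ℕ} {lam θ : ℝ}

/-! ### Time derivatives of the corrections -/

/-- By linearity the remainder of the corrections is the correction operator applied to the
remainder of the derivatives, and that operator is bounded. -/
lemma corrOp_eventually_diff (hU : JetFlow n K T u U) (hu : IsPeriodicSolution T u) (hK : 0 ≤ K)
    (hθ : θ ≠ 1 / 2) {i : ℕ} (hi : i + 2 ≤ n) {t : ℝ} (ht : t ∈ Icc 0 T) {ε : ℝ} (hε : 0 < ε) :
    ∀ᶠ s in 𝓝[Icc 0 T] t, Th.Bdd (fun j x => (Th.corrOp k lam θ i (U s)).1 j x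
      - (Th.corrOp k lam θ i (U t)).1 j x
      - (s - t) * (Th.corrOp k lam θ i (evo (U t))).1 j x) (ε * |s - t|) := by
  obtain ⟨C, hC0, hC⟩ := Mesh.exists_corrOp_bound k lam hθ i
  have h : ∀ᶠ s in 𝓝[Icc 0 T] t, ∀ m ∈ Finset.range (i + 1), ∀ x ∈ Icc 0 (2 * Real.pi),
      |U s m x - U t m x - (s - t) * evo (U t) m x| ≤ ε / (C + 1) * |s - t| := by
    rw [eventually_all_finset]
    intro m hm
    have := Finset.mem_range.mp hm
    exact hU.eventually_diff hu hK ht (by omega) (by positivity)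
  filter_upwards [self_mem_nhdsWithin, h] with s hs hb
  have c1 := (hU.cont s hs).combo (hU.cont t ht) 1 (-1)
  have c2 := c1.combo (hU.cont t ht).evo 1 (-(s - t))
  have l1 := (Th.corrOp_combo (k := k) (lam := lam) hθ i (hU.cont s hs) (hU.cont t ht) c1
    fun _ _ _ => rfl).1
  have l2 := (Th.corrOp_combo (k := k) (lam := lam) hθ i c1 (hU.cont t ht).evo c2
    fun _ _ _ => rfl).1
  have hbd := (hC N Th _ c2 (ε / (C + 1) * |s - t|) (by positivity)).1 fun m hm x hx => by
    have := hb m (Finset.mem_range.mpr (by omega)) x hx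
    have e : 1 * (1 * U s m x + -1 * U t m x) + -(s - t) * evo (U t) m x
        = U s m x - U t m x - (s - t) * evo (U t) m x := by ring
    rw [e]; exact this
  intro j x hx
  have h1 := hbd j x hx
  rw [l2 j x hx, l1 j x hx] at h1
  have e : (Th.corrOp k lam θ i (U s)).1 j x - (Th.corrOp k lam θ i (U t)).1 j x
      - (s - t) * (Th.corrOp k lam θ i (evo (U t))).1 j x
      = 1 * (1 * (Th.corrOp k lam θ i (U s)).1 j x + -1 * (Th.corrOp k lam θ i (U t)).1 j x)
        + -(s - t) * (Th.corrOp k lam θ i (evo (U t))).1 j x := by ring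
  rw [← e] at h1
  refine h1.trans ?_
  have : C * (ε / (C + 1) * |s - t|) = C / (C + 1) * (ε * |s - t|) := by ring
  rw [this]
  have h2 : C / (C + 1) ≤ 1 := by rw [div_le_one (by positivity)]; linarith
  exact mul_le_of_le_one_left (by positivity) h2

lemma corrOp_hasDerivWithinAt (hU : JetFlow n K T u U) (hu : IsPeriodicSolution T u) (hK : 0 ≤ K)
    (hθ : θ ≠ 1 / 2) {i : ℕ} (hi : i + 2 ≤ n) {t : ℝ} (ht : t ∈ Icc 0 T) (j : Fin N) {x : ℝ}
    (hx : x ∈ Icc (Th.left j) (Th.right j)) :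
    HasDerivWithinAt (fun s => (Th.corrOp k lam θ i (U s)).1 j x)
      ((Th.corrOp k lam θ i (evo (U t))).1 j x) (Icc 0 T) t := by
  rw [hasDerivWithinAt_iff_isLittleO, Asymptotics.isLittleO_iff]
  intro c hc
  filter_upwards [hU.corrOp_eventually_diff Th (k := k) (lam := lam) hu hK hθ hi ht hc] with s hs
  exact hs j x hx

lemma corrOp_snd_continuousOn (hU : JetFlow n K T u U) (hu : IsPeriodicSolution T u) (hK : 0 ≤ K)
    (hθ : θ ≠ 1 / 2) {i : ℕ} (hi : i + 1 ≤ n) (j : Fin N) {x : ℝ}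
    (hx : x ∈ Icc (Th.left j) (Th.right j)) :
    ContinuousOn (fun s => (Th.corrOp k lam θ i (U s)).2 j x) (Icc 0 T) := by
  obtain ⟨C, hC0, hC⟩ := Mesh.exists_corrOp_bound k lam hθ i
  intro t ht
  rw [ContinuousWithinAt, Metric.tendsto_nhds]
  intro ε hε
  have h : ∀ᶠ s in 𝓝[Icc 0 T] t, ∀ m ∈ Finset.range (i + 2), ∀ x ∈ Icc 0 (2 * Real.pi),
      |U s m x - U t m x| ≤ ε / (C + 1) := by
    rw [eventually_all_finset]
    intro m hm
    have := Finset.mem_range.mp hm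
    exact hU.eventually_close hu hK ht m (by omega) _ (by positivity)
  filter_upwards [self_mem_nhdsWithin, h] with s hs hb
  have c1 := (hU.cont s hs).combo (hU.cont t ht) 1 (-1)
  have l1 := (Th.corrOp_combo (k := k) (lam := lam) hθ i (hU.cont s hs) (hU.cont t ht) c1
    fun _ _ _ => rfl).2
  have hbd := (hC N Th _ c1 (ε / (C + 1)) (by positivity)).2 fun m hm x hx => by
    have := hb m (Finset.mem_range.mpr (by omega)) x hx
    have e : 1 * U s m x + -1 * U t m x = U s m x - U t m x := by ring
    rw [e]; exact this
  have h1 := hbd j x hx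
  rw [l1 j x hx] at h1
  rw [Real.dist_eq]
  have e : (Th.corrOp k lam θ i (U s)).2 j x - (Th.corrOp k lam θ i (U t)).2 j x
      = 1 * (Th.corrOp k lam θ i (U s)).2 j x + -1 * (Th.corrOp k lam θ i (U t)).2 j x := by ring
  rw [e]
  refine h1.trans_lt ?_
  rw [mul_div_assoc', div_lt_iff₀ (by positivity)]
  nlinarith

/-- The corrections of the scheme are the correction operators applied to the solution. -/
lemma corr_eq (hU : JetFlow n K T u U) (hu : IsPeriodicSolution T u) (hK : 0 ≤ K) (hT : 0 < T)
    (hθ : θ ≠ 1 / 2) {i : ℕ} (hi : i + 1 ≤ n) (hn : 2 ≤ n) : ∀ t ∈ Icc 0 T, ∀ j : Fin N,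
      ∀ x ∈ Icc (Th.left j) (Th.right j),
      (Th.corr k lam θ T u i).1 t j x = (Th.corrOp k lam θ i (U t)).1 j x ∧
      (Th.corr k lam θ T u i).2 t j x = (Th.corrOp k lam θ i (U t)).2 j x := by
  induction i with
  | zero =>
    intro t ht j x hx
    have hc := hu.contDiff t ht
    have hcu : Th.CellCont (fun _ => u t) := fun j => hc.continuous.continuousOn
    have hcq : Th.CellCont (fun _ => deriv (u t)) := fun j =>
      (hc.continuous_deriv (by norm_num)).continuousOn
    have h0 : ∀ j : Fin N, ∀ x ∈ Icc (Th.left j) (Th.right j), u t x = U t 0 x :=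
      fun j x hx => (hU.eq t ht x (Th.cell_subset j hx)).symm
    have h1 : ∀ j : Fin N, ∀ x ∈ Icc (Th.left j) (Th.right j), deriv (u t) x = U t 1 x :=
      fun j x hx => (hU.eq_deriv hu hn ht (Th.cell_subset j hx)).1.symm
    have cU0 : Th.CellCont (fun _ => U t 0) := Mesh.CellCont.of_continuousOn (hU.cont t ht 0)
    have cU1 : Th.CellCont (fun _ => U t 1) := Mesh.CellCont.of_continuousOn (hU.cont t ht 1)
    have e1 : Th.projU k θ (fun _ => u t) = Th.projU k θ (fun _ => U t 0) :=
      Th.radau_congr hθ hcu cU0 h0 (Th.wavg_congr θ h0)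
    have e2 : Th.projQ k lam θ (fun _ => u t) (fun _ => deriv (u t))
        = Th.projQ k lam θ (fun _ => U t 0) (fun _ => U t 1) := by
      refine Th.radau_congr (one_sub_ne_half hθ) hcq cU1 h1 fun j => ?_
      have e3 : ∀ j : Fin N, ∀ x ∈ Icc (Th.left j) (Th.right j),
          u t x - (Th.projU k θ (fun _ => u t)).toBroken j x
          = U t 0 x - (Th.projU k θ (fun _ => U t 0)).toBroken j x := by
        intro j x hx
        rw [e1, h0 j x hx]
      rw [Th.wavg_congr _ h1, Th.jump_eq, Th.jump_eq, Th.wavg_congr 0 e3, Th.wavg_congr 1 e3]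
    simp only [Mesh.corr, Mesh.corrOp]
    rw [e1, e2, h0 j x hx, h1 j x hx]
    exact ⟨rfl, rfl⟩
  | succ i ih =>
    have ih := ih (by omega)
    intro t ht
    have oc := Th.corrOp_cellCont (k := k) (lam := lam) (θ := θ) i (hU.cont t ht)
    have oc' := Th.corrOp_cellCont (k := k) (lam := lam) (θ := θ) i (hU.cont t ht).evo
    have oc1 := Th.corrOp_cellCont (k := k) (lam := lam) (θ := θ) (i + 1) (hU.cont t ht)
    have cc : Th.CellCont ((Th.corr k lam θ T u i).2 t) :=
      fun j => (oc.2 j).congr fun x hx => (ih t ht j x hx).2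
    have e1 : Th.stepU k θ ((Th.corr k lam θ T u i).2 t)
        = Th.stepU k θ (Th.corrOp k lam θ i (U t)).2 := by
      refine Mesh.IsRadau.unique Th hθ cc.prim (Th.stepU_spec hθ cc)
        (Mesh.IsRadau.congr Th (Th.stepU_spec hθ oc.2)
          (Th.prim_congr fun j x hx => (ih t ht j x hx).2.symm) fun j => rfl)
    -- The induction hypothesis holds at all times of `[0, T]` and may therefore be differentiated
    -- in time; here `∂_t` becomes `evo`.
    have hd : ∀ j : Fin N, ∀ x ∈ Icc (Th.left j) (Th.right j),
        timeDeriv T (Th.corr k lam θ T u i).1 t j x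
          = (Th.corrOp k lam θ i (evo (U t))).1 j x := by
      intro j x hx
      have h1 := hU.corrOp_hasDerivWithinAt Th (k := k) (lam := lam) hu hK hθ
        (i := i) (by omega) ht j hx
      have h2 : HasDerivWithinAt (fun s => (Th.corr k lam θ T u i).1 s j x)
          ((Th.corrOp k lam θ i (evo (U t))).1 j x) (Icc 0 T) t :=
        h1.congr_of_mem (fun s hs => (ih s hs j x hx).1) ht
      exact h2.derivWithin (uniqueDiffOn_Icc hT t ht)
    have cd : Th.CellCont (timeDeriv T (Th.corr k lam θ T u i).1 t) :=
      fun j => (oc'.1 j).congr fun x hx => hd j x hx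
    have e2 : Th.stepQ k lam θ (Th.corrOp k lam θ (i + 1) (U t)).1
          (timeDeriv T (Th.corr k lam θ T u i).1 t)
        = Th.stepQ k lam θ (Th.corrOp k lam θ (i + 1) (U t)).1
          (Th.corrOp k lam θ i (evo (U t))).1 := by
      refine Mesh.IsRadau.unique Th (one_sub_ne_half hθ) (fun j => (oc1.1 j).add (cd.prim j))
        (Th.stepQ_spec hθ oc1.1 cd)
        (Mesh.IsRadau.congr Th (Th.stepQ_spec hθ oc1.1 oc'.1) (fun j x hx => ?_) fun j => rfl)
      change (Th.corrOp k lam θ (i + 1) (U t)).1 j x + Th.prim _ j x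
        = (Th.corrOp k lam θ (i + 1) (U t)).1 j x + Th.prim _ j x
      rw [Th.prim_congr hd j x hx]
    have e3 : (Th.corr k lam θ T u (i + 1)).1 t = (Th.corrOp k lam θ (i + 1) (U t)).1 := by
      simp only [Mesh.corr, Mesh.corrOp, e1]
    have e4 : (Th.corr k lam θ T u (i + 1)).2 t = (Th.corrOp k lam θ (i + 1) (U t)).2 := by
      change (Th.stepQ k lam θ ((Th.corr k lam θ T u (i + 1)).1 t) _).toBroken = _
      rw [e3, e2]
      rfl
    intro j x _
    rw [e3, e4]
    exact ⟨rfl, rfl⟩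

lemma uI_eq (hU : JetFlow n K T u U) (hu : IsPeriodicSolution T u) (hK : 0 ≤ K) (hT : 0 < T)
    (hθ : θ ≠ 1 / 2) {ℓ : ℕ} (hℓ : ℓ + 1 ≤ n) (hn : 2 ≤ n) : ∀ t ∈ Icc 0 T, ∀ j : Fin N,
      ∀ x ∈ Icc (Th.left j) (Th.right j),
      Th.uI k ℓ lam θ T u t j x
        = U t 0 x - ∑ i ∈ Finset.range (ℓ + 1), (Th.corrOp k lam θ i (U t)).1 j x ∧
      Th.qI k ℓ lam θ T u t j x
        = U t 1 x - ∑ i ∈ Finset.range (ℓ + 1), (Th.corrOp k lam θ i (U t)).2 j x := by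
  intro t ht j x hx
  have h := fun i (hi : i + 1 ≤ n) =>
    hU.corr_eq Th (k := k) (lam := lam) hu hK hT hθ hi hn t ht j x hx
  have h0 := h 0 (by omega)
  -- Index `0` is the interpolation error itself, so including it in the sum replaces the projection
  -- by the exact function.
  have hr : Finset.range (ℓ + 1) = insert 0 (Finset.Icc 1 ℓ) := by
    ext i; simp only [Finset.mem_range, Finset.mem_insert, Finset.mem_Icc]; omega
  have hx2 := Th.cell_subset j hx
  rw [hr, Finset.sum_insert (by simp), Finset.sum_insert (by simp), ← h0.1, ← h0.2]
  have s1 : ∑ i ∈ Finset.Icc 1 ℓ, (Th.corrOp k lam θ i (U t)).1 j x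
      = ∑ i ∈ Finset.Icc 1 ℓ, (Th.corr k lam θ T u i).1 t j x :=
    Finset.sum_congr rfl fun i hi => (h i (by have := Finset.mem_Icc.mp hi; omega)).1.symm
  have s2 : ∑ i ∈ Finset.Icc 1 ℓ, (Th.corrOp k lam θ i (U t)).2 j x
      = ∑ i ∈ Finset.Icc 1 ℓ, (Th.corr k lam θ T u i).2 t j x :=
    Finset.sum_congr rfl fun i hi => (h i (by have := Finset.mem_Icc.mp hi; omega)).2.symm
  rw [s1, s2, hU.eq t ht x hx2, (hU.eq_deriv hu hn ht hx2).1]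
  simp only [Mesh.uI, Mesh.qI, Mesh.corr]
  constructor <;> ring

end JetFlow

open Filter Topology

/-! ### Polynomials depending on time -/

/-- Finitely many fixed points determine the polynomial, so regularity in time known pointwise in
`x` passes to moments and norms. -/
lemma exists_lagrange {k : ℕ} {a b : ℝ} (hab : a < b) :
    ∃ (y : Fin (k + 1) → ℝ) (l : Fin (k + 1) → ℝ[X]), (∀ i, y i ∈ Icc a b) ∧
      ∀ p ∈ degreeLT ℝ (k + 1), ∀ x, p.eval x = ∑ i, p.eval (y i) * (l i).eval x := by
  set y : Fin (k + 1) → ℝ := fun i => (b - a) * ((i : ℝ) / (k + 1)) + a with hy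
  have hba : b - a ≠ 0 := by linarith
  have hk : (k : ℝ) + 1 ≠ 0 := by positivity
  have hinj : Function.Injective y := by
    intro i i' h
    simp only [hy] at h
    have h1 := mul_left_cancel₀ hba (add_right_cancel h)
    rw [div_left_inj' hk] at h1
    exact Fin.ext (by exact_mod_cast h1)
  refine ⟨y, fun i => Lagrange.basis Finset.univ y i, fun i => affine_mem hab.le ⟨by positivity, ?_⟩,
    fun p hp x => ?_⟩
  · rw [div_le_one (by positivity)]
    have := i.2
    exact_mod_cast this.le
  · rw [mem_degreeLT] at hp
    have h := Lagrange.eq_interpolate (s := Finset.univ) (v := y) (f := p) hinj.injOn (by simpa using hp)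
    conv_lhs => rw [h]
    rw [Lagrange.interpolate_apply, eval_finsetSum]
    simp

namespace Mesh

variable {N k : ℕ} (Th : Mesh N)

lemma cellInner_sum_left {ι : Type*} (s : Finset ι) (j : Fin N) (c : ι → ℝ) (f : ι → ℝ → ℝ)
    {g : ℝ → ℝ} (hf : ∀ i, ContinuousOn (f i) (Icc (Th.left j) (Th.right j)))
    (hg : ContinuousOn g (Icc (Th.left j) (Th.right j))) :
    Th.cellInner j (fun x => ∑ i ∈ s, c i * f i x) g = ∑ i ∈ s, c i * Th.cellInner j (f i) g := by
  classical
  induction s using Finset.induction_on with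
  | empty => simp [cellInner]
  | insert i s hi ih =>
    simp only [Finset.sum_insert hi]
    have := Th.cellInner_combo j (c i) 1 (hf i)
      (f₂ := fun x => ∑ i ∈ s, c i * f i x)
      (continuousOn_finsetSum s fun i _ => continuousOn_const.mul (hf i)) hg
    simp only [one_mul] at this
    rw [this, ih]

lemma exists_cellInner_eq (k : ℕ) (j : Fin N) :
    ∃ (y : Fin (k + 1) → ℝ), (∀ i, y i ∈ Icc (Th.left j) (Th.right j)) ∧
      ∀ g : ℝ → ℝ, ContinuousOn g (Icc (Th.left j) (Th.right j)) → ∃ c : Fin (k + 1) → ℝ,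
        ∀ p : Vh N k, Th.cellInner j (p.toBroken j) g = ∑ i, p.toBroken j (y i) * c i := by
  obtain ⟨y, l, hy, hl⟩ := exists_lagrange (k := k) (Th.left_lt_right j)
  refine ⟨y, hy, fun g hg => ⟨fun i => Th.cellInner j (fun x => (l i).eval x) g, fun p => ?_⟩⟩
  rw [← Th.cellInner_sum_left Finset.univ j _ _ (fun i => (l i).continuous.continuousOn) hg]
  exact Th.cellInner_congr j (fun x _ => hl _ (p j).2 x) fun _ _ => rfl

lemma continuousOn_cellInner {S : Set ℝ} {p : ℝ → Vh N k} {j : Fin N}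
    (hp : ∀ x ∈ Icc (Th.left j) (Th.right j), ContinuousOn (fun s => (p s).toBroken j x) S)
    {g : ℝ → ℝ} (hg : ContinuousOn g (Icc (Th.left j) (Th.right j))) :
    ContinuousOn (fun s => Th.cellInner j ((p s).toBroken j) g) S := by
  obtain ⟨y, hy, h⟩ := Th.exists_cellInner_eq k j
  obtain ⟨c, hc⟩ := h g hg
  simp only [hc]
  exact continuousOn_finsetSum _ fun i _ => (hp _ (hy i)).mul continuousOn_const

lemma exists_cellInner_self_eq (k : ℕ) (j : Fin N) :
    ∃ (y : Fin (k + 1) → ℝ) (l : Fin (k + 1) → ℝ[X]),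
      (∀ i, y i ∈ Icc (Th.left j) (Th.right j)) ∧
      (∀ p : Vh N k, ∀ x, p.toBroken j x = ∑ i, p.toBroken j (y i) * (l i).eval x) ∧
      ∀ f g : Fin (k + 1) → ℝ,
        Th.cellInner j (fun x => ∑ i, f i * (l i).eval x) (fun x => ∑ i, g i * (l i).eval x)
          = ∑ i, f i * ∑ i', g i' *
            Th.cellInner j (fun x => (l i).eval x) (fun x => (l i').eval x) := by
  obtain ⟨y, l, hy, hl⟩ := exists_lagrange (k := k) (Th.left_lt_right j)
  refine ⟨y, l, hy, fun p x => hl _ (p j).2 x, fun f g => ?_⟩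
  have hlc : ∀ i, ContinuousOn (fun x => (l i).eval x) (Icc (Th.left j) (Th.right j)) :=
    fun i => (l i).continuous.continuousOn
  rw [Th.cellInner_sum_left Finset.univ j f (fun i x => (l i).eval x) hlc
    (g := fun x => ∑ i, g i * (l i).eval x)
    (continuousOn_finsetSum _ fun i _ => continuousOn_const.mul (hlc i))]
  refine Finset.sum_congr rfl fun i _ => ?_
  rw [Th.cellInner_comm, Th.cellInner_sum_left Finset.univ j g (fun i x => (l i).eval x) hlc (hlc i)]
  congr 1
  exact Finset.sum_congr rfl fun i' _ => by rw [Th.cellInner_comm]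

lemma continuousOn_cellInner_self {S : Set ℝ} {p : ℝ → Vh N k} {j : Fin N}
    (hp : ∀ x ∈ Icc (Th.left j) (Th.right j), ContinuousOn (fun s => (p s).toBroken j x) S) :
    ContinuousOn (fun s => Th.cellInner j ((p s).toBroken j) ((p s).toBroken j)) S := by
  obtain ⟨y, l, hy, hl, hi⟩ := Th.exists_cellInner_self_eq k j
  have e : (fun s => Th.cellInner j ((p s).toBroken j) ((p s).toBroken j))
      = fun s => ∑ i, (p s).toBroken j (y i) * ∑ i', (p s).toBroken j (y i') *
            Th.cellInner j (fun x => (l i).eval x) (fun x => (l i').eval x) := by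
    ext s
    rw [← hi]
    exact Th.cellInner_congr j (fun x _ => hl _ x) fun x _ => hl _ x
  rw [e]
  exact continuousOn_finsetSum _ fun i _ => (hp _ (hy i)).mul
    (continuousOn_finsetSum _ fun i' _ => (hp _ (hy i')).mul continuousOn_const)

lemma hasDerivWithinAt_cellInner_self {S : Set ℝ} {t : ℝ} (hS : UniqueDiffWithinAt ℝ S t)
    {p : ℝ → Vh N k} {j : Fin N} {d : ℝ → ℝ}
    (hp : ∀ x ∈ Icc (Th.left j) (Th.right j),
      HasDerivWithinAt (fun s => (p s).toBroken j x) (d x) S t) :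
    HasDerivWithinAt (fun s => Th.cellInner j ((p s).toBroken j) ((p s).toBroken j))
      (2 * Th.cellInner j d ((p t).toBroken j)) S t := by
  obtain ⟨y, l, hy, hl, hi⟩ := Th.exists_cellInner_self_eq k j
  have e : (fun s => Th.cellInner j ((p s).toBroken j) ((p s).toBroken j))
      = fun s => ∑ i, (p s).toBroken j (y i) * ∑ i', (p s).toBroken j (y i') *
            Th.cellInner j (fun x => (l i).eval x) (fun x => (l i').eval x) := by
    ext s
    rw [← hi]
    exact Th.cellInner_congr j (fun x _ => hl _ x) fun x _ => hl _ x
  -- Nothing is assumed about `d` as a function of `x`; uniqueness of the time derivative makes it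
  -- the interpolating polynomial on the cell.
  have hd : ∀ x ∈ Icc (Th.left j) (Th.right j), d x = ∑ i, d (y i) * (l i).eval x := by
    intro x hx
    have h1 : HasDerivWithinAt (fun s => (p s).toBroken j x) (∑ i, d (y i) * (l i).eval x) S t := by
      have h2 : (fun s => (p s).toBroken j x)
          = fun s => ∑ i, (p s).toBroken j (y i) * (l i).eval x := by
        ext s; exact hl _ x
      rw [h2]
      exact HasDerivWithinAt.fun_sum fun i _ => (hp _ (hy i)).mul_const _
    exact hS.eq_deriv _ (hp x hx) h1
  have e2 : 2 * Th.cellInner j d ((p t).toBroken j)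
      = ∑ i, (d (y i) * (∑ i', (p t).toBroken j (y i') *
            Th.cellInner j (fun x => (l i).eval x) (fun x => (l i').eval x))
          + (p t).toBroken j (y i) * ∑ i', d (y i') *
            Th.cellInner j (fun x => (l i).eval x) (fun x => (l i').eval x)) := by
    have h1 : Th.cellInner j d ((p t).toBroken j) = Th.cellInner j
        (fun x => ∑ i, d (y i) * (l i).eval x)
        (fun x => ∑ i, (p t).toBroken j (y i) * (l i).eval x) :=
      Th.cellInner_congr j hd fun x _ => hl _ x
    rw [Finset.sum_add_distrib, ← hi (fun i => d (y i)) (fun i => (p t).toBroken j (y i)),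
      ← hi (fun i => (p t).toBroken j (y i)) (fun i => d (y i)), h1,
      Th.cellInner_comm j (fun x => ∑ i, (p t).toBroken j (y i) * (l i).eval x)]
    ring
  rw [e, e2]
  exact HasDerivWithinAt.fun_sum fun i _ => (hp _ (hy i)).mul
    (HasDerivWithinAt.fun_sum fun i' _ => (hp _ (hy i')).mul_const _)

/-- Parseval's identity for the Legendre polynomials of a cell. -/
lemma parseval (j : Fin N) {n : ℕ} : ∀ {p : ℝ[X]}, p ∈ degreeLT ℝ n →
    Th.cellInner j (fun x => p.eval x) (fun x => p.eval x)
      = ∑ i ∈ Finset.range n,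
        Th.cellInner j (fun x => p.eval x) (fun x => (legOn (Th.left j) (Th.right j) i).eval x) ^ 2
        / Th.cellInner j (fun x => (legOn (Th.left j) (Th.right j) i).eval x)
            (fun x => (legOn (Th.left j) (Th.right j) i).eval x) := by
  induction n with
  | zero =>
    intro p hp
    have : p = 0 := by
      rw [mem_degreeLT] at hp
      simpa using hp
    simp [this, cellInner]
  | succ n ih =>
    intro p hp
    have hlr := Th.left_lt_right j
    obtain ⟨c, hc⟩ := exists_sub_legOn_mem hlr hp
    set L := legOn (Th.left j) (Th.right j) n with hL
    set r := p - c • L with hr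
    have hpc : ∀ q : ℝ[X], ContinuousOn (fun x => q.eval x) (Icc (Th.left j) (Th.right j)) :=
      fun q => q.continuous.continuousOn
    have hpr : ∀ g : ℝ[X], Th.cellInner j (fun x => p.eval x) (fun x => g.eval x)
        = Th.cellInner j (fun x => r.eval x) (fun x => g.eval x)
          + c * Th.cellInner j (fun x => L.eval x) (fun x => g.eval x) := by
      intro g
      have h1 := Th.cellInner_combo j 1 c (hpc r) (hpc L) (hpc g)
      rw [one_mul] at h1
      rw [← h1]
      refine Th.cellInner_congr j (fun x _ => ?_) fun _ _ => rfl
      simp [hr]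
    have hrL : Th.cellInner j (fun x => L.eval x) (fun x => r.eval x) = 0 :=
      legOn_orthogonal hlr n hc
    have hLi : ∀ i ∈ Finset.range n, Th.cellInner j (fun x => L.eval x)
        (fun x => (legOn (Th.left j) (Th.right j) i).eval x) = 0 := fun i hi =>
      legOn_orthogonal hlr n (degreeLT_mono (Finset.mem_range.mp hi) (legOn_mem _ _ i))
    have hLpos : Th.cellInner j (fun x => L.eval x) (fun x => L.eval x) ≠ 0 := by
      intro h0
      have h1 := poly_eq_zero_of_integral_sq hlr h0
      have h2 := legOn_left (Th.left j) (Th.right j) n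
      rw [← hL, h1] at h2
      simp at h2
    rw [Finset.sum_range_succ]
    have hs : ∀ i ∈ Finset.range n, Th.cellInner j (fun x => p.eval x)
          (fun x => (legOn (Th.left j) (Th.right j) i).eval x) ^ 2
        / Th.cellInner j (fun x => (legOn (Th.left j) (Th.right j) i).eval x)
            (fun x => (legOn (Th.left j) (Th.right j) i).eval x)
        = Th.cellInner j (fun x => r.eval x)
          (fun x => (legOn (Th.left j) (Th.right j) i).eval x) ^ 2
        / Th.cellInner j (fun x => (legOn (Th.left j) (Th.right j) i).eval x)
            (fun x => (legOn (Th.left j) (Th.right j) i).eval x) := by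
      intro i hi
      rw [hpr, hLi i hi, mul_zero, add_zero]
    rw [Finset.sum_congr rfl hs, ← ih hc, ← hL, hpr L, hpr p,
      Th.cellInner_comm j (fun x => r.eval x) (fun x => p.eval x),
      Th.cellInner_comm j (fun x => L.eval x) (fun x => p.eval x), hpr r, hpr L, hrL,
      Th.cellInner_comm j (fun x => r.eval x) (fun x => L.eval x), hrL]
    field_simp
    ring

/-! ### The energy identity -/

lemma sum_cellLength : ∑ j, Th.cellLength j = 2 * Real.pi := by
  have h : ∀ (n : ℕ) (f : Fin (n + 1) → ℝ),
      ∑ j : Fin n, (f j.succ - f j.castSucc) = f (Fin.last n) - f 0 := by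
    intro n
    induction n with
    | zero => intro f; simp
    | succ n ih =>
      intro f
      rw [Fin.sum_univ_castSucc]
      have := ih fun i => f i.castSucc
      simp only [Fin.succ_castSucc, Fin.castSucc_zero] at this ⊢
      rw [this, Fin.succ_last]
      ring
  have := h N Th.node
  rw [Th.node_zero, Th.node_last, sub_zero] at this
  exact this

lemma cellInner_derivative_add (j : Fin N) (p q : Vh N k) :
    Th.cellInner j (p.toBroken j) (q.dx j) + Th.cellInner j (q.toBroken j) (p.dx j)
      = p.toBroken j (Th.right j) * q.toBroken j (Th.right j)
        - p.toBroken j (Th.left j) * q.toBroken j (Th.left j) := by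
  have h := integral_mul_derivative (f := p.toBroken j) (f' := p.dx j) (Th.left_le_right j)
    (fun x _ => ((p j : ℝ[X]).hasDerivAt x).hasDerivWithinAt)
    (derivative (p j : ℝ[X])).continuous.continuousOn (q j : ℝ[X])
  have e : Th.cellInner j (p.toBroken j) (q.dx j) = _ := h
  rw [e, Th.cellInner_comm j (q.toBroken j)]
  unfold cellInner
  exact sub_add_cancel _ _

/-- Moves left-end contributions to the preceding cell, so that both traces at a node are collected
in one summand. -/
lemma sum_rotate (G : Fin N → Fin N → ℝ) :
    ∑ j, G ((finRotate N).symm j) j = ∑ j, G j (finRotate N j) := by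
  rw [← Equiv.sum_comp (finRotate N)]
  simp only [Equiv.symm_apply_apply]

/-- The volume terms are exact derivatives of `p ^ 2 / 2` and `p * q` and reduce to traces. Node by
node, the complementary weights `θ` and `1 - θ` cancel every term with `q`, leaving `lam - 1 / 2`
times the squared jump of `p`. -/
lemma energy_nonneg {lam θ : ℝ} (hlam : 1 / 2 ≤ lam) (p q : Vh N k) :
    0 ≤ ∑ j, (- Th.cellInner j (fun x => p.toBroken j x - q.toBroken j x) (p.dx j)
      + (Th.wavg lam p.toBroken j - Th.wavg (1 - θ) q.toBroken j) * p.toBroken j (Th.right j)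
      - (Th.wavg lam p.toBroken ((finRotate N).symm j)
          - Th.wavg (1 - θ) q.toBroken ((finRotate N).symm j)) * p.toBroken j (Th.left j)
      + Th.cellInner j (p.toBroken j) (q.dx j)
      - Th.wavg θ p.toBroken j * q.toBroken j (Th.right j)
      + Th.wavg θ p.toBroken ((finRotate N).symm j) * q.toBroken j (Th.left j)) := by
  have hpc : ∀ (v : Vh N k) j, ContinuousOn (v.toBroken j) (Icc (Th.left j) (Th.right j)) :=
    fun v j => (v.toBroken_continuous j).continuousOn
  have hdc : ∀ (v : Vh N k) j, ContinuousOn (v.dx j) (Icc (Th.left j) (Th.right j)) :=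
    fun v j => (derivative (v j : ℝ[X])).continuous.continuousOn
  set R : Fin N → ℝ := fun j => - (p.toBroken j (Th.right j)) ^ 2 / 2
      + p.toBroken j (Th.right j) * q.toBroken j (Th.right j)
      + (Th.wavg lam p.toBroken j - Th.wavg (1 - θ) q.toBroken j) * p.toBroken j (Th.right j)
      - Th.wavg θ p.toBroken j * q.toBroken j (Th.right j) with hR
  set G : Fin N → Fin N → ℝ := fun i j => (p.toBroken j (Th.left j)) ^ 2 / 2
      - p.toBroken j (Th.left j) * q.toBroken j (Th.left j)
      - (Th.wavg lam p.toBroken i - Th.wavg (1 - θ) q.toBroken i) * p.toBroken j (Th.left j)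
      + Th.wavg θ p.toBroken i * q.toBroken j (Th.left j) with hG
  have e : ∀ j, - Th.cellInner j (fun x => p.toBroken j x - q.toBroken j x) (p.dx j)
      + (Th.wavg lam p.toBroken j - Th.wavg (1 - θ) q.toBroken j) * p.toBroken j (Th.right j)
      - (Th.wavg lam p.toBroken ((finRotate N).symm j)
          - Th.wavg (1 - θ) q.toBroken ((finRotate N).symm j)) * p.toBroken j (Th.left j)
      + Th.cellInner j (p.toBroken j) (q.dx j)
      - Th.wavg θ p.toBroken j * q.toBroken j (Th.right j)
      + Th.wavg θ p.toBroken ((finRotate N).symm j) * q.toBroken j (Th.left j)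
      = R j + G ((finRotate N).symm j) j := by
    intro j
    have h1 := Th.cellInner_derivative_add j p p
    have h2 := Th.cellInner_derivative_add j p q
    rw [Th.cellInner_sub j (hpc p j) (hpc q j) (hdc p j)]
    simp only [hR, hG]
    linear_combination h2 - h1 / 2
  rw [Finset.sum_congr rfl fun j _ => e j, Finset.sum_add_distrib, sum_rotate,
    ← Finset.sum_add_distrib]
  refine Finset.sum_nonneg fun j _ => ?_
  have e2 : R j + G j (finRotate N j) = (lam - 1 / 2)
      * (p.toBroken j (Th.right j)
        - p.toBroken (finRotate N j) (Th.left (finRotate N j))) ^ 2 := by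
    simp only [hR, hG, wavg, minus, plus]
    ring
  rw [e2]
  exact mul_nonneg (by linarith) (sq_nonneg _)

/-- Weighted Young inequality, from `(μ * w + v) ^ 2 ≥ 0`. The factor `3` bounds the square root of
the length `2π`. -/
lemma neg_sum_cellInner_le {w v : Broken N} {A μ : ℝ} (hw : Th.Bdd w A) (hcw : Th.CellCont w)
    (hcv : Th.CellCont v) (hμ : 0 < μ) :
    -∑ j, Th.cellInner j (w j) (v j)
      ≤ (μ * (3 * A) ^ 2 + (∑ j, Th.cellInner j (v j) (v j)) / μ) / 2 := by
  have hj : ∀ j, - Th.cellInner j (w j) (v j)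
      ≤ (μ * A ^ 2 * Th.cellLength j + Th.cellInner j (v j) (v j) / μ) / 2 := by
    intro j
    have hlr := Th.left_le_right j
    have i1 : IntervalIntegrable (fun x => w j x * v j x) volume (Th.left j) (Th.right j) :=
      ((hcw j).mul (hcv j)).intervalIntegrable_of_Icc hlr
    have i2 : IntervalIntegrable (fun x => v j x * v j x) volume (Th.left j) (Th.right j) :=
      ((hcv j).mul (hcv j)).intervalIntegrable_of_Icc hlr
    have h : ∫ x in Th.left j..Th.right j, -(w j x * v j x)
        ≤ ∫ x in Th.left j..Th.right j, (μ * A ^ 2 / 2 + (2 * μ)⁻¹ * (v j x * v j x)) := by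
      refine intervalIntegral.integral_mono_on hlr i1.neg
        (intervalIntegrable_const.add (i2.const_mul _)) fun x hx => ?_
      have h1 := hw j x hx
      have h2 : w j x ^ 2 ≤ A ^ 2 := sq_le_sq' (by linarith [(abs_le.mp h1).1]) (abs_le.mp h1).2
      have h3 : 0 ≤ (2 * μ)⁻¹ * (μ * w j x + v j x) ^ 2 := by positivity
      have h4 : (2 * μ)⁻¹ * (μ * w j x + v j x) ^ 2
          = μ * w j x ^ 2 / 2 + w j x * v j x + (2 * μ)⁻¹ * (v j x * v j x) := by
        field_simp; ring
      have h5 : μ * w j x ^ 2 ≤ μ * A ^ 2 := by gcongr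
      linarith
    rw [intervalIntegral.integral_neg, intervalIntegral.integral_add intervalIntegrable_const
      (i2.const_mul _), intervalIntegral.integral_const_mul, intervalIntegral.integral_const,
      smul_eq_mul] at h
    unfold cellInner cellLength
    refine h.trans (le_of_eq ?_)
    field_simp
  rw [← Finset.sum_neg_distrib]
  refine (Finset.sum_le_sum fun j _ => hj j).trans ?_
  rw [← Finset.sum_div, Finset.sum_add_distrib, ← Finset.mul_sum, Th.sum_cellLength,
    ← Finset.sum_div]
  have hpi : 2 * Real.pi ≤ 9 := by have := Real.pi_lt_four; linarith
  have : μ * A ^ 2 * (2 * Real.pi) ≤ μ * A ^ 2 * 9 := by gcongr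
  have e : μ * (3 * A) ^ 2 = μ * A ^ 2 * 9 := by ring
  rw [e]
  linarith

lemma cellInner_self_nonneg (j : Fin N) (f : ℝ → ℝ) : 0 ≤ Th.cellInner j f f :=
  intervalIntegral.integral_nonneg (Th.left_le_right j) fun _ _ => mul_self_nonneg _

lemma l2norm_sq (v : Broken N) : Th.l2norm v ^ 2 = ∑ j, Th.cellInner j (v j) (v j) :=
  Real.sq_sqrt (Finset.sum_nonneg fun j _ => Th.cellInner_self_nonneg j _)

end Mesh

/-- A nonlinear Gronwall argument. -/
lemma sqrt_add_sqrt_integral_le {T A : ℝ} (hA : 0 < A) {E E' S : ℝ → ℝ}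
    (hE : ContinuousOn E (Icc 0 T)) (hE' : ∀ t ∈ Ioo 0 T, HasDerivAt E (E' t) t)
    (hE0 : E 0 = 0) (hEnn : ∀ t ∈ Icc 0 T, 0 ≤ E t) (hS : ContinuousOn S (Icc 0 T))
    (hSnn : ∀ t ∈ Icc 0 T, 0 ≤ S t)
    (h : ∀ t ∈ Ioo 0 T, ∀ μ > 0, E' t + S t ≤ μ * A ^ 2 + E t / μ + A ^ 2) :
    ∀ t ∈ Icc 0 T, √(E t) + √(∫ τ in (0 : ℝ)..t, S τ) ≤ 3 * A * (1 + t) := by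
  intro t ht
  set Y : ℝ → ℝ := fun t => E t + ∫ τ in (0 : ℝ)..t, S τ with hY
  have hQd := hasDerivWithinAt_primitive hS
  have hQc : ContinuousOn (fun t => ∫ τ in (0 : ℝ)..t, S τ) (Icc 0 T) :=
    fun s hs => (hQd s hs).continuousWithinAt
  have hQnn : ∀ s ∈ Icc 0 T, 0 ≤ ∫ τ in (0 : ℝ)..s, S τ := fun s hs =>
    intervalIntegral.integral_nonneg hs.1 fun τ hτ => hSnn τ ⟨hτ.1, hτ.2.trans hs.2⟩
  have hYc : ContinuousOn Y (Icc 0 T) := hE.add hQc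
  have hYnn : ∀ s ∈ Icc 0 T, 0 ≤ Y s := fun s hs => add_nonneg (hEnn s hs) (hQnn s hs)
  -- The shift by `A ^ 2` keeps the root differentiable where the energy vanishes, and gives `A ≤
  -- Z`.
  set Z : ℝ → ℝ := fun t => √(Y t + A ^ 2) with hZ
  have hZc : ContinuousOn Z (Icc 0 T) := (hYc.add continuousOn_const).sqrt
  have hZd : ∀ s ∈ Ioo 0 T, HasDerivAt Z ((E' s + S s) / (2 * Z s)) s := by
    intro s hs
    have hs' := Ioo_subset_Icc_self hs
    have h1 := (hQd s hs').hasDerivAt (Icc_mem_nhds hs.1 hs.2)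
    have h2 : HasDerivAt (fun t => Y t + A ^ 2) (E' s + S s) s := ((hE' s hs).add h1).add_const _
    have hpos : Y s + A ^ 2 ≠ 0 := by
      have := hYnn s hs'
      positivity
    exact h2.sqrt hpos
  have hZ0 : Z 0 = A := by
    simp only [hZ, hY, hE0, intervalIntegral.integral_same, zero_add]
    exact Real.sqrt_sq hA.le
  have hZb : ∀ s ∈ Ioo 0 T, (E' s + S s) / (2 * Z s) ≤ 3 / 2 * A := by
    intro s hs
    have hs' := Ioo_subset_Icc_self hs
    have hYs := hYnn s hs'
    have hZA : A ≤ Z s := Real.le_sqrt_of_sq_le (by linarith)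
    have hZpos : 0 < Z s := hA.trans_le hZA
    have hZsq : Z s ^ 2 = Y s + A ^ 2 := Real.sq_sqrt (by positivity)
    -- With this weight both `μ * A ^ 2` and `E / μ` are at most `A * Z`. As `A ^ 2 ≤ A * Z` too,
    -- the derivative of `Z ^ 2` is at most `3 * A * Z`, so `Z` grows at most linearly.
    have h1 := h s hs (Z s / A) (by positivity)
    have hEY : E s ≤ Z s ^ 2 := by
      rw [hZsq]
      have := hQnn s hs'
      have : 0 ≤ A ^ 2 := by positivity
      simp only [hY]; linarith
    have h2 : E s / (Z s / A) ≤ Z s * A := by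
      rw [div_div_eq_mul_div, div_le_iff₀ hZpos]
      nlinarith
    have h3 : Z s / A * A ^ 2 = Z s * A := by field_simp
    rw [div_le_iff₀ (by positivity)]
    nlinarith
  have hmv := Convex.image_sub_le_mul_sub_of_deriv_le (convex_Icc 0 T) hZc
    (fun s hs => by
      rw [interior_Icc] at hs
      exact (hZd s hs).differentiableAt.differentiableWithinAt) (C := 3 / 2 * A)
    (fun s hs => by
      rw [interior_Icc] at hs
      rw [(hZd s hs).deriv]
      exact hZb s hs) 0 ⟨le_rfl, ht.1.trans ht.2⟩ t ht ht.1
  rw [hZ0, sub_zero] at hmv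
  have hA2 : 0 ≤ A ^ 2 := by positivity
  have h1 : √(E t) ≤ Z t := Real.sqrt_le_sqrt (by
    have := hQnn t ht
    simp only [hY]; linarith)
  have h2 : √(∫ τ in (0 : ℝ)..t, S τ) ≤ Z t := Real.sqrt_le_sqrt (by
    have := hEnn t ht
    simp only [hY]; linarith)
  nlinarith [ht.1]

open Filter Topology

namespace Mesh

variable {N k : ℕ} (Th : Mesh N)

/-! ### Error equations -/

/-- Subtracting the term `i = 0` leaves the projection, and all later terms already belong to the
finite element space. -/
lemma exists_interpolant (k : ℕ) (lam θ : ℝ) (F : ℕ → ℝ → ℝ) (ℓ : ℕ) :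
    ∃ p q : Vh N k, ∀ j x,
      p.toBroken j x = F 0 x - ∑ i ∈ Finset.range (ℓ + 1), (Th.corrOp k lam θ i F).1 j x ∧
      q.toBroken j x = F 1 x - ∑ i ∈ Finset.range (ℓ + 1), (Th.corrOp k lam θ i F).2 j x := by
  induction ℓ with
  | zero =>
    refine ⟨Th.projU k θ (fun _ => F 0), Th.projQ k lam θ (fun _ => F 0) (fun _ => F 1),
      fun j x => ?_⟩
    simp [corrOp]
  | succ ℓ ih =>
    obtain ⟨p, q, h⟩ := ih
    refine ⟨p - Th.stepU k θ (Th.corrOp k lam θ ℓ F).2,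
      q - Th.stepQ k lam θ (Th.stepU k θ (Th.corrOp k lam θ ℓ F).2).toBroken
        (Th.corrOp k lam θ ℓ (evo F)).1, fun j x => ?_⟩
    rw [Vh.toBroken_sub, Vh.toBroken_sub, (h j x).1, (h j x).2, Finset.sum_range_succ _ (ℓ + 1),
      Finset.sum_range_succ _ (ℓ + 1)]
    simp only [corrOp]
    constructor <;> ring

lemma cellInner_sub_sum {n : ℕ} (j : Fin N) {f h v : ℝ → ℝ} {g : ℕ → ℝ → ℝ}
    (hf : ContinuousOn f (Icc (Th.left j) (Th.right j)))
    (hg : ∀ i, ContinuousOn (g i) (Icc (Th.left j) (Th.right j)))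
    (hh : ContinuousOn h (Icc (Th.left j) (Th.right j)))
    (hv : ContinuousOn v (Icc (Th.left j) (Th.right j))) :
    Th.cellInner j (fun x => f x - ∑ i ∈ Finset.range n, g i x - h x) v
      = Th.cellInner j f v - ∑ i ∈ Finset.range n, Th.cellInner j (g i) v
        - Th.cellInner j h v := by
  have hs : ContinuousOn (fun x => ∑ i ∈ Finset.range n, g i x) (Icc (Th.left j) (Th.right j)) :=
    continuousOn_finsetSum _ fun i _ => hg i
  have h1 := Th.cellInner_sum_left (Finset.range n) j (fun _ => 1) g hg hv
  simp only [one_mul] at h1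
  rw [Th.cellInner_sub j (f₁ := fun x => f x - ∑ i ∈ Finset.range n, g i x) (hf.sub hs) hh hv,
    Th.cellInner_sub j hf hs hv, h1]

lemma wavg_sub_sum {n : ℕ} (θ : ℝ) (f h : Broken N) (g : ℕ → Broken N) (j : Fin N) :
    Th.wavg θ (fun j x => f j x - ∑ i ∈ Finset.range n, g i j x - h j x) j
      = Th.wavg θ f j - ∑ i ∈ Finset.range n, Th.wavg θ (g i) j - Th.wavg θ h j := by
  simp only [wavg, minus, plus, Finset.sum_add_distrib, ← Finset.mul_sum]
  ring

lemma wavg_periodic (θ : ℝ) {f : ℝ → ℝ} (hf : f 0 = f (2 * Real.pi)) (j : Fin N) :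
    Th.wavg θ (fun _ => f) j = f (Th.right j) ∧
    Th.wavg θ (fun _ => f) ((finRotate N).symm j) = f (Th.left j) := by
  have h : ∀ j, Th.wavg θ (fun _ => f) j = f (Th.right j) := by
    intro j
    unfold wavg minus plus
    beta_reduce
    rw [Th.periodic_left_rotate hf]; ring
  refine ⟨h j, ?_⟩
  rw [h, ← Th.periodic_left_rotate hf, Equiv.apply_symm_apply]

variable {lam θ : ℝ}

/-- The telescoping at the heart of supercloseness. Orthogonality of the projection errors to `v'`
starts the induction, and each new correction cancels the residual left so far, replacing it by its
own. -/
lemma corrOp_sum_inner (hθ : θ ≠ 1 / 2) {F : ℕ → ℝ → ℝ} (hF : JetCont F) (j : Fin N) {v : ℝ[X]}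
    (hv : v ∈ degreeLT ℝ (k + 1)) {ℓ : ℕ} (hℓ : ℓ ≤ k) :
    ∑ i ∈ Finset.range (ℓ + 1), Th.cellInner j ((Th.corrOp k lam θ i (evo F)).1 j)
          (fun x => v.eval x)
        - ∑ i ∈ Finset.range (ℓ + 1), Th.cellInner j ((Th.corrOp k lam θ i F).1 j)
          (fun x => (derivative v).eval x)
        + ∑ i ∈ Finset.range (ℓ + 1), Th.cellInner j ((Th.corrOp k lam θ i F).2 j)
          (fun x => (derivative v).eval x)
      = Th.cellInner j ((Th.corrOp k lam θ ℓ (evo F)).1 j) (fun x => v.eval x) ∧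
    ∑ i ∈ Finset.range (ℓ + 1), Th.cellInner j ((Th.corrOp k lam θ i F).2 j) (fun x => v.eval x)
        + ∑ i ∈ Finset.range (ℓ + 1), Th.cellInner j ((Th.corrOp k lam θ i F).1 j)
          (fun x => (derivative v).eval x)
      = Th.cellInner j ((Th.corrOp k lam θ ℓ F).2 j) (fun x => v.eval x) := by
  induction ℓ with
  | zero =>
    have h := Th.corrOp_zero_orth (lam := lam) hθ hF j (derivative_mem_degreeLT hv)
    simp only [zero_add, Finset.range_one, Finset.sum_singleton]
    rw [h.1, h.2]
    simp
  | succ ℓ ih =>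
    obtain ⟨h1, h2⟩ := ih (by omega)
    obtain ⟨h3, h4⟩ := Th.corrOp_succ_inner_derivative (lam := lam) hθ (i := ℓ) (by omega) hF j hv
    simp only [Finset.sum_range_succ _ (ℓ + 1)]
    constructor
    · linear_combination h1 + h4
    · linear_combination h2 + h3

/-- The error equations at a fixed time. -/
lemma error_equations (hθ : θ ≠ 1 / 2) {F : ℕ → ℝ → ℝ} (hF : JetCont F) {K : ℝ}
    (hR : JetReg 2 K F) (h0 : F 0 0 = F 0 (2 * Real.pi)) (h1 : F 1 0 = F 1 (2 * Real.pi))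
    {ℓ : ℕ} (hℓ : ℓ ≤ k) {d du : Broken N} (hdu : Th.CellCont du) {p q : Broken N} {uh qh : Vh N k}
    (hp : ∀ j x, p j x = F 0 x - ∑ i ∈ Finset.range (ℓ + 1), (Th.corrOp k lam θ i F).1 j x
      - uh.toBroken j x)
    (hq : ∀ j x, q j x = F 1 x - ∑ i ∈ Finset.range (ℓ + 1), (Th.corrOp k lam θ i F).2 j x
      - qh.toBroken j x)
    (hd : ∀ j x, d j x = evo F 0 x
      - ∑ i ∈ Finset.range (ℓ + 1), (Th.corrOp k lam θ i (evo F)).1 j x - du j x)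
    (v : Vh N k) (j : Fin N)
    (hs1 : Th.cellInner j (du j) (v.toBroken j)
      - Th.cellInner j (fun x => uh.toBroken j x - qh.toBroken j x) (v.dx j)
      + (Th.wavg lam uh.toBroken j - Th.wavg (1 - θ) qh.toBroken j) * v.toBroken j (Th.right j)
      - (Th.wavg lam uh.toBroken ((finRotate N).symm j)
          - Th.wavg (1 - θ) qh.toBroken ((finRotate N).symm j)) * v.toBroken j (Th.left j) = 0)
    (hs2 : Th.cellInner j (qh.toBroken j) (v.toBroken j)
      + Th.cellInner j (uh.toBroken j) (v.dx j)
      - Th.wavg θ uh.toBroken j * v.toBroken j (Th.right j)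
      + Th.wavg θ uh.toBroken ((finRotate N).symm j) * v.toBroken j (Th.left j) = 0) :
    (Th.cellInner j (d j) (v.toBroken j)
      - Th.cellInner j (p j) (v.dx j) + Th.cellInner j (q j) (v.dx j)
      + (Th.wavg lam p j - Th.wavg (1 - θ) q j) * v.toBroken j (Th.right j)
      - (Th.wavg lam p ((finRotate N).symm j)
          - Th.wavg (1 - θ) q ((finRotate N).symm j)) * v.toBroken j (Th.left j)
      = - Th.cellInner j ((Th.corrOp k lam θ ℓ (evo F)).1 j) (v.toBroken j)) ∧
    (Th.cellInner j (q j) (v.toBroken j) + Th.cellInner j (p j) (v.dx j)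
      - Th.wavg θ p j * v.toBroken j (Th.right j)
      + Th.wavg θ p ((finRotate N).symm j) * v.toBroken j (Th.left j)
      = - Th.cellInner j ((Th.corrOp k lam θ ℓ F).2 j) (v.toBroken j)) := by
  obtain rfl : p = fun j x => F 0 x - ∑ i ∈ Finset.range (ℓ + 1), (Th.corrOp k lam θ i F).1 j x
      - uh.toBroken j x := funext fun j => funext fun x => hp j x
  obtain rfl : q = fun j x => F 1 x - ∑ i ∈ Finset.range (ℓ + 1), (Th.corrOp k lam θ i F).2 j x
      - qh.toBroken j x := funext fun j => funext fun x => hq j x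
  obtain rfl : d = fun j x => evo F 0 x
      - ∑ i ∈ Finset.range (ℓ + 1), (Th.corrOp k lam θ i (evo F)).1 j x - du j x :=
    funext fun j => funext fun x => hd j x
  have hv : ContinuousOn (v.toBroken j) (Icc (Th.left j) (Th.right j)) :=
    (v.toBroken_continuous j).continuousOn
  have hvx : ContinuousOn (v.dx j) (Icc (Th.left j) (Th.right j)) :=
    (derivative (v j : ℝ[X])).continuous.continuousOn
  have cF : ∀ m, ContinuousOn (F m) (Icc (Th.left j) (Th.right j)) :=
    fun m => (hF m).mono (Th.cell_subset j)
  have cE : ContinuousOn (evo F 0) (Icc (Th.left j) (Th.right j)) :=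
    (hF.evo 0).mono (Th.cell_subset j)
  have cW := fun i => Th.corrOp_cellCont (k := k) (lam := lam) (θ := θ) i hF
  have cW' := fun i => Th.corrOp_cellCont (k := k) (lam := lam) (θ := θ) i hF.evo
  have cu : ContinuousOn (uh.toBroken j) (Icc (Th.left j) (Th.right j)) :=
    CellCont.toBroken Th uh j
  have cq : ContinuousOn (qh.toBroken j) (Icc (Th.left j) (Th.right j)) :=
    CellCont.toBroken Th qh j
  have hsum := Th.corrOp_sum_inner (lam := lam) hθ hF j (v j).2 hℓ
  have hder : ∀ m < 2, ∀ x ∈ Icc (Th.left j) (Th.right j),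
      HasDerivWithinAt (F m) (F (m + 1) x) (Icc (Th.left j) (Th.right j)) x := fun m hm x hx =>
    (hR.hasDeriv m hm x (Th.cell_subset j hx)).mono (Th.cell_subset j)
  have ex1 := integral_mul_derivative (Th.left_le_right j) (hder 0 (by norm_num)) (cF 1) (v j : ℝ[X])
  have ex2 := integral_mul_derivative (Th.left_le_right j) (hder 1 (by norm_num)) (cF 2) (v j : ℝ[X])
  change Th.cellInner j (F 0) (v.dx j) = F 0 (Th.right j) * v.toBroken j (Th.right j)
    - F 0 (Th.left j) * v.toBroken j (Th.left j) - Th.cellInner j (F 1) (v.toBroken j) at ex1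
  change Th.cellInner j (F 1) (v.dx j) = F 1 (Th.right j) * v.toBroken j (Th.right j)
    - F 1 (Th.left j) * v.toBroken j (Th.left j) - Th.cellInner j (F 2) (v.toBroken j) at ex2
  have ex3 : Th.cellInner j (evo F 0) (v.toBroken j)
      = Th.cellInner j (F 2) (v.toBroken j) - Th.cellInner j (F 1) (v.toBroken j) :=
    Th.cellInner_sub j (cF 2) (cF 1) hv
  have w0 := fun i j => (Th.corrOp_wavg (k := k) (lam := lam) hθ i hF j).1
  have w1 := fun i j => (Th.corrOp_wavg (k := k) (lam := lam) hθ i hF j).2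
  have wl := Th.wavg_periodic lam h0 j
  have wt := Th.wavg_periodic θ h0 j
  have wq := Th.wavg_periodic (1 - θ) h1 j
  rw [Th.cellInner_sub j cu cq hvx] at hs1
  have a1 := Th.cellInner_sub_sum (n := ℓ + 1) j cE (fun i => (cW' i).1 j) (hdu j) hv
  have a2 := Th.cellInner_sub_sum (n := ℓ + 1) j (cF 0) (fun i => (cW i).1 j) cu hvx
  have a3 := Th.cellInner_sub_sum (n := ℓ + 1) j (cF 1) (fun i => (cW i).2 j) cq hvx
  have a4 := Th.cellInner_sub_sum (n := ℓ + 1) j (cF 1) (fun i => (cW i).2 j) cq hv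
  have b1 := fun j => Th.wavg_sub_sum (n := ℓ + 1) lam (fun _ => F 0) uh.toBroken
    (fun i => (Th.corrOp k lam θ i F).1) j
  have b2 := fun j => Th.wavg_sub_sum (n := ℓ + 1) (1 - θ) (fun _ => F 1) qh.toBroken
    (fun i => (Th.corrOp k lam θ i F).2) j
  have b3 := fun j => Th.wavg_sub_sum (n := ℓ + 1) θ (fun _ => F 0) uh.toBroken
    (fun i => (Th.corrOp k lam θ i F).1) j
  -- The `θ`-averages of the `u`-corrections vanish. The `(1 - θ)`-averages of the `q`-corrections
  -- become `lam`-averages of the `u`-corrections and cancel against those in `b1`.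
  simp only [w0, w1, Finset.sum_const_zero] at b2 b3
  rw [b1, b1, b2, b2, b3, b3]
  beta_reduce
  rw [a1, a2, a3, a4, wl.1, wl.2, wt.1, wt.2, wq.1, wq.2, ex1, ex2, ex3]
  obtain ⟨s1, s2⟩ := hsum
  change ∑ i ∈ Finset.range (ℓ + 1), Th.cellInner j ((Th.corrOp k lam θ i (evo F)).1 j)
        (v.toBroken j)
      - ∑ i ∈ Finset.range (ℓ + 1), Th.cellInner j ((Th.corrOp k lam θ i F).1 j) (v.dx j)
      + ∑ i ∈ Finset.range (ℓ + 1), Th.cellInner j ((Th.corrOp k lam θ i F).2 j) (v.dx j)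
      = Th.cellInner j ((Th.corrOp k lam θ ℓ (evo F)).1 j) (v.toBroken j) at s1
  change ∑ i ∈ Finset.range (ℓ + 1), Th.cellInner j ((Th.corrOp k lam θ i F).2 j) (v.toBroken j)
      + ∑ i ∈ Finset.range (ℓ + 1), Th.cellInner j ((Th.corrOp k lam θ i F).1 j) (v.dx j)
      = Th.cellInner j ((Th.corrOp k lam θ ℓ F).2 j) (v.toBroken j) at s2
  constructor
  · linear_combination -hs1 - s1
  · linear_combination -hs2 - s2

/-- The energy inequality at a fixed time. -/
lemma energy_inequality (hlam : 1 / 2 ≤ lam) {p q : Vh N k} {d wu wq : Broken N} {a : ℝ}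
    (hwu : Th.Bdd wu a) (hwq : Th.Bdd wq a) (cwu : Th.CellCont wu) (cwq : Th.CellCont wq)
    (h1 : ∀ j, Th.cellInner j (d j) (p.toBroken j)
      - Th.cellInner j (p.toBroken j) (p.dx j) + Th.cellInner j (q.toBroken j) (p.dx j)
      + (Th.wavg lam p.toBroken j - Th.wavg (1 - θ) q.toBroken j) * p.toBroken j (Th.right j)
      - (Th.wavg lam p.toBroken ((finRotate N).symm j)
          - Th.wavg (1 - θ) q.toBroken ((finRotate N).symm j)) * p.toBroken j (Th.left j)
      = - Th.cellInner j (wu j) (p.toBroken j))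
    (h2 : ∀ j, Th.cellInner j (q.toBroken j) (q.toBroken j)
      + Th.cellInner j (p.toBroken j) (q.dx j)
      - Th.wavg θ p.toBroken j * q.toBroken j (Th.right j)
      + Th.wavg θ p.toBroken ((finRotate N).symm j) * q.toBroken j (Th.left j)
      = - Th.cellInner j (wq j) (q.toBroken j)) {μ : ℝ} (hμ : 0 < μ) :
    ∑ j, 2 * Th.cellInner j (d j) (p.toBroken j)
        + ∑ j, Th.cellInner j (q.toBroken j) (q.toBroken j)
      ≤ μ * (3 * a) ^ 2 + (∑ j, Th.cellInner j (p.toBroken j) (p.toBroken j)) / μ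
        + (3 * a) ^ 2 := by
  have hn := Th.energy_nonneg (θ := θ) hlam p q
  have e : ∀ j, (- Th.cellInner j (fun x => p.toBroken j x - q.toBroken j x) (p.dx j)
      + (Th.wavg lam p.toBroken j - Th.wavg (1 - θ) q.toBroken j) * p.toBroken j (Th.right j)
      - (Th.wavg lam p.toBroken ((finRotate N).symm j)
          - Th.wavg (1 - θ) q.toBroken ((finRotate N).symm j)) * p.toBroken j (Th.left j)
      + Th.cellInner j (p.toBroken j) (q.dx j)
      - Th.wavg θ p.toBroken j * q.toBroken j (Th.right j)
      + Th.wavg θ p.toBroken ((finRotate N).symm j) * q.toBroken j (Th.left j))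
      = - Th.cellInner j (wu j) (p.toBroken j) - Th.cellInner j (wq j) (q.toBroken j)
        - Th.cellInner j (d j) (p.toBroken j)
        - Th.cellInner j (q.toBroken j) (q.toBroken j) := by
    intro j
    rw [Th.cellInner_sub j (CellCont.toBroken Th p j) (CellCont.toBroken Th q j)
      (show ContinuousOn (p.dx j) _ from (derivative (p j : ℝ[X])).continuous.continuousOn)]
    linear_combination h1 j + h2 j
  rw [Finset.sum_congr rfl fun j _ => e j, Finset.sum_sub_distrib, Finset.sum_sub_distrib,
    Finset.sum_sub_distrib, Finset.sum_neg_distrib] at hn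
  have b1 := Th.neg_sum_cellInner_le hwu cwu (CellCont.toBroken Th p) hμ
  -- With weight `1`, the quadratic term in `q` is absorbed by the dissipation; the weight for `p`
  -- stays free for the Gronwall argument.
  have b2 := Th.neg_sum_cellInner_le hwq cwq (CellCont.toBroken Th q) one_pos
  rw [← Finset.mul_sum]
  rw [one_mul, div_one] at b2
  linarith

end Mesh

open Filter Topology

/-! ### The supercloseness estimate -/

namespace Mesh

variable {N k : ℕ} (Th : Mesh N)

lemma timeDeriv_cellCont {T t : ℝ} (hT : 0 < T) (ht : t ∈ Icc 0 T) {uh : ℝ → Vh N k}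
    (hd : ∀ j x, DifferentiableWithinAt ℝ (fun s => (uh s).toBroken j x) (Icc 0 T) t) :
    Th.CellCont (timeDeriv T (fun s => (uh s).toBroken) t) := by
  intro j
  obtain ⟨y, l, -, hl⟩ := exists_lagrange (k := k) (Th.left_lt_right j)
  have e : ∀ x, timeDeriv T (fun s => (uh s).toBroken) t j x
      = ∑ i, timeDeriv T (fun s => (uh s).toBroken) t j (y i) * (l i).eval x := by
    intro x
    have h1 : (fun s => (uh s).toBroken j x)
        = fun s => ∑ i, (uh s).toBroken j (y i) * (l i).eval x := by
      ext s; exact hl _ (uh s j).2 x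
    have h2 : HasDerivWithinAt (fun s => (uh s).toBroken j x)
        (∑ i, timeDeriv T (fun s => (uh s).toBroken) t j (y i) * (l i).eval x) (Icc 0 T) t := by
      rw [h1]
      exact HasDerivWithinAt.fun_sum fun i _ => (hd j (y i)).hasDerivWithinAt.mul_const _
    exact h2.derivWithin (uniqueDiffOn_Icc hT t ht)
  exact (continuousOn_finsetSum _ fun i _ =>
    continuousOn_const.mul (l i).continuous.continuousOn).congr fun x _ => e x

/-- Supercloseness, for a solution given with its spatial derivatives. -/
lemma supercloseness {T : ℝ} (hT : 0 < T) {u : ℝ → ℝ → ℝ} (hu : IsPeriodicSolution T u)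
    {ℓ : ℕ} (hℓ : 1 ≤ ℓ) (hℓk : ℓ ≤ k) {lam θ : ℝ} (hlam : 1 / 2 ≤ lam) (hθ : θ ≠ 1 / 2)
    {K : ℝ} (hK : 0 ≤ K) {U : ℝ → ℕ → ℝ → ℝ} (hU : JetFlow (k + ℓ + 2) K T u U)
    {uh qh : ℝ → Vh N k} (hs : Th.IsLDGSolution lam θ T uh qh)
    (hinit : Th.l2norm (fun j x => Th.uI k ℓ lam θ T u 0 j x - (uh 0).toBroken j x) = 0)
    {a : ℝ} (ha : 0 < a)
    (hau : ∀ t ∈ Icc 0 T, Th.Bdd (Th.corrOp k lam θ ℓ (evo (U t))).1 a)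
    (haq : ∀ t ∈ Icc 0 T, Th.Bdd (Th.corrOp k lam θ ℓ (U t)).2 a) :
    ∀ t ∈ Icc 0 T,
      IntervalIntegrable
        (fun τ => Th.l2norm (fun j x => Th.qI k ℓ lam θ T u τ j x - (qh τ).toBroken j x) ^ 2)
        volume 0 t ∧
      Th.l2norm (fun j x => Th.uI k ℓ lam θ T u t j x - (uh t).toBroken j x)
        + √(∫ τ in (0 : ℝ)..t,
            Th.l2norm (fun j x => Th.qI k ℓ lam θ T u τ j x - (qh τ).toBroken j x) ^ 2)
        ≤ 3 * (3 * a) * (1 + t) := by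
  have hex := fun t => Th.exists_interpolant k lam θ (U t) ℓ
  choose pI qI' hI using hex
  set p : ℝ → Vh N k := fun t => pI t - uh t with hpdef
  set q : ℝ → Vh N k := fun t => qI' t - qh t with hqdef
  have hp : ∀ t j x, (p t).toBroken j x = U t 0 x
      - ∑ i ∈ Finset.range (ℓ + 1), (Th.corrOp k lam θ i (U t)).1 j x - (uh t).toBroken j x :=
    fun t j x => by rw [Vh.toBroken_sub, (hI t j x).1]
  have hq : ∀ t j x, (q t).toBroken j x = U t 1 x
      - ∑ i ∈ Finset.range (ℓ + 1), (Th.corrOp k lam θ i (U t)).2 j x - (qh t).toBroken j x :=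
    fun t j x => by rw [Vh.toBroken_sub, (hI t j x).2]
  set E : ℝ → ℝ := fun t => ∑ j, Th.cellInner j ((p t).toBroken j) ((p t).toBroken j) with hE
  set Q : ℝ → ℝ := fun t => ∑ j, Th.cellInner j ((q t).toBroken j) ((q t).toBroken j) with hQ
  have hUI := hU.uI_eq Th (k := k) (lam := lam) hu hK hT hθ (ℓ := ℓ) (by omega) (by omega)
  have hEl : ∀ t ∈ Icc 0 T,
      Th.l2norm (fun j x => Th.uI k ℓ lam θ T u t j x - (uh t).toBroken j x) = √(E t) := by
    intro t ht
    unfold l2norm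
    congr 1
    refine Finset.sum_congr rfl fun j _ => ?_
    have h1 : ∀ x ∈ Icc (Th.left j) (Th.right j),
        Th.uI k ℓ lam θ T u t j x - (uh t).toBroken j x = (p t).toBroken j x := fun x hx => by
      rw [hp, (hUI t ht j x hx).1]
    exact Th.cellInner_congr j h1 h1
  have hQl : ∀ t ∈ Icc 0 T,
      Th.l2norm (fun j x => Th.qI k ℓ lam θ T u t j x - (qh t).toBroken j x) ^ 2 = Q t := by
    intro t ht
    rw [l2norm_sq]
    refine Finset.sum_congr rfl fun j _ => ?_
    have h1 : ∀ x ∈ Icc (Th.left j) (Th.right j),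
        Th.qI k ℓ lam θ T u t j x - (qh t).toBroken j x = (q t).toBroken j x := fun x hx => by
      rw [hq, (hUI t ht j x hx).2]
    exact Th.cellInner_congr j h1 h1
  set D : ℝ → Broken N := fun t j x => evo (U t) 0 x
    - ∑ i ∈ Finset.range (ℓ + 1), (Th.corrOp k lam θ i (evo (U t))).1 j x
    - timeDeriv T (fun s => (uh s).toBroken) t j x with hD
  have hU0d : ∀ t ∈ Icc 0 T, ∀ x ∈ Icc 0 (2 * Real.pi),
      HasDerivWithinAt (fun s => U s 0 x) (evo (U t) 0 x) (Icc 0 T) t := by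
    intro t ht x hx
    rw [hasDerivWithinAt_iff_isLittleO, Asymptotics.isLittleO_iff]
    intro c hc
    filter_upwards [hU.eventually_diff hu hK ht (m := 0) (by omega) hc] with s hs
    exact hs x hx
  have hpI : ∀ t ∈ Icc 0 T, ∀ j, ∀ x ∈ Icc (Th.left j) (Th.right j),
      HasDerivWithinAt (fun s => U s 0 x
        - ∑ i ∈ Finset.range (ℓ + 1), (Th.corrOp k lam θ i (U s)).1 j x)
        (evo (U t) 0 x - ∑ i ∈ Finset.range (ℓ + 1), (Th.corrOp k lam θ i (evo (U t))).1 j x)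
        (Icc 0 T) t := by
    intro t ht j x hx
    refine (hU0d t ht x (Th.cell_subset j hx)).sub (HasDerivWithinAt.fun_sum fun i hi => ?_)
    have := Finset.mem_range.mp hi
    exact hU.corrOp_hasDerivWithinAt Th hu hK hθ (by omega) ht j hx
  have hpc : ∀ j, ∀ x ∈ Icc (Th.left j) (Th.right j),
      ContinuousOn (fun s => (p s).toBroken j x) (Icc 0 T) := by
    intro j x hx
    simp only [hp]
    exact ContinuousOn.sub (fun t ht => (hpI t ht j x hx).continuousWithinAt)
      (hs.continuousOn j x)
  have hpd : ∀ t ∈ Ioc 0 T, ∀ j, ∀ x ∈ Icc (Th.left j) (Th.right j),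
      HasDerivWithinAt (fun s => (p s).toBroken j x) (D t j x) (Icc 0 T) t := by
    intro t ht j x hx
    simp only [hp]
    exact (hpI t (Ioc_subset_Icc_self ht) j x hx).sub
      (hs.differentiable t ht j x).hasDerivWithinAt
  have hEc : ContinuousOn E (Icc 0 T) :=
    continuousOn_finsetSum _ fun j _ => Th.continuousOn_cellInner_self (hpc j)
  have hEd : ∀ t ∈ Ioo 0 T,
      HasDerivAt E (∑ j, 2 * Th.cellInner j (D t j) ((p t).toBroken j)) t := by
    intro t ht
    refine HasDerivWithinAt.hasDerivAt ?_ (Icc_mem_nhds ht.1 ht.2)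
    exact HasDerivWithinAt.fun_sum fun j _ => Th.hasDerivWithinAt_cellInner_self
      (uniqueDiffOn_Icc hT t (Ioo_subset_Icc_self ht)) (hpd t (Ioo_subset_Ioc_self ht) j)
  have herr : ∀ t ∈ Ioc 0 T, ∀ (v : Vh N k) (j : Fin N), _ := fun t ht v j => by
    have ht' := Ioc_subset_Icc_self ht
    have hpi : (0 : ℝ) ≤ 2 * Real.pi := by positivity
    have m0 : (0 : ℝ) ∈ Icc 0 (2 * Real.pi) := ⟨le_rfl, hpi⟩
    have m1 : 2 * Real.pi ∈ Icc 0 (2 * Real.pi) := ⟨hpi, le_rfl⟩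
    have hper := hu.periodic t ht'
    exact Th.error_equations (ℓ := ℓ) (p := (p t).toBroken) (q := (q t).toBroken) (d := D t)
      (du := timeDeriv T (fun s => (uh s).toBroken) t) (uh := uh t) (qh := qh t)
      hθ (hU.cont t ht') ((hU.reg t ht').mono (by omega))
      (by
        rw [hU.eq t ht' _ m0, hU.eq t ht' _ m1]
        simpa using (hper 0).symm)
      (by
        rw [(hU.eq_deriv hu (by omega) ht' m0).1, (hU.eq_deriv hu (by omega) ht' m1).1]
        have h1 : (fun x => u t (x + 2 * Real.pi)) = u t := funext hper
        have h2 := deriv_comp_add_const (u t) (2 * Real.pi) 0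
        rw [h1, zero_add] at h2
        exact h2)
      hℓk (Th.timeDeriv_cellCont hT ht' (hs.differentiable t ht)) (hp t) (hq t)
      (fun _ _ => rfl) v j (hs.eq_u t ht v j) (hs.eq_q t ht v j)
  -- A positive index makes the last `q`-correction a finite element function, so its moments are
  -- continuous in time by `continuousOn_cellInner`.
  obtain ⟨ℓ', rfl⟩ : ∃ ℓ', ℓ = ℓ' + 1 := ⟨ℓ - 1, by omega⟩
  -- No regularity of `qh` in time is assumed. The second error equation, however, expresses the
  -- moments of the `q`-error for `t > 0` through quantities continuous on all of `[0, T]`.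
  set Λ : ℝ → Fin N → Vh N k → ℝ := fun t j v =>
    - Th.cellInner j ((Th.corrOp k lam θ (ℓ' + 1) (U t)).2 j) (v.toBroken j)
      - Th.cellInner j ((p t).toBroken j) (v.dx j)
      + Th.wavg θ (p t).toBroken j * v.toBroken j (Th.right j)
      - Th.wavg θ (p t).toBroken ((finRotate N).symm j) * v.toBroken j (Th.left j) with hΛ
  have hwc : ∀ j, ContinuousOn (fun t => Th.wavg θ (p t).toBroken j) (Icc 0 T) := by
    intro j
    unfold wavg minus plus
    exact (continuousOn_const.mul (hpc _ _ (Th.right_mem _))).add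
      (continuousOn_const.mul (hpc _ _ (Th.left_mem _)))
  have hΛc : ∀ j v, ContinuousOn (fun t => Λ t j v) (Icc 0 T) := by
    intro j v
    have c1 : ContinuousOn (fun t => Th.cellInner j
        ((Th.corrOp k lam θ (ℓ' + 1) (U t)).2 j) (v.toBroken j)) (Icc 0 T) :=
      Th.continuousOn_cellInner (p := fun t => Th.stepQ k lam θ
        (Th.stepU k θ (Th.corrOp k lam θ ℓ' (U t)).2).toBroken
        (Th.corrOp k lam θ ℓ' (evo (U t))).1)
        (fun x hx => hU.corrOp_snd_continuousOn Th (k := k) (lam := lam) hu hK hθ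
          (i := ℓ' + 1) (by omega) j hx)
        (v.toBroken_continuous j).continuousOn
    have c2 : ContinuousOn (fun t => Th.cellInner j ((p t).toBroken j) (v.dx j)) (Icc 0 T) :=
      Th.continuousOn_cellInner (hpc j) (derivative (v j : ℝ[X])).continuous.continuousOn
    exact ((c1.neg.sub c2).add ((hwc j).mul continuousOn_const)).sub
      ((hwc _).mul continuousOn_const)
  have hΛq : ∀ t ∈ Ioc 0 T, ∀ j v, Th.cellInner j ((q t).toBroken j) (v.toBroken j) = Λ t j v := by
    intro t ht j v
    have := (herr t ht v j).2
    simp only [hΛ]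
    linarith
  -- The default value `0` is never reached, as only indices `i ≤ k` occur in the sum below.
  set Lg : ℕ → Vh N k := fun i j => if h : i ≤ k then ⟨legOn (Th.left j) (Th.right j) i,
    degreeLT_mono (by omega) (legOn_mem _ _ i)⟩ else 0 with hLg
  have hLgb : ∀ i ∈ Finset.range (k + 1), ∀ j,
      (Lg i).toBroken j = fun x => (legOn (Th.left j) (Th.right j) i).eval x := by
    intro i hi j
    have : i ≤ k := by have := Finset.mem_range.mp hi; omega
    ext x
    simp [Vh.toBroken_apply, hLg, this]
  -- By Parseval, a continuous function on `[0, T]` that equals the squared norm of the `q`-error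
  -- for `t > 0`. The scheme says nothing at `t = 0`, and the integral does not see that point.
  set S : ℝ → ℝ := fun t => ∑ j, ∑ i ∈ Finset.range (k + 1), Λ t j (Lg i) ^ 2
    / Th.cellInner j ((Lg i).toBroken j) ((Lg i).toBroken j) with hS
  have hSc : ContinuousOn S (Icc 0 T) :=
    continuousOn_finsetSum _ fun j _ => continuousOn_finsetSum _ fun i _ =>
      ((hΛc j (Lg i)).pow 2).div_const _
  have hSnn : ∀ t ∈ Icc 0 T, 0 ≤ S t := fun t _ => Finset.sum_nonneg fun j _ =>
    Finset.sum_nonneg fun i _ => div_nonneg (sq_nonneg _) (Th.cellInner_self_nonneg j _)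
  have hSQ : ∀ t ∈ Ioc 0 T, S t = Q t := by
    intro t ht
    refine Finset.sum_congr rfl fun j _ => ?_
    refine Eq.trans ?_ (Th.parseval j (q t j).2).symm
    refine Finset.sum_congr rfl fun i hi => ?_
    rw [← hΛq t ht j (Lg i), hLgb i hi j]
    rfl
  have hQS : ∀ t ∈ Ioc 0 T, S t =
      Th.l2norm (fun j x => Th.qI k (ℓ' + 1) lam θ T u t j x - (qh t).toBroken j x) ^ 2 :=
    fun t ht => (hSQ t ht).trans (hQl t (Ioc_subset_Icc_self ht)).symm
  have hEnn : ∀ t, 0 ≤ E t := fun t => Finset.sum_nonneg fun j _ => Th.cellInner_self_nonneg j _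
  have hE0 : E 0 = 0 := by
    rw [hEl 0 ⟨le_rfl, hT.le⟩, Real.sqrt_eq_zero (hEnn 0)] at hinit
    exact hinit
  have hmain := sqrt_add_sqrt_integral_le (T := T) (A := 3 * a) (by positivity) hEc hEd hE0
    (fun t _ => hEnn t) hSc hSnn (fun t ht μ hμ => by
      have ht' := Ioo_subset_Ioc_self ht
      have htc := Ioo_subset_Icc_self ht
      rw [hSQ t ht']
      exact Th.energy_inequality (θ := θ) hlam (hau t htc) (haq t htc)
        (Th.corrOp_cellCont _ (hU.cont t htc).evo).1 (Th.corrOp_cellCont _ (hU.cont t htc)).2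
        (fun j => (herr t ht' (p t) j).1) (fun j => (herr t ht' (q t) j).2) hμ)
  intro t ht
  have hsub : ∀ τ ∈ uIoc 0 t, S τ = Th.l2norm
      (fun j x => Th.qI k (ℓ' + 1) lam θ T u τ j x - (qh τ).toBroken j x) ^ 2 := by
    intro τ hτ
    rw [uIoc_of_le ht.1] at hτ
    exact hQS τ ⟨hτ.1, hτ.2.trans ht.2⟩
  constructor
  · exact (intervalIntegrable_congr hsub).mp
      ((hSc.mono (Icc_subset_Icc_right ht.2)).intervalIntegrable_of_Icc ht.1)
  · rw [hEl t ht, ← intervalIntegral.integral_congr_ae (ae_of_all _ hsub)]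
    exact hmain t ht

end Mesh

end LDG

theorem mainTheorem1 (k ℓ : ℕ) (hℓ : 1 ≤ ℓ) (hℓk : ℓ ≤ k)
    (lam θ : ℝ) (hlam : 1 / 2 ≤ lam) (hθ : θ ≠ 1 / 2)
    (σ : ℝ) (hσ : 0 < σ) (M : ℝ) :
    ∃ C : ℝ, ∀ (N : ℕ) (Th : LDG.Mesh N), Th.QuasiUniform σ →
      ∀ (T : ℝ), 0 < T → ∀ (u : ℝ → ℝ → ℝ), LDG.IsPeriodicSolution T u →
      (∀ t ∈ Set.Icc 0 T,
        LDG.sobolevNorm (Set.Ioo 0 (2 * Real.pi)) (k + ℓ + 3) (u t) ≤ ENNReal.ofReal M) →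
      ∀ (uh qh : ℝ → LDG.Vh N k), Th.IsLDGSolution lam θ T uh qh →
      Th.l2norm (fun j x => Th.uI k ℓ lam θ T u 0 j x - (uh 0).toBroken j x) = 0 →
      ∀ t ∈ Set.Icc 0 T,
        IntervalIntegrable
          (fun τ => Th.l2norm (fun j x => Th.qI k ℓ lam θ T u τ j x - (qh τ).toBroken j x) ^ 2)
          MeasureTheory.volume 0 t ∧
        Th.l2norm (fun j x => Th.uI k ℓ lam θ T u t j x - (uh t).toBroken j x)
          + √(∫ τ in (0 : ℝ)..t,
              Th.l2norm (fun j x => Th.qI k ℓ lam θ T u τ j x - (qh τ).toBroken j x) ^ 2)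
          ≤ C * (1 + t) * Th.size ^ (k + ℓ + 1) := by
  obtain ⟨C, hC0, hC⟩ := LDG.Mesh.exists_corrOp_error k lam hθ ℓ
  set K := max M 0 + 1 with hKdef
  have hK : 0 < K := by positivity
  refine ⟨9 * (C * (2 * K) + 1), fun N Th _ T hT u hu hM uh qh hs hinit t ht => ?_⟩
  -- Two orders are spent on `evo` and `k + ℓ` on the size of the last `u`-correction; the weak
  -- derivative of order `k + ℓ + 3` supplies the Lipschitz bound at the top.
  obtain ⟨U, hU⟩ := LDG.exists_jetFlow (n := k + ℓ + 2) hu hM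
  have hpos := Th.size_pos
  have hpow : 0 < Th.size ^ (k + ℓ + 1) := by positivity
  have he : k + 1 + ℓ = k + ℓ + 1 := by omega
  -- `evo` doubles the Lipschitz constant, hence `2 * K`; the summand `1` keeps the bound positive
  -- even when `C = 0`.
  have h := Th.supercloseness hT hu hℓ hℓk hlam hθ hK.le hU hs hinit
    (a := (C * (2 * K) + 1) * Th.size ^ (k + ℓ + 1)) (by positivity)
    (fun t ht => LDG.Mesh.Bdd.mono Th
      ((hC N Th _ (hU.cont t ht).evo (2 * K) (by positivity)).1 (hU.reg t ht).evo) (by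
        rw [he]; nlinarith))
    (fun t ht => LDG.Mesh.Bdd.mono Th
      ((hC N Th _ (hU.cont t ht) K hK.le).2 ((hU.reg t ht).mono (by omega))) (by
        rw [he]
        have : C * K ≤ C * (2 * K) + 1 := by nlinarith
        gcongr)) t ht
  refine ⟨h.1, h.2.trans (le_of_eq (by ring))⟩
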